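/- Let $q\in\mathbb C$ be nonzero and not a root of $1$, let $\mathbf i=\sqrt{-1}$, and let $t=\mathbf i\sqrt q$, so $t^2=-q$. **The algebra $\mathcal U=U_q(osp(1,2))$** is the associative $\mathbb C$-algebra with generators $k^{\pm1},e,f$ and relations $kk^{-1}=k^{-1}k=1$, $kek^{-1}=qe$, $kfk^{-1}=q^{-1}f$, $ef+fe=\frac{k-k^{-1}}{q-q^{-1}}$. It is $\mathbb Z_2$-graded by $p(k^{\pm1})=0$, $p(e)=p(f)=1$, and its counit is the algebra homomorphism with $\varepsilon(k^{\pm1})=1$, $\varepsilon(e)=\varepsilon(f)=0$. **The algebra $\mathcal A=\mathbb C_q[osp(1,2)]$** is the associative $\mathbb C$-algebra with generators $a,b,c,d,\sigma$ and relations $$ab=tba,\quad ac=tca,\quad bc=-cb,\quad bd=-tdb,\quad cd=-tdc,$$ $$ad-da=(t^{-1}-t)bc,\quad ad+tbc=\sigma,\quad \sigma^2=1.$$ It is $\mathbb Z_2$-graded by $p(a)=p(d)=p(\sigma)=0$, $p(b)=p(c)=1$. Its comultiplication $\Delta(u)=\sum u_1\otimes u_2$ is the homomorphism of superalgebras $\mathcal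 A\to\mathcal A\otimes\mathcal A$ (with product $(x\otimes y)(x'\otimes y')=(-1)^{p(y)p(x')}xx'\otimes yy'$) given by $$\Delta(a)=a\otimes a+b\otimes c,\quad \Delta(b)=a\otimes b+b\otimes d,\quad \Delta(c)=c\otimes a+d\otimes c,\quad \Delta(d)=c\otimes b+d\otimes d,\quad \Delta(\sigma)=\sigma\otimes\sigma,$$ and its counit is the algebra homomorphism with $\varepsilon(a)=\varepsilon(d)=\varepsilon(\sigma)=1$, $\varepsilon(b)=\varepsilon(c)=0$. **Pairing.** Elements of $\mathcal U$ are viewed as linear functionals on $\mathcal A$: $k^{\pm1}$ are algebra homomorphisms $\mathcal A\to\mathbb C$ with $k^{\pm1}(a)=t^{\pm1}$, $k^{\pm1}(d)=-t^{\mp1}$, $k^{\pm1}(\sigma)=-1$, $k^{\pm1}(b)=k^{\pm1}(c)=0$; the functional $e$ has $e(b)=\frac{t-t^{-1}}{q-q^{-1}}$ and vanishes on $1,a,c,d,\sigma$; the functional $f$ has $f(c)=1$ and vanishes on $1,a,b,d,\sigma$; for homogeneous $x$ and all $y$ in $\mathcal A$, $$e(xy)=e(x)\varepsilon(y)+(-1)^{p(x)}k(x)e(y),\qquad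 f(xy)=f(x)k^{-1}(y)+(-1)^{p(x)}\varepsilon(x)f(y);$$ and products act by $(xy)(u)=\sum x(u_1)y(u_2)$ for $x,y\in\mathcal U$, $u\in\mathcal A$, with $1\in\mathcal U$ acting as $\varepsilon$. **Invariants.** For $x\in\mathcal U$ and $u\in\mathcal A$ put $$R_x(u)=\sum x(u_1)u_2,\qquad L_x(u)=\sum(-1)^{p(x)p(u_1)}x(u_2)u_1$$ (the second formula for homogeneous $x$, extended linearly in $x$). The right (left) invariants of a subspace $J\subseteq\mathcal U$ are the $u\in\mathcal A$ such that $R_x(u)=\varepsilon(x)u$ (respectively $L_x(u)=\varepsilon(x)u$) for all $x\in J$. **Matrix elements.** For $\ell\in\frac12\mathbb Z_+=\{0,\frac12,1,\dots\}$ let $I_\ell=\{-\ell,-\ell+1,\dots,\ell\}$ and $$\xi^{(\ell)}_i=\mathbf i^{[(\ell+i)/2]}\binom{2\ell}{\ell+i}^{1/2}_{t^{-2}}a^{\ell-i}c^{\ell+i}\quad(i\in I_\ell),\qquad \binom mn_v=\frac{(v;v)_m}{(v;v)_n(v;v)_{m-n}},\quad (u;v)_m=\prod_{r=0}^{m-1}(1-uv^r),$$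 where $[\cdot]$ is the integer part and the power $\frac12$ is the principal square root. Let $m^{(\ell)}_{ij}\in\mathcal A$ ($i,j\in I_\ell$) be the elements determined by $\Delta(\xi^{(\ell)}_i)=\sum_{j\in I_\ell}m^{(\ell)}_{ij}\otimes\xi^{(\ell)}_j$, and for $s=0,1$ let $M_\ell\sigma^s$ be the span of the $m^{(\ell)}_{ij}\sigma^s$, $i,j\in I_\ell$. **Theorem.** 1. Let $\alpha,\beta,\gamma\in\mathbb C$ and $x=\alpha e+\beta fk+\gamma(k-1)$. If for every $\ell\in\frac12\mathbb Z_+$ the space $M_\ell+M_\ell\sigma$ contains a nonzero right invariant of $\mathbb Cx$, or if for every $\ell\in\frac12\mathbb Z_+$ it contains a nonzero left invariant of $\mathbb Cx$, then $x$ is a scalar multiple of $e$ or of $fk$. 2. The space of right invariants of $\mathbb Ce$ in $\mathcal A$ is the linear span of the elements $m^{(\ell)}_{\ell j}\sigma^s$ with $\ell\in\frac12\mathbb Z_+$, $j\in I_\ell$, $s\in\{0,1\}$. 3. The space of right invariants of $\mathbb Cfk$ in $\mathcal A$ is the linear span of the elements $m^{(\ell)}_{-\ell j}\sigma^s$ with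 $\ell\in\frac12\mathbb Z_+$, $j\in I_\ell$, $s\in\{0,1\}$. -/

import Mathlib

open scoped TensorProduct

set_option linter.unusedSimpArgs false
set_option linter.unusedTactic false
set_option linter.unreachableTactic false
set_option linter.unnecessarySeqFocus false

noncomputable section

namespace QuantumOSp

/-- The parameters: `q ≠ 0` is a complex number that is not a root of `1`, and `t = i √q` for one
of the two square roots of `q`, that is, `t² = -q`. -/
structure Params where
  q : ℂ
  t : ℂ
  q_ne_zero : q ≠ 0
  q_pow_ne_one : ∀ n : ℕ, 0 < n → q ^ n ≠ 1
  t_sq : t ^ 2 = -q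

theorem Params.t_ne_zero (P : Params) : P.t ≠ 0 := by
  intro h
  have := P.t_sq
  rw [h] at this
  exact P.q_ne_zero (by simpa using this.symm)

theorem Params.t_mul_inv (P : Params) : P.t * P.t⁻¹ = 1 := mul_inv_cancel₀ P.t_ne_zero

/-! ### Superalgebras given by a parity automorphism -/

section Super

variable {B : Type} [Ring B] [Algebra ℂ B]

/-- The `ℤ/2`-grading of an algebra attached to a parity automorphism `θ`: the even elements are
those with `θ x = x`, the odd elements those with `θ x = -x`. -/
def superGrading (θ : B →ₐ[ℂ] B) (i : ZMod 2) : Submodule ℂ B :=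
  LinearMap.ker (θ.toLinearMap - (if i = 0 then (1 : ℂ) else -1) • LinearMap.id)

theorem mem_superGrading (θ : B →ₐ[ℂ] B) (i : ZMod 2) (x : B) :
    x ∈ superGrading θ i ↔ θ x = (if i = 0 then (1 : ℂ) else -1) • x := by
  simp only [superGrading, LinearMap.mem_ker, LinearMap.sub_apply, LinearMap.smul_apply,
    LinearMap.id_apply, AlgHom.toLinearMap_apply, sub_eq_zero]

theorem mem_superGrading_zero (θ : B →ₐ[ℂ] B) (x : B) :
    x ∈ superGrading θ 0 ↔ θ x = x := by
  simp [mem_superGrading]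

theorem mem_superGrading_one (θ : B →ₐ[ℂ] B) (x : B) :
    x ∈ superGrading θ 1 ↔ θ x = -x := by
  simp [mem_superGrading]

/-- The even component of an element. -/
def evenPart (θ : B →ₐ[ℂ] B) : B →ₗ[ℂ] B := (1 / 2 : ℂ) • (LinearMap.id + θ.toLinearMap)

/-- The odd component of an element. -/
def oddPart (θ : B →ₐ[ℂ] B) : B →ₗ[ℂ] B := (1 / 2 : ℂ) • (LinearMap.id - θ.toLinearMap)

theorem evenPart_mem (θ : B →ₐ[ℂ] B) (hθ : ∀ x, θ (θ x) = x) (x : B) :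
    evenPart θ x ∈ superGrading θ 0 := by
  rw [mem_superGrading_zero]
  simp [evenPart, hθ, add_comm]

theorem oddPart_mem (θ : B →ₐ[ℂ] B) (hθ : ∀ x, θ (θ x) = x) (x : B) :
    oddPart θ x ∈ superGrading θ 1 := by
  rw [mem_superGrading_one]
  simp [oddPart, hθ, ← smul_neg]

theorem evenPart_add_oddPart (θ : B →ₐ[ℂ] B) (x : B) : evenPart θ x + oddPart θ x = x := by
  simp only [evenPart, oddPart, LinearMap.smul_apply, LinearMap.add_apply, LinearMap.sub_apply,
    LinearMap.id_apply, AlgHom.toLinearMap_apply]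
  module

/-- The decomposition into even and odd components, as a map into the direct sum. -/
def superDecompose (θ : B →ₐ[ℂ] B) (hθ : ∀ x, θ (θ x) = x) :
    B →ₗ[ℂ] DirectSum (ZMod 2) (fun i => superGrading θ i) :=
  DirectSum.lof ℂ (ZMod 2) (fun i => superGrading θ i) 0 ∘ₗ
      (evenPart θ).codRestrict _ (evenPart_mem θ hθ) +
    DirectSum.lof ℂ (ZMod 2) (fun i => superGrading θ i) 1 ∘ₗ
      (oddPart θ).codRestrict _ (oddPart_mem θ hθ)

/-- The grading by parity makes the algebra a `ℤ/2`-graded algebra. -/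
@[reducible]
def superGradedAlgebra (θ : B →ₐ[ℂ] B) (hθ : ∀ x, θ (θ x) = x) :
    GradedAlgebra (superGrading θ) where
  one_mem := by simp [mem_superGrading_zero]
  mul_mem := by
    intro i j x y hx hy
    have hz : ∀ k : ZMod 2, k = 0 ∨ k = 1 := by decide
    rcases hz i with rfl | rfl <;> rcases hz j with rfl | rfl
    · rw [mem_superGrading_zero] at hx hy
      rw [add_zero, mem_superGrading_zero, map_mul, hx, hy]
    · rw [mem_superGrading_zero] at hx
      rw [mem_superGrading_one] at hy
      rw [zero_add, mem_superGrading_one, map_mul, hx, hy, mul_neg]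
    · rw [mem_superGrading_one] at hx
      rw [mem_superGrading_zero] at hy
      rw [add_zero, mem_superGrading_one, map_mul, hx, hy, neg_mul]
    · rw [mem_superGrading_one] at hx hy
      rw [show (1 : ZMod 2) + 1 = 0 from rfl, mem_superGrading_zero, map_mul, hx, hy, neg_mul_neg]
  toDecomposition := DirectSum.Decomposition.ofLinearMap _ (superDecompose θ hθ)
    (by
      ext x
      simp [superDecompose, evenPart_add_oddPart])
    (by
      have hz : ∀ k : ZMod 2, k = 0 ∨ k = 1 := by decide
      refine DirectSum.linearMap_ext ℂ fun i => LinearMap.ext fun x => ?_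
      obtain ⟨x, hx⟩ := x
      rcases hz i with rfl | rfl
      · have hx' := (mem_superGrading_zero θ x).1 hx
        have e1 : (evenPart θ).codRestrict _ (evenPart_mem θ hθ) x = ⟨x, hx⟩ := by
          apply Subtype.ext
          simp only [LinearMap.codRestrict_apply, evenPart, LinearMap.smul_apply,
            LinearMap.add_apply, LinearMap.id_apply, AlgHom.toLinearMap_apply, hx']
          module
        have e2 : (oddPart θ).codRestrict _ (oddPart_mem θ hθ) x = 0 := by
          apply Subtype.ext
          simp [oddPart, hx']
        simp [superDecompose, e1, e2]
      · have hx' := (mem_superGrading_one θ x).1 hx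
        have e1 : (oddPart θ).codRestrict _ (oddPart_mem θ hθ) x = ⟨x, hx⟩ := by
          apply Subtype.ext
          simp only [LinearMap.codRestrict_apply, oddPart, LinearMap.smul_apply,
            LinearMap.sub_apply, LinearMap.id_apply, AlgHom.toLinearMap_apply, hx']
          module
        have e2 : (evenPart θ).codRestrict _ (evenPart_mem θ hθ) x = 0 := by
          apply Subtype.ext
          simp [evenPart, hx']
        simp [superDecompose, e1, e2])

end Super

/-! ### The quantum supergroup -/

/-- The generators `a, b, c, d, σ`. -/
inductive CGen
  | a | b | c | d | σ

/-- The defining relations of the quantum supergroup. -/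
inductive CRel (P : Params) : FreeAlgebra ℂ CGen → FreeAlgebra ℂ CGen → Prop
  | ab : CRel P (.ι ℂ .a * .ι ℂ .b) (P.t • (.ι ℂ .b * .ι ℂ .a))
  | ac : CRel P (.ι ℂ .a * .ι ℂ .c) (P.t • (.ι ℂ .c * .ι ℂ .a))
  | bc : CRel P (.ι ℂ .b * .ι ℂ .c) (-(.ι ℂ .c * .ι ℂ .b))
  | bd : CRel P (.ι ℂ .b * .ι ℂ .d) (-(P.t • (.ι ℂ .d * .ι ℂ .b)))
  | cd : CRel P (.ι ℂ .c * .ι ℂ .d) (-(P.t • (.ι ℂ .d * .ι ℂ .c)))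
  | ad_da : CRel P (.ι ℂ .a * .ι ℂ .d - .ι ℂ .d * .ι ℂ .a)
      ((P.t⁻¹ - P.t) • (.ι ℂ .b * .ι ℂ .c))
  | ad_bc : CRel P (.ι ℂ .a * .ι ℂ .d + P.t • (.ι ℂ .b * .ι ℂ .c)) (.ι ℂ .σ)
  | σ_sq : CRel P (.ι ℂ .σ * .ι ℂ .σ) 1

/-- The quantum supergroup `ℂ_q(osp(1,2))` as an algebra. -/
def Cq (P : Params) : Type := RingQuot (CRel P)

instance (P : Params) : Ring (Cq P) := inferInstanceAs (Ring (RingQuot (CRel P)))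
instance (P : Params) : Algebra ℂ (Cq P) := inferInstanceAs (Algebra ℂ (RingQuot (CRel P)))

namespace Cq

variable (P : Params)

/-- The quotient map from the free algebra. -/
def mk : FreeAlgebra ℂ CGen →ₐ[ℂ] Cq P := RingQuot.mkAlgHom ℂ (CRel P)

theorem mk_surjective : Function.Surjective (mk P) := RingQuot.mkAlgHom_surjective ℂ (CRel P)

variable {P} in
theorem mk_rel {x y : FreeAlgebra ℂ CGen} (h : CRel P x y) : mk P x = mk P y :=
  RingQuot.mkAlgHom_rel ℂ h

/-- The image of a generator in `ℂ_q(osp(1,2))`. -/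
def gen (g : CGen) : Cq P := mk P (.ι ℂ g)

/-- The generator `a`. -/
abbrev a : Cq P := gen P .a
/-- The generator `b`. -/
abbrev b : Cq P := gen P .b
/-- The generator `c`. -/
abbrev c : Cq P := gen P .c
/-- The generator `d`. -/
abbrev d : Cq P := gen P .d
/-- The generator `σ`. -/
abbrev σ : Cq P := gen P .σ

theorem ab_rel : a P * b P = P.t • (b P * a P) := by
  simpa [gen] using mk_rel (CRel.ab (P := P))
theorem ac_rel : a P * c P = P.t • (c P * a P) := by
  simpa [gen] using mk_rel (CRel.ac (P := P))
theorem bc_rel : b P * c P = -(c P * b P) := by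
  simpa [gen] using mk_rel (CRel.bc (P := P))
theorem bd_rel : b P * d P = -(P.t • (d P * b P)) := by
  simpa [gen] using mk_rel (CRel.bd (P := P))
theorem cd_rel : c P * d P = -(P.t • (d P * c P)) := by
  simpa [gen] using mk_rel (CRel.cd (P := P))
theorem ad_da_rel : a P * d P - d P * a P = (P.t⁻¹ - P.t) • (b P * c P) := by
  simpa [gen] using mk_rel (CRel.ad_da (P := P))
theorem ad_bc_rel : a P * d P + P.t • (b P * c P) = σ P := by
  simpa [gen] using mk_rel (CRel.ad_bc (P := P))
theorem σ_sq_rel : σ P * σ P = 1 := by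
  simpa [gen] using mk_rel (CRel.σ_sq (P := P))

variable {P} in
/-- The algebra homomorphism with prescribed values on the generators that satisfy the defining
relations. -/
def lift {B : Type} [Ring B] [Algebra ℂ B] (a b c d σ : B)
    (hab : a * b = P.t • (b * a)) (hac : a * c = P.t • (c * a)) (hbc : b * c = -(c * b))
    (hbd : b * d = -(P.t • (d * b))) (hcd : c * d = -(P.t • (d * c)))
    (hada : a * d - d * a = (P.t⁻¹ - P.t) • (b * c)) (hadbc : a * d + P.t • (b * c) = σ)
    (hσ : σ * σ = 1) : Cq P →ₐ[ℂ] B :=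
  RingQuot.liftAlgHom ℂ ⟨FreeAlgebra.lift ℂ
    (fun g => match g with | .a => a | .b => b | .c => c | .d => d | .σ => σ), by
      intro x y h
      cases h <;> simpa⟩

variable {P} in
theorem induction {p : Cq P → Prop} (hone : p 1) (hsmul : ∀ (r : ℂ) x, p x → p (r • x))
    (hgen : ∀ g x, p x → p (gen P g * x)) (hadd : ∀ x y, p x → p y → p (x + y)) (x : Cq P) :
    p x := by
  obtain ⟨x, rfl⟩ := mk_surjective P x
  suffices h : ∀ y : Cq P, p y → p (mk P x * y) by
    have := h 1 hone
    rwa [mul_one] at this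
  induction x using FreeAlgebra.induction with
  | grade0 r =>
    intro y hy
    rw [AlgHom.commutes, ← Algebra.smul_def]
    exact hsmul _ _ hy
  | grade1 g => exact fun y hy => hgen g y hy
  | mul x x' hx hx' =>
    intro y hy
    rw [map_mul, mul_assoc]
    exact hx _ (hx' _ hy)
  | add x x' hx hx' =>
    intro y hy
    rw [map_add, add_mul]
    exact hadd _ _ (hx _ hy) (hx' _ hy)


variable (P : Params)

theorem algHom_ext' {P : Params} {B : Type} [Ring B] [Algebra ℂ B] {φ ψ : Cq P →ₐ[ℂ] B}
    (h : ∀ g, φ (gen P g) = ψ (gen P g)) : φ = ψ := by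
  have h' : φ.comp (mk P) = ψ.comp (mk P) := FreeAlgebra.hom_ext (funext fun g => h g)
  ext x
  obtain ⟨x, rfl⟩ := mk_surjective P x
  exact DFunLike.congr_fun h' x

/-- The parity automorphism of `ℂ_q(osp(1,2))`: `a, d, σ` are even and `b, c` are odd. -/
def parity : Cq P →ₐ[ℂ] Cq P :=
  lift (a P) (-b P) (-c P) (d P) (σ P)
    (by simp [ab_rel]) (by simp [ac_rel]) (by simp [bc_rel]) (by simp [bd_rel])
    (by simp [cd_rel]) (by simpa using ad_da_rel P) (by simpa using ad_bc_rel P) (σ_sq_rel P)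

theorem lift_gen {P : Params} {B : Type} [Ring B] [Algebra ℂ B] (a b c d σ : B)
    (hab hac hbc hbd hcd hada hadbc hσ) (g : CGen) :
    lift (P := P) a b c d σ hab hac hbc hbd hcd hada hadbc hσ (gen P g) =
      (match g with | .a => a | .b => b | .c => c | .d => d | .σ => σ) := by
  have h : lift (P := P) a b c d σ hab hac hbc hbd hcd hada hadbc hσ (gen P g) =
      FreeAlgebra.lift ℂ (fun g : CGen => match g with
        | .a => a | .b => b | .c => c | .d => d | .σ => σ) (.ι ℂ g) :=
    RingQuot.liftAlgHom_mkAlgHom_apply ℂ _ _ _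
  rw [h, FreeAlgebra.lift_ι_apply]

theorem parity_gen (g : CGen) : parity P (gen P g) =
    (match g with | .a => a P | .b => -b P | .c => -c P | .d => d P | .σ => σ P) := by
  rw [parity, lift_gen]

theorem parity_parity (x : Cq P) : parity P (parity P x) = x := by
  suffices h : (parity P).comp (parity P) = AlgHom.id ℂ _ from DFunLike.congr_fun h x
  refine algHom_ext' fun g => ?_
  cases g <;> simp [parity_gen]

/-- The `ℤ/2`-grading of `ℂ_q(osp(1,2))`. -/
abbrev grading : ZMod 2 → Submodule ℂ (Cq P) := superGrading (parity P)

instance : GradedAlgebra (grading P) := superGradedAlgebra _ (parity_parity P)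

/-- The super tensor square of `ℂ_q(osp(1,2))`, with product
`(x ⊗ y) (x' ⊗ y') = (-1)^{p(y) p(x')} x x' ⊗ y y'`. -/
abbrev SuperTensor : Type := GradedTensorProduct ℂ (grading P) (grading P)

variable {P}

theorem tmul_mul_tmul_even (x y x' y' : Cq P) (hy : parity P y = y) :
    ((x ᵍ⊗ₜ[ℂ] y * x' ᵍ⊗ₜ[ℂ] y' : SuperTensor P)) = (x * x') ᵍ⊗ₜ[ℂ] (y * y') := by
  have hy0 : y ∈ grading P 0 := (mem_superGrading_zero _ _).2 hy
  conv_lhs => rw [← evenPart_add_oddPart (parity P) x']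
  have h0 := GradedTensorProduct.tmul_coe_mul_coe_tmul (R := ℂ) (grading P) (grading P) x
    ⟨y, hy0⟩ ⟨_, evenPart_mem (parity P) (parity_parity P) x'⟩ y'
  have h1 := GradedTensorProduct.tmul_coe_mul_coe_tmul (R := ℂ) (grading P) (grading P) x
    ⟨y, hy0⟩ ⟨_, oddPart_mem (parity P) (parity_parity P) x'⟩ y'
  simp only [zero_mul, uzpow_zero, one_smul] at h0 h1
  simp only [GradedTensorProduct.tmul, TensorProduct.add_tmul, map_add, mul_add] at h0 h1 ⊢
  rw [h0, h1, ← map_add, ← TensorProduct.add_tmul, ← mul_add, evenPart_add_oddPart]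

theorem tmul_mul_tmul_odd (x y x' y' : Cq P) (hy : parity P y = -y) :
    ((x ᵍ⊗ₜ[ℂ] y * x' ᵍ⊗ₜ[ℂ] y' : SuperTensor P)) =
      (x * parity P x') ᵍ⊗ₜ[ℂ] (y * y') := by
  have hy0 : y ∈ grading P 1 := (mem_superGrading_one _ _).2 hy
  conv_lhs => rw [← evenPart_add_oddPart (parity P) x']
  have h0 := GradedTensorProduct.tmul_coe_mul_coe_tmul (R := ℂ) (grading P) (grading P) x
    ⟨y, hy0⟩ ⟨_, evenPart_mem (parity P) (parity_parity P) x'⟩ y'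
  have h1 := GradedTensorProduct.tmul_coe_mul_coe_tmul (R := ℂ) (grading P) (grading P) x
    ⟨y, hy0⟩ ⟨_, oddPart_mem (parity P) (parity_parity P) x'⟩ y'
  simp only [mul_zero, mul_one, uzpow_zero, uzpow_one, one_smul, Units.neg_smul]
    at h0 h1
  simp only [GradedTensorProduct.tmul, TensorProduct.add_tmul, map_add, mul_add] at h0 h1 ⊢
  rw [h0, h1, ← sub_eq_add_neg, ← map_sub, ← TensorProduct.sub_tmul, ← mul_sub]
  congr 4
  simp only [evenPart, oddPart, LinearMap.smul_apply, LinearMap.add_apply, LinearMap.sub_apply,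
    LinearMap.id_apply, AlgHom.toLinearMap_apply]
  module

@[simp] theorem parity_a : parity P (a P) = a P := by simp [a, parity_gen]
@[simp] theorem parity_b : parity P (b P) = -b P := by simp [b, parity_gen]
@[simp] theorem parity_c : parity P (c P) = -c P := by simp [c, parity_gen]
@[simp] theorem parity_d : parity P (d P) = d P := by simp [d, parity_gen]
@[simp] theorem parity_σ : parity P (σ P) = σ P := by simp [σ, parity_gen]

theorem bc_rel' : b P * c P = (-1 : ℂ) • (c P * b P) := by rw [bc_rel]; module
theorem bd_rel' : b P * d P = (-P.t) • (d P * b P) := by rw [bd_rel]; module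
theorem cd_rel' : c P * d P = (-P.t) • (d P * c P) := by rw [cd_rel]; module
theorem ad_rel' : a P * d P = σ P + P.t • (c P * b P) := by
  rw [← ad_bc_rel, bc_rel]; module
theorem da_rel' : d P * a P = σ P + P.t⁻¹ • (c P * b P) := by
  have h := ad_da_rel P
  have h' : d P * a P = a P * d P - (P.t⁻¹ - P.t) • (b P * c P) := by rw [← h]; abel
  rw [h', ad_rel', bc_rel]; module

theorem comul_ab : ((a P ᵍ⊗ₜ[ℂ] a P + b P ᵍ⊗ₜ[ℂ] c P) * (a P ᵍ⊗ₜ[ℂ] b P + b P ᵍ⊗ₜ[ℂ] d P) : SuperTensor P) = P.t • ((a P ᵍ⊗ₜ[ℂ] b P + b P ᵍ⊗ₜ[ℂ] d P) * (a P ᵍ⊗ₜ[ℂ] a P + b P ᵍ⊗ₜ[ℂ] c P)) := by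
  have ht := P.t_ne_zero
  simp only [add_mul, mul_add, tmul_mul_tmul_even _ (a P) _ _ parity_a,
    tmul_mul_tmul_even _ (d P) _ _ parity_d, tmul_mul_tmul_even _ (σ P) _ _ parity_σ,
    tmul_mul_tmul_odd _ (b P) _ _ parity_b, tmul_mul_tmul_odd _ (c P) _ _ parity_c,
    parity_a, parity_b, parity_c, parity_d, parity_σ, mul_neg, ab_rel P, ac_rel P, bc_rel',
    bd_rel', cd_rel', ad_rel', da_rel', σ_sq_rel P, GradedTensorProduct.tmul,
    TensorProduct.neg_tmul, TensorProduct.tmul_neg, TensorProduct.tmul_smul, ← TensorProduct.smul_tmul',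
    TensorProduct.tmul_add, TensorProduct.add_tmul, map_add, map_neg, map_smul, smul_add,
    smul_neg, smul_smul]
  all_goals match_scalars <;> field_simp <;> try ring1

theorem comul_ac : ((a P ᵍ⊗ₜ[ℂ] a P + b P ᵍ⊗ₜ[ℂ] c P) * (c P ᵍ⊗ₜ[ℂ] a P + d P ᵍ⊗ₜ[ℂ] c P) : SuperTensor P) = P.t • ((c P ᵍ⊗ₜ[ℂ] a P + d P ᵍ⊗ₜ[ℂ] c P) * (a P ᵍ⊗ₜ[ℂ] a P + b P ᵍ⊗ₜ[ℂ] c P)) := by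
  have ht := P.t_ne_zero
  simp only [add_mul, mul_add, tmul_mul_tmul_even _ (a P) _ _ parity_a,
    tmul_mul_tmul_even _ (d P) _ _ parity_d, tmul_mul_tmul_even _ (σ P) _ _ parity_σ,
    tmul_mul_tmul_odd _ (b P) _ _ parity_b, tmul_mul_tmul_odd _ (c P) _ _ parity_c,
    parity_a, parity_b, parity_c, parity_d, parity_σ, mul_neg, ab_rel P, ac_rel P, bc_rel',
    bd_rel', cd_rel', ad_rel', da_rel', σ_sq_rel P, GradedTensorProduct.tmul,
    TensorProduct.neg_tmul, TensorProduct.tmul_neg, TensorProduct.tmul_smul, ← TensorProduct.smul_tmul',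
    TensorProduct.tmul_add, TensorProduct.add_tmul, map_add, map_neg, map_smul, smul_add,
    smul_neg, smul_smul]
  all_goals match_scalars <;> field_simp <;> try ring1

theorem comul_bc : ((a P ᵍ⊗ₜ[ℂ] b P + b P ᵍ⊗ₜ[ℂ] d P) * (c P ᵍ⊗ₜ[ℂ] a P + d P ᵍ⊗ₜ[ℂ] c P) : SuperTensor P) = -((c P ᵍ⊗ₜ[ℂ] a P + d P ᵍ⊗ₜ[ℂ] c P) * (a P ᵍ⊗ₜ[ℂ] b P + b P ᵍ⊗ₜ[ℂ] d P)) := by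
  have ht := P.t_ne_zero
  simp only [add_mul, mul_add, tmul_mul_tmul_even _ (a P) _ _ parity_a,
    tmul_mul_tmul_even _ (d P) _ _ parity_d, tmul_mul_tmul_even _ (σ P) _ _ parity_σ,
    tmul_mul_tmul_odd _ (b P) _ _ parity_b, tmul_mul_tmul_odd _ (c P) _ _ parity_c,
    parity_a, parity_b, parity_c, parity_d, parity_σ, mul_neg, ab_rel P, ac_rel P, bc_rel',
    bd_rel', cd_rel', ad_rel', da_rel', σ_sq_rel P, GradedTensorProduct.tmul,
    TensorProduct.neg_tmul, TensorProduct.tmul_neg, TensorProduct.tmul_smul, ← TensorProduct.smul_tmul',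
    TensorProduct.tmul_add, TensorProduct.add_tmul, map_add, map_neg, map_smul, smul_add,
    smul_neg, smul_smul]
  all_goals match_scalars <;> field_simp <;> try ring1

theorem comul_bd : ((a P ᵍ⊗ₜ[ℂ] b P + b P ᵍ⊗ₜ[ℂ] d P) * (c P ᵍ⊗ₜ[ℂ] b P + d P ᵍ⊗ₜ[ℂ] d P) : SuperTensor P) = -(P.t • ((c P ᵍ⊗ₜ[ℂ] b P + d P ᵍ⊗ₜ[ℂ] d P) * (a P ᵍ⊗ₜ[ℂ] b P + b P ᵍ⊗ₜ[ℂ] d P))) := by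
  have ht := P.t_ne_zero
  simp only [add_mul, mul_add, tmul_mul_tmul_even _ (a P) _ _ parity_a,
    tmul_mul_tmul_even _ (d P) _ _ parity_d, tmul_mul_tmul_even _ (σ P) _ _ parity_σ,
    tmul_mul_tmul_odd _ (b P) _ _ parity_b, tmul_mul_tmul_odd _ (c P) _ _ parity_c,
    parity_a, parity_b, parity_c, parity_d, parity_σ, mul_neg, ab_rel P, ac_rel P, bc_rel',
    bd_rel', cd_rel', ad_rel', da_rel', σ_sq_rel P, GradedTensorProduct.tmul,
    TensorProduct.neg_tmul, TensorProduct.tmul_neg, TensorProduct.tmul_smul, ← TensorProduct.smul_tmul',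
    TensorProduct.tmul_add, TensorProduct.add_tmul, map_add, map_neg, map_smul, smul_add,
    smul_neg, smul_smul]
  all_goals match_scalars <;> field_simp <;> try ring1

theorem comul_cd : ((c P ᵍ⊗ₜ[ℂ] a P + d P ᵍ⊗ₜ[ℂ] c P) * (c P ᵍ⊗ₜ[ℂ] b P + d P ᵍ⊗ₜ[ℂ] d P) : SuperTensor P) = -(P.t • ((c P ᵍ⊗ₜ[ℂ] b P + d P ᵍ⊗ₜ[ℂ] d P) * (c P ᵍ⊗ₜ[ℂ] a P + d P ᵍ⊗ₜ[ℂ] c P))) := by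
  have ht := P.t_ne_zero
  simp only [add_mul, mul_add, tmul_mul_tmul_even _ (a P) _ _ parity_a,
    tmul_mul_tmul_even _ (d P) _ _ parity_d, tmul_mul_tmul_even _ (σ P) _ _ parity_σ,
    tmul_mul_tmul_odd _ (b P) _ _ parity_b, tmul_mul_tmul_odd _ (c P) _ _ parity_c,
    parity_a, parity_b, parity_c, parity_d, parity_σ, mul_neg, ab_rel P, ac_rel P, bc_rel',
    bd_rel', cd_rel', ad_rel', da_rel', σ_sq_rel P, GradedTensorProduct.tmul,
    TensorProduct.neg_tmul, TensorProduct.tmul_neg, TensorProduct.tmul_smul, ← TensorProduct.smul_tmul',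
    TensorProduct.tmul_add, TensorProduct.add_tmul, map_add, map_neg, map_smul, smul_add,
    smul_neg, smul_smul]
  all_goals match_scalars <;> field_simp <;> try ring1

theorem comul_ad_da : ((a P ᵍ⊗ₜ[ℂ] a P + b P ᵍ⊗ₜ[ℂ] c P) * (c P ᵍ⊗ₜ[ℂ] b P + d P ᵍ⊗ₜ[ℂ] d P) - (c P ᵍ⊗ₜ[ℂ] b P + d P ᵍ⊗ₜ[ℂ] d P) * (a P ᵍ⊗ₜ[ℂ] a P + b P ᵍ⊗ₜ[ℂ] c P) : SuperTensor P) = (P.t⁻¹ - P.t) • ((a P ᵍ⊗ₜ[ℂ] b P + b P ᵍ⊗ₜ[ℂ] d P) * (c P ᵍ⊗ₜ[ℂ] a P + d P ᵍ⊗ₜ[ℂ] c P)) := by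
  have ht := P.t_ne_zero
  simp only [add_mul, mul_add, tmul_mul_tmul_even _ (a P) _ _ parity_a,
    tmul_mul_tmul_even _ (d P) _ _ parity_d, tmul_mul_tmul_even _ (σ P) _ _ parity_σ,
    tmul_mul_tmul_odd _ (b P) _ _ parity_b, tmul_mul_tmul_odd _ (c P) _ _ parity_c,
    parity_a, parity_b, parity_c, parity_d, parity_σ, mul_neg, ab_rel P, ac_rel P, bc_rel',
    bd_rel', cd_rel', ad_rel', da_rel', σ_sq_rel P, GradedTensorProduct.tmul,
    TensorProduct.neg_tmul, TensorProduct.tmul_neg, TensorProduct.tmul_smul, ← TensorProduct.smul_tmul',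
    TensorProduct.tmul_add, TensorProduct.add_tmul, map_add, map_neg, map_smul, smul_add,
    smul_neg, smul_smul]
  all_goals match_scalars <;> field_simp <;> try ring1

theorem comul_ad_bc : ((a P ᵍ⊗ₜ[ℂ] a P + b P ᵍ⊗ₜ[ℂ] c P) * (c P ᵍ⊗ₜ[ℂ] b P + d P ᵍ⊗ₜ[ℂ] d P) + P.t • ((a P ᵍ⊗ₜ[ℂ] b P + b P ᵍ⊗ₜ[ℂ] d P) * (c P ᵍ⊗ₜ[ℂ] a P + d P ᵍ⊗ₜ[ℂ] c P)) : SuperTensor P) = σ P ᵍ⊗ₜ[ℂ] σ P := by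
  have ht := P.t_ne_zero
  simp only [add_mul, mul_add, tmul_mul_tmul_even _ (a P) _ _ parity_a,
    tmul_mul_tmul_even _ (d P) _ _ parity_d, tmul_mul_tmul_even _ (σ P) _ _ parity_σ,
    tmul_mul_tmul_odd _ (b P) _ _ parity_b, tmul_mul_tmul_odd _ (c P) _ _ parity_c,
    parity_a, parity_b, parity_c, parity_d, parity_σ, mul_neg, ab_rel P, ac_rel P, bc_rel',
    bd_rel', cd_rel', ad_rel', da_rel', σ_sq_rel P, GradedTensorProduct.tmul,
    TensorProduct.neg_tmul, TensorProduct.tmul_neg, TensorProduct.tmul_smul, ← TensorProduct.smul_tmul',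
    TensorProduct.tmul_add, TensorProduct.add_tmul, map_add, map_neg, map_smul, smul_add,
    smul_neg, smul_smul]
  all_goals match_scalars <;> field_simp <;> try ring1

theorem comul_σ_sq : (σ P ᵍ⊗ₜ[ℂ] σ P * σ P ᵍ⊗ₜ[ℂ] σ P : SuperTensor P) = 1 := by
  rw [tmul_mul_tmul_even _ (σ P) _ _ parity_σ, σ_sq_rel]
  rfl

variable (P)

/-- The comultiplication as a homomorphism of superalgebras: `a ↦ a ⊗ a + b ⊗ c`,
`b ↦ a ⊗ b + b ⊗ d`, `c ↦ c ⊗ a + d ⊗ c`, `d ↦ c ⊗ b + d ⊗ d`, `σ ↦ σ ⊗ σ`. -/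
def comulHom : Cq P →ₐ[ℂ] SuperTensor P :=
  lift (a P ᵍ⊗ₜ[ℂ] a P + b P ᵍ⊗ₜ[ℂ] c P) (a P ᵍ⊗ₜ[ℂ] b P + b P ᵍ⊗ₜ[ℂ] d P)
    (c P ᵍ⊗ₜ[ℂ] a P + d P ᵍ⊗ₜ[ℂ] c P) (c P ᵍ⊗ₜ[ℂ] b P + d P ᵍ⊗ₜ[ℂ] d P) (σ P ᵍ⊗ₜ[ℂ] σ P)
    comul_ab comul_ac comul_bc comul_bd comul_cd comul_ad_da comul_ad_bc comul_σ_sq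


/-- The comultiplication as a linear map into the tensor square. -/
def comulLin : Cq P →ₗ[ℂ] Cq P ⊗[ℂ] Cq P :=
  (GradedTensorProduct.of ℂ (grading P) (grading P)).symm.toLinearMap ∘ₗ (comulHom P).toLinearMap

/-- The counit: `a, d, σ ↦ 1` and `b, c ↦ 0`. -/
def counitHom : Cq P →ₐ[ℂ] ℂ :=
  lift 1 0 0 1 1 (by simp) (by simp) (by simp) (by simp) (by simp) (by simp) (by simp) (by simp)

/-- Left multiplication by the coproduct of a generator on the super tensor square. -/
def comulOp : CGen → (Cq P ⊗[ℂ] Cq P →ₗ[ℂ] Cq P ⊗[ℂ] Cq P)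
  | .a => TensorProduct.map (LinearMap.mulLeft ℂ (a P)) (LinearMap.mulLeft ℂ (a P)) +
      TensorProduct.map (LinearMap.mulLeft ℂ (b P) ∘ₗ (parity P).toLinearMap)
        (LinearMap.mulLeft ℂ (c P))
  | .b => TensorProduct.map (LinearMap.mulLeft ℂ (a P) ∘ₗ (parity P).toLinearMap)
        (LinearMap.mulLeft ℂ (b P)) +
      TensorProduct.map (LinearMap.mulLeft ℂ (b P)) (LinearMap.mulLeft ℂ (d P))
  | .c => TensorProduct.map (LinearMap.mulLeft ℂ (c P)) (LinearMap.mulLeft ℂ (a P)) +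
      TensorProduct.map (LinearMap.mulLeft ℂ (d P) ∘ₗ (parity P).toLinearMap)
        (LinearMap.mulLeft ℂ (c P))
  | .d => TensorProduct.map (LinearMap.mulLeft ℂ (c P) ∘ₗ (parity P).toLinearMap)
        (LinearMap.mulLeft ℂ (b P)) +
      TensorProduct.map (LinearMap.mulLeft ℂ (d P)) (LinearMap.mulLeft ℂ (d P))
  | .σ => TensorProduct.map (LinearMap.mulLeft ℂ (σ P)) (LinearMap.mulLeft ℂ (σ P))

theorem comulHom_gen (g : CGen) : comulHom P (gen P g) = (match g with
    | .a => a P ᵍ⊗ₜ[ℂ] a P + b P ᵍ⊗ₜ[ℂ] c P | .b => a P ᵍ⊗ₜ[ℂ] b P + b P ᵍ⊗ₜ[ℂ] d P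
    | .c => c P ᵍ⊗ₜ[ℂ] a P + d P ᵍ⊗ₜ[ℂ] c P | .d => c P ᵍ⊗ₜ[ℂ] b P + d P ᵍ⊗ₜ[ℂ] d P
    | .σ => σ P ᵍ⊗ₜ[ℂ] σ P) := by
  rw [comulHom, lift_gen]

theorem even_mul (x y : Cq P) (hy : parity P y = y) (z : Cq P ⊗[ℂ] Cq P) :
    x ᵍ⊗ₜ[ℂ] y * GradedTensorProduct.of ℂ (grading P) (grading P) z =
      GradedTensorProduct.of ℂ (grading P) (grading P)
        (TensorProduct.map (LinearMap.mulLeft ℂ x) (LinearMap.mulLeft ℂ y) z) := by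
  induction z using TensorProduct.induction_on with
  | zero => simp
  | tmul x' y' => exact tmul_mul_tmul_even x y x' y' hy
  | add u v hu hv => rw [map_add, mul_add, hu, hv, map_add, map_add]

theorem odd_mul (x y : Cq P) (hy : parity P y = -y) (z : Cq P ⊗[ℂ] Cq P) :
    x ᵍ⊗ₜ[ℂ] y * GradedTensorProduct.of ℂ (grading P) (grading P) z =
      GradedTensorProduct.of ℂ (grading P) (grading P)
        (TensorProduct.map (LinearMap.mulLeft ℂ x ∘ₗ (parity P).toLinearMap)
          (LinearMap.mulLeft ℂ y) z) := by
  induction z using TensorProduct.induction_on with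
  | zero => simp
  | tmul x' y' => exact tmul_mul_tmul_odd x y x' y' hy
  | add u v hu hv => rw [map_add, mul_add, hu, hv, map_add, map_add]

theorem comulLin_gen_mul (g : CGen) (u : Cq P) :
    comulLin P (gen P g * u) = comulOp P g (comulLin P u) := by
  apply (GradedTensorProduct.of ℂ (grading P) (grading P)).injective
  have h : ∀ v, GradedTensorProduct.of ℂ (grading P) (grading P) (comulLin P v) = comulHom P v :=
    fun v => rfl
  rw [h, map_mul, comulHom_gen, ← h u]
  cases g <;> simp only [comulOp, LinearMap.add_apply, map_add, add_mul,
    even_mul P _ (a P) parity_a, even_mul P _ (d P) parity_d, even_mul P _ (σ P) parity_σ,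
    odd_mul P _ (b P) parity_b, odd_mul P _ (c P) parity_c]

theorem comulLin_one : comulLin P 1 = 1 ⊗ₜ[ℂ] 1 := by
  simp only [comulLin, LinearMap.comp_apply, AlgHom.toLinearMap_apply, map_one]
  rfl

theorem counitHom_gen (g : CGen) : counitHom P (gen P g) =
    (match g with | .a => 1 | .b => 0 | .c => 0 | .d => 1 | .σ => 1) := by
  rw [counitHom, lift_gen]

variable {P} in
/-- Linear maps on `ℂ_q(osp(1,2))` that agree at `1` and satisfy the same recursion under left
multiplication by the generators agree. -/
theorem linear_ext {M : Type} [AddCommGroup M] [Module ℂ M] {φ ψ : Cq P →ₗ[ℂ] M}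
    (h1 : φ 1 = ψ 1) (hg : ∀ g x, φ x = ψ x → φ (gen P g * x) = ψ (gen P g * x)) : φ = ψ := by
  ext x
  induction x using induction with
  | hone => exact h1
  | hsmul r x hx => rw [map_smul, map_smul, hx]
  | hgen g x hx => exact hg g x hx
  | hadd x y hx hy => rw [map_add, map_add, hx, hy]

theorem comulLin_parity (u : Cq P) : comulLin P (parity P u) =
    TensorProduct.map (parity P).toLinearMap (parity P).toLinearMap (comulLin P u) := by
  suffices h : comulLin P ∘ₗ (parity P).toLinearMap =
      TensorProduct.map (parity P).toLinearMap (parity P).toLinearMap ∘ₗ comulLin P from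
    LinearMap.congr_fun h u
  refine linear_ext ?_ ?_
  · simp [comulLin_one]
  · intro g x hx
    simp only [LinearMap.comp_apply, AlgHom.toLinearMap_apply, map_mul] at hx ⊢
    rw [comulLin_gen_mul]
    have key : ∀ z, TensorProduct.map (parity P).toLinearMap (parity P).toLinearMap
        (comulOp P g z) = (match g with | .a | .d | .σ => (1 : ℂ) | .b | .c => -1) • comulOp P g
          (TensorProduct.map (parity P).toLinearMap (parity P).toLinearMap z) := by
      intro z
      induction z using TensorProduct.induction_on with
      | zero => simp
      | tmul u v =>
        cases g <;> simp [comulOp, TensorProduct.tmul_neg, TensorProduct.neg_tmul]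
      | add u v hu hv => rw [map_add, map_add, hu, hv, map_add, map_add, smul_add]
    rw [key, ← hx]
    cases g <;> simp [parity_gen, comulLin_gen_mul]

/-- Left multiplication by the iterated coproduct of a generator on the super tensor cube. -/
def tripleOp : CGen → (Cq P ⊗[ℂ] (Cq P ⊗[ℂ] Cq P) →ₗ[ℂ] Cq P ⊗[ℂ] (Cq P ⊗[ℂ] Cq P))
  | .a => TensorProduct.map (LinearMap.mulLeft ℂ (a P)) (comulOp P .a) +
      TensorProduct.map (LinearMap.mulLeft ℂ (b P) ∘ₗ (parity P).toLinearMap) (comulOp P .c)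
  | .b => TensorProduct.map (LinearMap.mulLeft ℂ (a P) ∘ₗ (parity P).toLinearMap)
        (comulOp P .b) + TensorProduct.map (LinearMap.mulLeft ℂ (b P)) (comulOp P .d)
  | .c => TensorProduct.map (LinearMap.mulLeft ℂ (c P)) (comulOp P .a) +
      TensorProduct.map (LinearMap.mulLeft ℂ (d P) ∘ₗ (parity P).toLinearMap) (comulOp P .c)
  | .d => TensorProduct.map (LinearMap.mulLeft ℂ (c P) ∘ₗ (parity P).toLinearMap)
        (comulOp P .b) + TensorProduct.map (LinearMap.mulLeft ℂ (d P)) (comulOp P .d)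
  | .σ => TensorProduct.map (LinearMap.mulLeft ℂ (σ P)) (comulOp P .σ)

theorem lTensor_comulOp (g : CGen) (z : Cq P ⊗[ℂ] Cq P) :
    (comulLin P).lTensor (Cq P) (comulOp P g z) =
      tripleOp P g ((comulLin P).lTensor (Cq P) z) := by
  induction z using TensorProduct.induction_on with
  | zero => simp
  | tmul u v =>
    cases g <;> simp [comulOp, tripleOp, comulLin_gen_mul]
  | add u v hu hv => rw [map_add, map_add, hu, hv, map_add, map_add]

theorem assoc_rTensor_comulOp (g : CGen) (z : Cq P ⊗[ℂ] Cq P) :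
    TensorProduct.assoc ℂ _ _ _ ((comulLin P).rTensor (Cq P) (comulOp P g z)) =
      tripleOp P g (TensorProduct.assoc ℂ _ _ _ ((comulLin P).rTensor (Cq P) z)) := by
  induction z using TensorProduct.induction_on with
  | zero => simp
  | tmul u v =>
    have h : TensorProduct.assoc ℂ _ _ _ ((comulLin P).rTensor (Cq P) (comulOp P g (u ⊗ₜ v))) =
        (match g with
          | .a => TensorProduct.assoc ℂ _ _ _ (comulOp P .a (comulLin P u) ⊗ₜ (a P * v)) +
              TensorProduct.assoc ℂ _ _ _ (comulOp P .b (TensorProduct.map (parity P).toLinearMap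
                (parity P).toLinearMap (comulLin P u)) ⊗ₜ (c P * v))
          | .b => TensorProduct.assoc ℂ _ _ _ (comulOp P .a (TensorProduct.map
                (parity P).toLinearMap (parity P).toLinearMap (comulLin P u)) ⊗ₜ (b P * v)) +
              TensorProduct.assoc ℂ _ _ _ (comulOp P .b (comulLin P u) ⊗ₜ (d P * v))
          | .c => TensorProduct.assoc ℂ _ _ _ (comulOp P .c (comulLin P u) ⊗ₜ (a P * v)) +
              TensorProduct.assoc ℂ _ _ _ (comulOp P .d (TensorProduct.map (parity P).toLinearMap
                (parity P).toLinearMap (comulLin P u)) ⊗ₜ (c P * v))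
          | .d => TensorProduct.assoc ℂ _ _ _ (comulOp P .c (TensorProduct.map
                (parity P).toLinearMap (parity P).toLinearMap (comulLin P u)) ⊗ₜ (b P * v)) +
              TensorProduct.assoc ℂ _ _ _ (comulOp P .d (comulLin P u) ⊗ₜ (d P * v))
          | .σ => TensorProduct.assoc ℂ _ _ _ (comulOp P .σ (comulLin P u) ⊗ₜ (σ P * v))) := by
      cases g <;> simp only [← comulLin_parity, ← comulLin_gen_mul, ← map_add] <;>
        simp [comulOp]
    rw [h, LinearMap.rTensor_tmul]
    generalize comulLin P u = w
    induction w using TensorProduct.induction_on with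
    | zero => cases g <;> simp
    | tmul x y =>
      cases g <;> simp [comulOp, tripleOp, TensorProduct.add_tmul, TensorProduct.tmul_add,
        TensorProduct.neg_tmul, TensorProduct.tmul_neg, parity_parity] <;> try abel
    | add x y hx hy =>
      rw [TensorProduct.add_tmul x y v, map_add (TensorProduct.assoc ℂ _ _ _),
        map_add (tripleOp P g), ← hx, ← hy]
      cases g <;> simp only [map_add, TensorProduct.add_tmul] <;> try abel
  | add u v hu hv => rw [map_add, map_add, map_add, hu, hv, map_add, map_add, map_add]

theorem counitHom_parity (u : Cq P) : counitHom P (parity P u) = counitHom P u := by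
  suffices h : (counitHom P).comp (parity P) = counitHom P from DFunLike.congr_fun h u
  refine algHom_ext' fun g => ?_
  cases g <;> simp [parity_gen, counitHom_gen]

instance : Coalgebra ℂ (Cq P) where
  comul := comulLin P
  counit := (counitHom P).toLinearMap
  coassoc := by
    refine linear_ext ?_ ?_
    · simp [comulLin_one]
    · intro g x hx
      simp only [LinearMap.comp_apply, comulLin_gen_mul, LinearEquiv.coe_coe] at hx ⊢
      rw [assoc_rTensor_comulOp, lTensor_comulOp, hx]
  rTensor_counit_comp_comul := by
    refine linear_ext ?_ ?_
    · simp [comulLin_one]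
    · intro g x hx
      simp only [LinearMap.comp_apply, comulLin_gen_mul] at hx ⊢
      have key : ∀ z, (counitHom P).toLinearMap.rTensor (Cq P) (comulOp P g z) =
          (LinearMap.mulLeft ℂ (gen P g)).lTensor ℂ
            ((counitHom P).toLinearMap.rTensor (Cq P) z) := by
        intro z
        induction z using TensorProduct.induction_on with
        | zero => simp
        | tmul u v => cases g <;> simp [comulOp, counitHom_gen, counitHom_parity]
        | add u v hu hv => rw [map_add, map_add, hu, hv, map_add, map_add]
      rw [key, hx]
      simp
  lTensor_counit_comp_comul := by
    refine linear_ext ?_ ?_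
    · simp [comulLin_one]
    · intro g x hx
      simp only [LinearMap.comp_apply, comulLin_gen_mul] at hx ⊢
      have key : ∀ z, (counitHom P).toLinearMap.lTensor (Cq P) (comulOp P g z) =
          (LinearMap.mulLeft ℂ (gen P g)).rTensor ℂ
            ((counitHom P).toLinearMap.lTensor (Cq P) z) := by
        intro z
        induction z using TensorProduct.induction_on with
        | zero => simp
        | tmul u v => cases g <;> simp [comulOp, counitHom_gen]
        | add u v hu hv => rw [map_add, map_add, hu, hv, map_add, map_add]
      rw [key, hx]
      simp

/-! ### The functionals `k, k⁻¹, e, f` on `ℂ_q(osp(1,2))` -/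

/-- The functional `k`, an algebra homomorphism: `a ↦ t`, `d ↦ -t⁻¹`, `σ ↦ -1`. -/
def kHom : Cq P →ₐ[ℂ] ℂ :=
  lift P.t 0 0 (-P.t⁻¹) (-1) (by simp) (by simp) (by simp) (by simp) (by simp)
    (by simp [mul_comm]) (by simp [P.t_ne_zero]) (by simp)

/-- The functional `k⁻¹`, an algebra homomorphism: `a ↦ t⁻¹`, `d ↦ -t`, `σ ↦ -1`. -/
def kInvHom : Cq P →ₐ[ℂ] ℂ :=
  lift P.t⁻¹ 0 0 (-P.t) (-1) (by simp) (by simp) (by simp) (by simp) (by simp)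
    (by simp [mul_comm]) (by simp [P.t_ne_zero]) (by simp)

/-- The value `e(b) = (t - t⁻¹) / (q - q⁻¹)`. -/
def eVal : ℂ := (P.t - P.t⁻¹) / (P.q - P.q⁻¹)

/-- The homomorphism `x ↦ (k(x), e(x); 0, ε(x))` to `2 × 2` matrices that encodes the rule
`e(x y) = e(x) ε(y) + (-1)^{p(x)} k(x) e(y)` (the sign has no effect, as `k` vanishes on odd
elements). -/
def eMat : Cq P →ₐ[ℂ] Matrix (Fin 2) (Fin 2) ℂ :=
  lift !![P.t, 0; 0, 1] !![0, eVal P; 0, 0] 0 !![-P.t⁻¹, 0; 0, 1] !![-1, 0; 0, 1]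
    (by simp) (by simp) (by simp)
    (by ext i j; fin_cases i <;> fin_cases j <;> simp [P.t_ne_zero]) (by simp)
    (by ext i j; fin_cases i <;> fin_cases j <;> simp [mul_comm])
    (by simp [P.t_ne_zero]) (by simp [Matrix.one_fin_two])

/-- The homomorphism `x ↦ (ε(x), f(x); 0, k⁻¹(x))` to `2 × 2` matrices that encodes the rule
`f(x y) = f(x) k⁻¹(y) + (-1)^{p(x)} ε(x) f(y)` (the sign has no effect, as `ε` vanishes on odd
elements). -/
def fMat : Cq P →ₐ[ℂ] Matrix (Fin 2) (Fin 2) ℂ :=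
  lift !![1, 0; 0, P.t⁻¹] 0 !![0, 1; 0, 0] !![1, 0; 0, -P.t] !![1, 0; 0, -1]
    (by simp) (by ext i j; fin_cases i <;> fin_cases j <;> simp [P.t_ne_zero]) (by simp) (by simp)
    (by ext i j; fin_cases i <;> fin_cases j <;> simp [P.t_ne_zero])
    (by ext i j; fin_cases i <;> fin_cases j <;> simp [mul_comm])
    (by simp [P.t_ne_zero]) (by simp [Matrix.one_fin_two])

theorem kHom_gen (g : CGen) : kHom P (gen P g) =
    (match g with | .a => P.t | .b => 0 | .c => 0 | .d => -P.t⁻¹ | .σ => -1) := by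
  rw [kHom, lift_gen]

theorem kInvHom_gen (g : CGen) : kInvHom P (gen P g) =
    (match g with | .a => P.t⁻¹ | .b => 0 | .c => 0 | .d => -P.t | .σ => -1) := by
  rw [kInvHom, lift_gen]

theorem eMat_gen (g : CGen) : eMat P (gen P g) =
    (match g with
      | .a => !![P.t, 0; 0, 1] | .b => !![0, eVal P; 0, 0] | .c => 0
      | .d => !![-P.t⁻¹, 0; 0, 1] | .σ => !![-1, 0; 0, 1]) := by
  rw [eMat, lift_gen]

theorem fMat_gen (g : CGen) : fMat P (gen P g) =
    (match g with
      | .a => !![1, 0; 0, P.t⁻¹] | .b => 0 | .c => !![0, 1; 0, 0]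
      | .d => !![1, 0; 0, -P.t] | .σ => !![1, 0; 0, -1]) := by
  rw [fMat, lift_gen]

/-- The functional `k`. -/
def kFun : Cq P →ₗ[ℂ] ℂ := (kHom P).toLinearMap

/-- The functional `k⁻¹`. -/
def kInvFun : Cq P →ₗ[ℂ] ℂ := (kInvHom P).toLinearMap

/-- The functional `e`. -/
def eFun : Cq P →ₗ[ℂ] ℂ := Matrix.entryLinearMap ℂ ℂ 0 1 ∘ₗ (eMat P).toLinearMap

/-- The functional `f`. -/
def fFun : Cq P →ₗ[ℂ] ℂ := Matrix.entryLinearMap ℂ ℂ 0 1 ∘ₗ (fMat P).toLinearMap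

theorem eMat_apply (x : Cq P) : eMat P x 0 0 = kHom P x ∧ eMat P x 1 0 = 0 ∧
    eMat P x 1 1 = counitHom P x := by
  induction x using induction with
  | hone => simp
  | hsmul r x hx => simp [hx.1, hx.2.1, hx.2.2]
  | hgen g x hx =>
    simp only [map_mul, eMat_gen, kHom_gen, counitHom_gen, Matrix.mul_apply, Fin.sum_univ_two, hx]
    cases g <;> simp
  | hadd x y hx hy => simp [hx.1, hx.2.1, hx.2.2, hy.1, hy.2.1, hy.2.2]

theorem fMat_apply (x : Cq P) : fMat P x 0 0 = counitHom P x ∧ fMat P x 1 0 = 0 ∧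
    fMat P x 1 1 = kInvHom P x := by
  induction x using induction with
  | hone => simp
  | hsmul r x hx => simp [hx.1, hx.2.1, hx.2.2]
  | hgen g x hx =>
    simp only [map_mul, fMat_gen, kInvHom_gen, counitHom_gen, Matrix.mul_apply, Fin.sum_univ_two,
      hx]
    cases g <;> simp
  | hadd x y hx hy => simp [hx.1, hx.2.1, hx.2.2, hy.1, hy.2.1, hy.2.2]

/-- The rule `e(x y) = e(x) ε(y) + k(x) e(y)`. -/
theorem eFun_mul (x y : Cq P) :
    eFun P (x * y) = eFun P x * counitHom P y + kHom P x * eFun P y := by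
  simp [eFun, Matrix.mul_apply, Fin.sum_univ_two, eMat_apply]
  ring

/-- The rule `f(x y) = f(x) k⁻¹(y) + ε(x) f(y)`. -/
theorem fFun_mul (x y : Cq P) :
    fFun P (x * y) = fFun P x * kInvHom P y + counitHom P x * fFun P y := by
  simp [fFun, Matrix.mul_apply, Fin.sum_univ_two, fMat_apply]
  ring

theorem eFun_gen (g : CGen) : eFun P (gen P g) = (match g with | .b => eVal P | _ => 0) := by
  cases g <;> simp [eFun, eMat_gen]

theorem fFun_gen (g : CGen) : fFun P (gen P g) = (match g with | .c => 1 | _ => 0) := by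
  cases g <;> simp [fFun, fMat_gen]

theorem eFun_one : eFun P 1 = 0 := by simp [eFun]
theorem fFun_one : fFun P 1 = 0 := by simp [fFun]

theorem kHom_parity (u : Cq P) : kHom P (parity P u) = kHom P u := by
  suffices h : (kHom P).comp (parity P) = kHom P from DFunLike.congr_fun h u
  refine algHom_ext' fun g => ?_
  cases g <;> simp [parity_gen, kHom_gen]

theorem kInvHom_parity (u : Cq P) : kInvHom P (parity P u) = kInvHom P u := by
  suffices h : (kInvHom P).comp (parity P) = kInvHom P from DFunLike.congr_fun h u
  refine algHom_ext' fun g => ?_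
  cases g <;> simp [parity_gen, kInvHom_gen]

theorem eFun_parity (u : Cq P) : eFun P (parity P u) = -eFun P u := by
  suffices h : eFun P ∘ₗ (parity P).toLinearMap = -eFun P from LinearMap.congr_fun h u
  refine linear_ext ?_ ?_
  · simp [eFun_one]
  · intro g x hx
    simp only [LinearMap.comp_apply, AlgHom.toLinearMap_apply, LinearMap.neg_apply] at hx ⊢
    rw [map_mul, eFun_mul, eFun_mul, hx, counitHom_parity, kHom_parity]
    cases g <;> simp [parity_gen, eFun_gen, kHom_gen]

theorem fFun_parity (u : Cq P) : fFun P (parity P u) = -fFun P u := by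
  suffices h : fFun P ∘ₗ (parity P).toLinearMap = -fFun P from LinearMap.congr_fun h u
  refine linear_ext ?_ ?_
  · simp [fFun_one]
  · intro g x hx
    simp only [LinearMap.comp_apply, AlgHom.toLinearMap_apply, LinearMap.neg_apply] at hx ⊢
    rw [map_mul, fFun_mul, fFun_mul, hx, counitHom_parity, kInvHom_parity]
    cases g <;> simp [parity_gen, fFun_gen, counitHom_gen]

/-- The dual of `ℂ_q(osp(1,2))` with the convolution product `(φ ψ)(u) = ∑ φ(u₁) ψ(u₂)`. -/
abbrev Dual : Type := WithConv (Cq P →ₗ[ℂ] ℂ)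

theorem comul_eq : (Coalgebra.comul : Cq P →ₗ[ℂ] Cq P ⊗[ℂ] Cq P) = comulLin P := rfl
theorem counit_eq : (Coalgebra.counit : Cq P →ₗ[ℂ] ℂ) = (counitHom P).toLinearMap := rfl

/-- The functional `k` in the convolution algebra. -/
def kDual : Dual P := .toConv (kFun P)
/-- The functional `k⁻¹` in the convolution algebra. -/
def kInvDual : Dual P := .toConv (kInvFun P)
/-- The functional `e` in the convolution algebra. -/
def eDual : Dual P := .toConv (eFun P)
/-- The functional `f` in the convolution algebra. -/
def fDual : Dual P := .toConv (fFun P)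

/-- Precomposition of a functional with left multiplication by a generator. -/
theorem kFun_comp (g : CGen) : kFun P ∘ₗ LinearMap.mulLeft ℂ (gen P g) =
    (match g with | .a => P.t | .b => 0 | .c => 0 | .d => -P.t⁻¹ | .σ => -1) • kFun P := by
  ext x; cases g <;> simp [kFun, kHom_gen]
theorem kInvFun_comp (g : CGen) : kInvFun P ∘ₗ LinearMap.mulLeft ℂ (gen P g) =
    (match g with | .a => P.t⁻¹ | .b => 0 | .c => 0 | .d => -P.t | .σ => -1) • kInvFun P := by
  ext x; cases g <;> simp [kInvFun, kInvHom_gen]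
theorem eFun_comp (g : CGen) : eFun P ∘ₗ LinearMap.mulLeft ℂ (gen P g) =
    (match g with
      | .a => P.t • eFun P | .b => eVal P • (counitHom P).toLinearMap | .c => 0
      | .d => (-P.t⁻¹) • eFun P | .σ => (-1 : ℂ) • eFun P) := by
  ext x; cases g <;> simp [eFun_mul, eFun_gen, kHom_gen]
theorem fFun_comp (g : CGen) : fFun P ∘ₗ LinearMap.mulLeft ℂ (gen P g) =
    (match g with
      | .a => fFun P | .b => 0 | .c => kInvFun P | .d => fFun P | .σ => fFun P) := by
  ext x; cases g <;> simp [fFun_mul, fFun_gen, counitHom_gen, kInvFun]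

theorem kFun_parity : kFun P ∘ₗ (parity P).toLinearMap = kFun P := by
  ext x; simp [kFun, kHom_parity]
theorem kInvFun_parity : kInvFun P ∘ₗ (parity P).toLinearMap = kInvFun P := by
  ext x; simp [kInvFun, kInvHom_parity]
theorem eFun_parity' : eFun P ∘ₗ (parity P).toLinearMap = (-1 : ℂ) • eFun P := by
  ext x; simp [eFun_parity]
theorem fFun_parity' : fFun P ∘ₗ (parity P).toLinearMap = (-1 : ℂ) • fFun P := by
  ext x; simp [fFun_parity]
theorem counit_parity' : (counitHom P).toLinearMap ∘ₗ (parity P).toLinearMap =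
    (counitHom P).toLinearMap := by
  ext x; simp [counitHom_parity]

theorem Dual.ext {φ ψ : Dual P} (h1 : φ 1 = ψ 1)
    (hg : ∀ g x, φ x = ψ x → φ (gen P g * x) = ψ (gen P g * x)) : φ = ψ :=
  WithConv.ext (linear_ext h1 hg)

theorem conv_one (φ ψ : Dual P) : (φ * ψ) 1 = φ 1 * ψ 1 := by
  rw [LinearMap.convMul_apply, comul_eq, comulLin_one]; simp

theorem toConv_counit : (WithConv.toConv (counitHom P).toLinearMap : Dual P) = 1 := by
  ext x; simp [counit_eq]

/-- The value of `φ ⊗ ψ` on a tensor. -/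
def pair (φ ψ : Cq P →ₗ[ℂ] ℂ) : Cq P ⊗[ℂ] Cq P →ₗ[ℂ] ℂ :=
  LinearMap.mul' ℂ ℂ ∘ₗ TensorProduct.map φ ψ

theorem conv_eq (φ ψ : Cq P →ₗ[ℂ] ℂ) (u : Cq P) :
    pair P φ ψ (comulLin P u) = (WithConv.toConv φ * WithConv.toConv ψ : Dual P) u := rfl

theorem conv_gen_mul (φ ψ : Cq P →ₗ[ℂ] ℂ) (g : CGen) (u : Cq P) :
    (WithConv.toConv φ * WithConv.toConv ψ : Dual P) (gen P g * u) =
      pair P φ ψ (comulOp P g (comulLin P u)) := by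
  rw [← conv_eq, comulLin_gen_mul]

theorem pair_map (φ ψ : Cq P →ₗ[ℂ] ℂ) (f g : Cq P →ₗ[ℂ] Cq P) (z : Cq P ⊗[ℂ] Cq P) :
    pair P φ ψ (TensorProduct.map f g z) = pair P (φ ∘ₗ f) (ψ ∘ₗ g) z := by
  rw [pair, pair, TensorProduct.map_comp]; rfl

theorem pair_smul_left (r : ℂ) (φ ψ : Cq P →ₗ[ℂ] ℂ) : pair P (r • φ) ψ = r • pair P φ ψ := by
  rw [pair, TensorProduct.map_smul_left, LinearMap.comp_smul]; rfl

theorem pair_smul_right (r : ℂ) (φ ψ : Cq P →ₗ[ℂ] ℂ) : pair P φ (r • ψ) = r • pair P φ ψ := by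
  rw [pair, TensorProduct.map_smul_right, LinearMap.comp_smul]; rfl

theorem pair_neg_left (φ ψ : Cq P →ₗ[ℂ] ℂ) : pair P (-φ) ψ = -pair P φ ψ := by
  rw [← neg_one_smul ℂ φ, pair_smul_left, neg_one_smul]

theorem pair_neg_right (φ ψ : Cq P →ₗ[ℂ] ℂ) : pair P φ (-ψ) = -pair P φ ψ := by
  rw [← neg_one_smul ℂ ψ, pair_smul_right, neg_one_smul]

theorem pair_zero_left (ψ : Cq P →ₗ[ℂ] ℂ) : pair P 0 ψ = 0 := by
  rw [pair, TensorProduct.map_zero_left, LinearMap.comp_zero]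

theorem pair_zero_right (φ : Cq P →ₗ[ℂ] ℂ) : pair P φ 0 = 0 := by
  rw [pair, TensorProduct.map_zero_right, LinearMap.comp_zero]

theorem pair_counit_left (ψ : Cq P →ₗ[ℂ] ℂ) (u : Cq P) :
    pair P (counitHom P).toLinearMap ψ (comulLin P u) = ψ u := by
  rw [conv_eq, toConv_counit, one_mul]

theorem pair_counit_right (φ : Cq P →ₗ[ℂ] ℂ) (u : Cq P) :
    pair P φ (counitHom P).toLinearMap (comulLin P u) = φ u := by
  rw [conv_eq, toConv_counit, mul_one]

theorem kDual_mul_kInvDual : kDual P * kInvDual P = 1 := by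
  refine Dual.ext P ?_ ?_
  · simp [comul_eq, comulLin_one, kDual, kInvDual, kFun, kInvFun, counit_eq]
  · intro g x hx
    have ht := P.t_ne_zero
    simp only [kDual, kInvDual] at hx ⊢
    rw [conv_gen_mul]
    rw [← conv_eq] at hx
    cases g <;> simp [comulOp, pair_map, ← LinearMap.comp_assoc, kFun_comp, kInvFun_comp,
      kFun_parity, LinearMap.smul_comp, pair_smul_left, pair_smul_right,
      pair_neg_left, pair_neg_right, pair_zero_left,
      pair_zero_right, hx, counit_eq, counitHom_gen] <;> try field_simp

theorem kInvDual_mul_kDual : kInvDual P * kDual P = 1 := by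
  refine Dual.ext P ?_ ?_
  · simp [comul_eq, comulLin_one, kDual, kInvDual, kFun, kInvFun, counit_eq]
  · intro g x hx
    have ht := P.t_ne_zero
    simp only [kDual, kInvDual] at hx ⊢
    rw [conv_gen_mul]
    rw [← conv_eq] at hx
    cases g <;> simp [comulOp, pair_map, ← LinearMap.comp_assoc, kFun_comp, kInvFun_comp,
      kInvFun_parity, LinearMap.smul_comp, pair_smul_left, pair_smul_right,
      pair_neg_left, pair_neg_right, pair_zero_left,
      pair_zero_right, hx, counit_eq, counitHom_gen] <;> try field_simp

theorem kDual_mul_eDual : kDual P * eDual P = P.q • (eDual P * kDual P) := by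
  refine Dual.ext P ?_ ?_
  · simp [comul_eq, comulLin_one, kDual, eDual, eFun_one]
  · intro g x hx
    have ht := P.t_ne_zero
    have hq : P.q = -P.t ^ 2 := by rw [P.t_sq, neg_neg]
    simp only [kDual, eDual, WithConv.ofConv_smul, LinearMap.smul_apply] at hx ⊢
    rw [conv_gen_mul, conv_gen_mul]
    rw [← conv_eq, ← conv_eq] at hx
    cases g <;> simp [comulOp, pair_map, ← LinearMap.comp_assoc, kFun_comp, eFun_comp,
      kFun_parity, eFun_parity', counit_parity', LinearMap.smul_comp, pair_smul_left,
      pair_smul_right, pair_neg_left, pair_neg_right, pair_zero_left, pair_counit_left, pair_counit_right,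
      pair_zero_right, hx, counitHom_gen] <;> (try rw [hq]) <;> (try field_simp) <;> try ring1

theorem kDual_mul_fDual : kDual P * fDual P = P.q⁻¹ • (fDual P * kDual P) := by
  refine Dual.ext P ?_ ?_
  · simp [comul_eq, comulLin_one, kDual, fDual, fFun_one]
  · intro g x hx
    have ht := P.t_ne_zero
    have hq : P.q = -P.t ^ 2 := by rw [P.t_sq, neg_neg]
    have h1 := congrArg (fun φ : Dual P => φ x) (kDual_mul_kInvDual P)
    have h2 := congrArg (fun φ : Dual P => φ x) (kInvDual_mul_kDual P)
    simp only [kDual, fDual, kInvDual, WithConv.ofConv_smul, LinearMap.smul_apply] at hx h1 h2 ⊢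
    rw [conv_gen_mul, conv_gen_mul]
    rw [← conv_eq, ← conv_eq] at hx
    rw [← conv_eq] at h1 h2
    cases g <;> simp [comulOp, pair_map, ← LinearMap.comp_assoc, kFun_comp, fFun_comp,
      kFun_parity, fFun_parity', counit_parity', LinearMap.smul_comp, pair_smul_left,
      pair_smul_right, pair_neg_left, pair_neg_right, pair_zero_left, pair_counit_left, pair_counit_right,
      pair_zero_right, hx, h1, h2, counitHom_gen] <;> (try rw [hq]) <;> (try field_simp) <;> try ring1

theorem eDual_mul_kInvDual : eDual P * kInvDual P = P.q • (kInvDual P * eDual P) := by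
  calc eDual P * kInvDual P
      = kInvDual P * kDual P * (eDual P * kInvDual P) := by rw [kInvDual_mul_kDual, one_mul]
    _ = kInvDual P * (kDual P * eDual P) * kInvDual P := by simp only [mul_assoc]
    _ = P.q • (kInvDual P * eDual P * (kDual P * kInvDual P)) := by
        rw [kDual_mul_eDual, mul_smul_comm, smul_mul_assoc]; simp only [mul_assoc]
    _ = P.q • (kInvDual P * eDual P) := by rw [kDual_mul_kInvDual, mul_one]

theorem eDual_mul_fDual_add : eDual P * fDual P + fDual P * eDual P =
    (P.q - P.q⁻¹)⁻¹ • (kDual P - kInvDual P) := by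
  refine Dual.ext P ?_ ?_
  · simp [comul_eq, comulLin_one, kDual, fDual, eDual, kInvDual, fFun_one, eFun_one, kFun, kInvFun]
  · intro g x hx
    have ht := P.t_ne_zero
    simp only [kDual, fDual, eDual, kInvDual, WithConv.ofConv_smul, LinearMap.smul_apply,
      WithConv.ofConv_add, LinearMap.add_apply, WithConv.ofConv_sub, LinearMap.sub_apply]
      at hx ⊢
    rw [conv_gen_mul, conv_gen_mul]
    rw [← conv_eq, ← conv_eq] at hx
    have hx' := eq_sub_of_add_eq hx
    have hc := congrArg (fun φ : Dual P => φ x) (eDual_mul_kInvDual P)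
    simp only [eDual, kInvDual, WithConv.ofConv_smul, LinearMap.smul_apply] at hc
    rw [← conv_eq, ← conv_eq, show P.q = -P.t ^ 2 by rw [P.t_sq, neg_neg]] at hc
    have hk : (kHom P).toLinearMap = kFun P := rfl
    have hki : (kInvHom P).toLinearMap = kInvFun P := rfl
    have hkm : ∀ g, kFun P (gen P g * x) = kHom P (gen P g) * kFun P x :=
      fun g => map_mul (kHom P) _ _
    have hkim : ∀ g, kInvFun P (gen P g * x) = kInvHom P (gen P g) * kInvFun P x :=
      fun g => map_mul (kInvHom P) _ _
    have hkp : kInvFun P (parity P x) = kInvFun P x := kInvHom_parity P x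
    simp only [smul_eq_mul] at hx'
    cases g <;> simp [comulOp, pair_map, ← LinearMap.comp_assoc, eFun_comp, fFun_comp,
      eFun_parity', fFun_parity', counit_parity', LinearMap.smul_comp, pair_smul_left,
      pair_smul_right, pair_neg_left, pair_neg_right, pair_zero_left, pair_counit_left, pair_counit_right,
      pair_zero_right, hx', hc, hk, hki, counitHom_gen, kHom_gen, kInvHom_gen, eVal,
      div_eq_mul_inv, hkm, hkim, hkp] <;> (try ring1)
    field_simp
    ring

end Cq

/-! ### The quantized enveloping algebra -/

/-- The generators `k, k⁻¹, e, f`. -/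
inductive UGen
  | k | kInv | e | f

/-- The defining relations of the quantized enveloping algebra. -/
inductive URel (P : Params) : FreeAlgebra ℂ UGen → FreeAlgebra ℂ UGen → Prop
  | k_kInv : URel P (.ι ℂ .k * .ι ℂ .kInv) 1
  | kInv_k : URel P (.ι ℂ .kInv * .ι ℂ .k) 1
  | kek : URel P (.ι ℂ .k * .ι ℂ .e * .ι ℂ .kInv) (P.q • .ι ℂ .e)
  | kfk : URel P (.ι ℂ .k * .ι ℂ .f * .ι ℂ .kInv) (P.q⁻¹ • .ι ℂ .f)
  | ef_fe : URel P (.ι ℂ .e * .ι ℂ .f + .ι ℂ .f * .ι ℂ .e)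
      ((P.q - P.q⁻¹)⁻¹ • (.ι ℂ .k - .ι ℂ .kInv))

/-- The quantized enveloping algebra `U_q(osp(1,2))` as an algebra. -/
def Uq (P : Params) : Type := RingQuot (URel P)

instance (P : Params) : Ring (Uq P) := inferInstanceAs (Ring (RingQuot (URel P)))
instance (P : Params) : Algebra ℂ (Uq P) := inferInstanceAs (Algebra ℂ (RingQuot (URel P)))

namespace Uq

variable (P : Params)

/-- The quotient map from the free algebra. -/
def mk : FreeAlgebra ℂ UGen →ₐ[ℂ] Uq P := RingQuot.mkAlgHom ℂ (URel P)

theorem mk_surjective : Function.Surjective (mk P) := RingQuot.mkAlgHom_surjective ℂ (URel P)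

variable {P} in
theorem mk_rel {x y : FreeAlgebra ℂ UGen} (h : URel P x y) : mk P x = mk P y :=
  RingQuot.mkAlgHom_rel ℂ h

/-- The image of a generator in `U_q(osp(1,2))`. -/
def gen (g : UGen) : Uq P := mk P (.ι ℂ g)

/-- The generator `k`. -/
abbrev k : Uq P := gen P .k
/-- The generator `k⁻¹`. -/
abbrev kInv : Uq P := gen P .kInv
/-- The generator `e`. -/
abbrev e : Uq P := gen P .e
/-- The generator `f`. -/
abbrev f : Uq P := gen P .f

theorem k_kInv_rel : k P * kInv P = 1 := by
  simpa [gen] using mk_rel (URel.k_kInv (P := P))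
theorem kInv_k_rel : kInv P * k P = 1 := by
  simpa [gen] using mk_rel (URel.kInv_k (P := P))
theorem kek_rel : k P * e P * kInv P = P.q • e P := by
  simpa [gen] using mk_rel (URel.kek (P := P))
theorem kfk_rel : k P * f P * kInv P = P.q⁻¹ • f P := by
  simpa [gen] using mk_rel (URel.kfk (P := P))
theorem ef_fe_rel : e P * f P + f P * e P = (P.q - P.q⁻¹)⁻¹ • (k P - kInv P) := by
  simpa [gen] using mk_rel (URel.ef_fe (P := P))

variable {P} in
/-- The algebra homomorphism with prescribed values on the generators that satisfy the defining
relations. -/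
def lift {B : Type} [Ring B] [Algebra ℂ B] (k kInv e f : B)
    (h1 : k * kInv = 1) (h2 : kInv * k = 1) (hkek : k * e * kInv = P.q • e)
    (hkfk : k * f * kInv = P.q⁻¹ • f) (hef : e * f + f * e = (P.q - P.q⁻¹)⁻¹ • (k - kInv)) :
    Uq P →ₐ[ℂ] B :=
  RingQuot.liftAlgHom ℂ ⟨FreeAlgebra.lift ℂ
    (fun g => match g with | .k => k | .kInv => kInv | .e => e | .f => f), by
      intro x y h
      cases h <;> simpa⟩

variable {P} in
theorem lift_gen {B : Type} [Ring B] [Algebra ℂ B] (k kInv e f : B)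
    (h1 h2 hkek hkfk hef) (g : UGen) :
    lift (P := P) k kInv e f h1 h2 hkek hkfk hef (gen P g) =
      (match g with | .k => k | .kInv => kInv | .e => e | .f => f) := by
  have h : lift (P := P) k kInv e f h1 h2 hkek hkfk hef (gen P g) =
      FreeAlgebra.lift ℂ (fun g : UGen => match g with
        | .k => k | .kInv => kInv | .e => e | .f => f) (.ι ℂ g) :=
    RingQuot.liftAlgHom_mkAlgHom_apply ℂ _ _ _
  rw [h, FreeAlgebra.lift_ι_apply]

/-- The counit: `k, k⁻¹ ↦ 1` and `e, f ↦ 0`. -/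
def counit : Uq P →ₐ[ℂ] ℂ :=
  lift 1 1 0 0 (by simp) (by simp) (by simp) (by simp) (by simp)

/-- The parity automorphism: `k, k⁻¹` are even and `e, f` are odd. -/
def parity : Uq P →ₐ[ℂ] Uq P :=
  lift (k P) (kInv P) (-e P) (-f P) (k_kInv_rel P) (kInv_k_rel P) (by simp [kek_rel])
    (by simp [kfk_rel]) (by simpa using ef_fe_rel P)

/-- The dual pairing, as the algebra homomorphism from `U_q(osp(1,2))` to the dual of
`ℂ_q(osp(1,2))` with the convolution product `(x y)(u) = ∑ x(u₁) y(u₂)`. -/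
def pairing : Uq P →ₐ[ℂ] Cq.Dual P :=
  lift (Cq.kDual P) (Cq.kInvDual P) (Cq.eDual P) (Cq.fDual P)
    (Cq.kDual_mul_kInvDual P) (Cq.kInvDual_mul_kDual P)
    (by rw [Cq.kDual_mul_eDual, smul_mul_assoc, mul_assoc, Cq.kDual_mul_kInvDual, mul_one])
    (by rw [Cq.kDual_mul_fDual, smul_mul_assoc, mul_assoc, Cq.kDual_mul_kInvDual, mul_one])
    (Cq.eDual_mul_fDual_add P)

variable {P}

/-- The value `x(u)` of `x ∈ U_q(osp(1,2))` at `u ∈ ℂ_q(osp(1,2))`, as a linear functional. -/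
def eval (x : Uq P) : Cq P →ₗ[ℂ] ℂ := (pairing P x).ofConv

/-- The right action `R_x(u) = ∑ x(u₁) u₂`. -/
def rightAct (x : Uq P) : Cq P →ₗ[ℂ] Cq P :=
  (TensorProduct.lid ℂ (Cq P)).toLinearMap ∘ₗ (eval x).rTensor (Cq P) ∘ₗ Coalgebra.comul

/-- The left action `L_x(u) = ∑ (-1)^{p(x) p(u₁)} x(u₂) u₁`, extended linearly from homogeneous
`x`: the even component of `x` contributes `∑ x(u₂) u₁`, and the odd component contributes
`∑ x(u₂) (-1)^{p(u₁)} u₁`. -/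
def leftAct (x : Uq P) : Cq P →ₗ[ℂ] Cq P :=
  (TensorProduct.rid ℂ (Cq P)).toLinearMap ∘ₗ
    (TensorProduct.map LinearMap.id (eval (evenPart (parity P) x)) +
      TensorProduct.map (Cq.parity P).toLinearMap (eval (oddPart (parity P) x))) ∘ₗ
    Coalgebra.comul

/-- The right invariants of a subspace `J` of `U_q(osp(1,2))`: all `u` with
`R_x(u) = ε(x) u` for every `x ∈ J`. -/
def rightInvariants (J : Submodule ℂ (Uq P)) : Submodule ℂ (Cq P) :=
  ⨅ x ∈ J, LinearMap.eqLocus (rightAct x) (counit P x • LinearMap.id)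

/-- The left invariants of a subspace `J` of `U_q(osp(1,2))`: all `u` with
`L_x(u) = ε(x) u` for every `x ∈ J`. -/
def leftInvariants (J : Submodule ℂ (Uq P)) : Submodule ℂ (Cq P) :=
  ⨅ x ∈ J, LinearMap.eqLocus (leftAct x) (counit P x • LinearMap.id)

variable (P) in
/-- The element `α e + β f k + γ (k - 1)`. -/
def primitive (α β γ : ℂ) : Uq P := α • e P + β • (f P * k P) + γ • (k P - 1)

end Uq

/-! ### The matrix elements -/

/-- The shifted factorial `(u; v)_m = ∏_{k < m} (1 - u v^k)`. -/
def qPochhammer (u v : ℂ) (m : ℕ) : ℂ := ∏ k ∈ Finset.range m, (1 - u * v ^ k)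

/-- The Gauss binomial coefficient `(v; v)_m / ((v; v)_n (v; v)_{m-n})`, for `n ≤ m`. -/
def gaussBinom (v : ℂ) (m n : ℕ) : ℂ :=
  qPochhammer v v m / (qPochhammer v v n * qPochhammer v v (m - n))

namespace Cq

variable (P : Params)

/-- The scalar `i^{[(ℓ+i)/2]} (2ℓ choose ℓ+i)^{1/2}_{t⁻²}`, with `n = 2ℓ` and `r = ℓ + i`, where
the power `1/2` is the principal square root. -/
def ξCoeff (n r : ℕ) : ℂ :=
  Complex.I ^ (r / 2) * gaussBinom (P.t ^ (-2 : ℤ)) n r ^ (1 / 2 : ℂ)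

/-- The basis vectors of the left comodule `V_ℓ`. With `n = 2ℓ` and `r = ℓ + i`, this is
`ξ_i^{(ℓ)} = i^{[(ℓ+i)/2]} (2ℓ choose ℓ+i)^{1/2}_{t⁻²} a^{ℓ-i} c^{ℓ+i}`; the index set
`{-ℓ, …, ℓ}` of `i` corresponds to `r ∈ {0, …, n}`. -/
def ξ (n : ℕ) (r : Fin (n + 1)) : Cq P := ξCoeff P n r • (a P ^ (n - (r : ℕ)) * c P ^ (r : ℕ))

theorem v_pow_ne_one (m : ℕ) (hm : 0 < m) : (P.t ^ (-2 : ℤ)) ^ m ≠ 1 := by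
  intro h
  have hv : P.t ^ (-2 : ℤ) = (-P.q)⁻¹ := by
    rw [zpow_neg, ← P.t_sq]; rfl
  rw [hv, inv_pow, inv_eq_one] at h
  apply P.q_pow_ne_one (m * 2) (by omega)
  calc P.q ^ (m * 2) = ((-P.q) ^ m) ^ 2 := by
        rw [← pow_mul, mul_comm, pow_mul, pow_mul, neg_sq]
    _ = 1 := by rw [h, one_pow]

theorem qPochhammer_ne_zero (m : ℕ) :
    qPochhammer (P.t ^ (-2 : ℤ)) (P.t ^ (-2 : ℤ)) m ≠ 0 := by
  rw [qPochhammer, Finset.prod_ne_zero_iff]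
  intro k _
  rw [← pow_succ', sub_ne_zero]
  exact (v_pow_ne_one P (k + 1) (Nat.succ_pos k)).symm

theorem ξCoeff_ne_zero (n r : ℕ) : ξCoeff P n r ≠ 0 := by
  refine mul_ne_zero (pow_ne_zero _ Complex.I_ne_zero) ?_
  rw [Complex.cpow_ne_zero_iff]
  left
  exact div_ne_zero (qPochhammer_ne_zero P _)
    (mul_ne_zero (qPochhammer_ne_zero P _) (qPochhammer_ne_zero P _))

theorem ca_rel : c P * a P = P.t⁻¹ • (a P * c P) := by
  rw [ac_rel, smul_smul, inv_mul_cancel₀ P.t_ne_zero, one_smul]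

theorem c_mul_a_pow (m : ℕ) : c P * a P ^ m = P.t⁻¹ ^ m • (a P ^ m * c P) := by
  induction m with
  | zero => simp
  | succ m ih =>
    rw [pow_succ, ← mul_assoc, ih, smul_mul_assoc, mul_assoc, ca_rel, mul_smul_comm, smul_smul,
      ← mul_assoc, pow_succ]

/-- The span of the tensors `x ⊗ a^p c^r` with `p + r = n`. -/
def tensorSpan (n : ℕ) : Submodule ℂ (Cq P ⊗[ℂ] Cq P) :=
  Submodule.span ℂ {z | ∃ (x : Cq P) (p r : ℕ), p + r = n ∧ z = x ⊗ₜ[ℂ] (a P ^ p * c P ^ r)}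

theorem comulOp_mem (n : ℕ) (g : CGen) (hg : g = .a ∨ g = .c) (z : Cq P ⊗[ℂ] Cq P)
    (hz : z ∈ tensorSpan P n) : comulOp P g z ∈ tensorSpan P (n + 1) := by
  induction hz using Submodule.span_induction with
  | mem z hz =>
    obtain ⟨x, p, r, hpr, rfl⟩ := hz
    have ha : ∀ y : Cq P, y ⊗ₜ[ℂ] (a P * (a P ^ p * c P ^ r)) ∈ tensorSpan P (n + 1) :=
      fun y => Submodule.subset_span ⟨y, p + 1, r, by omega, by rw [pow_succ', mul_assoc]⟩
    have hc : ∀ y : Cq P, y ⊗ₜ[ℂ] (c P * (a P ^ p * c P ^ r)) ∈ tensorSpan P (n + 1) := by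
      intro y
      rw [← mul_assoc, c_mul_a_pow, smul_mul_assoc, TensorProduct.tmul_smul, mul_assoc,
        ← pow_succ']
      exact Submodule.smul_mem _ _ (Submodule.subset_span ⟨y, p, r + 1, by omega, rfl⟩)
    rcases hg with rfl | rfl
    · exact Submodule.add_mem _ (ha _) (hc _)
    · exact Submodule.add_mem _ (ha _) (hc _)
  | zero => rw [map_zero]; exact Submodule.zero_mem _
  | add u v _ _ hu hv => rw [map_add]; exact Submodule.add_mem _ hu hv
  | smul s u _ hu => rw [map_smul]; exact Submodule.smul_mem _ _ hu

theorem comul_monomial_mem (p r : ℕ) :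
    comulLin P (a P ^ p * c P ^ r) ∈ tensorSpan P (p + r) := by
  induction p with
  | zero =>
    induction r with
    | zero =>
      rw [pow_zero, pow_zero, mul_one, comulLin_one]
      exact Submodule.subset_span ⟨1, 0, 0, rfl, by simp⟩
    | succ r ih =>
      rw [pow_zero, one_mul, pow_succ', comulLin_gen_mul]
      rw [pow_zero, one_mul] at ih
      exact comulOp_mem P _ _ (Or.inr rfl) _ ih
  | succ p ih =>
    rw [pow_succ', mul_assoc, comulLin_gen_mul, show p + 1 + r = p + r + 1 by omega]
    exact comulOp_mem P _ _ (Or.inl rfl) _ ih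

theorem exists_of_mem_tensorSpan (n : ℕ) (z : Cq P ⊗[ℂ] Cq P) (hz : z ∈ tensorSpan P n) :
    ∃ w : Fin (n + 1) → Cq P, z = ∑ j, w j ⊗ₜ[ℂ] ξ P n j := by
  induction hz using Submodule.span_induction with
  | mem z hz =>
    obtain ⟨x, p, r, hpr, rfl⟩ := hz
    refine ⟨Pi.single ⟨r, by omega⟩ ((ξCoeff P n r)⁻¹ • x), ?_⟩
    rw [Finset.sum_eq_single ⟨r, by omega⟩]
    · rw [Pi.single_eq_same, ξ, TensorProduct.tmul_smul, TensorProduct.smul_tmul', smul_smul,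
        mul_inv_cancel₀ (ξCoeff_ne_zero P n r), one_smul]
      simp only
      rw [show n - r = p by omega]
    · intro j _ hj
      rw [Pi.single_eq_of_ne hj, TensorProduct.zero_tmul]
    · simp
  | zero => exact ⟨0, by simp⟩
  | add u v _ _ hu hv =>
    obtain ⟨w, rfl⟩ := hu
    obtain ⟨w', rfl⟩ := hv
    exact ⟨w + w', by simp [TensorProduct.add_tmul, Finset.sum_add_distrib]⟩
  | smul s u _ hu =>
    obtain ⟨w, rfl⟩ := hu
    exact ⟨s • w, by simp [TensorProduct.smul_tmul', Finset.smul_sum]⟩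

theorem exists_matrixElements (n : ℕ) : ∃ m : Fin (n + 1) → Fin (n + 1) → Cq P,
    ∀ i, Coalgebra.comul (R := ℂ) (ξ P n i) = ∑ j, m i j ⊗ₜ[ℂ] ξ P n j := by
  have h : ∀ i : Fin (n + 1), ∃ w : Fin (n + 1) → Cq P,
      Coalgebra.comul (R := ℂ) (ξ P n i) = ∑ j, w j ⊗ₜ[ℂ] ξ P n j := by
    intro i
    apply exists_of_mem_tensorSpan
    rw [comul_eq, ξ, map_smul]
    have := comul_monomial_mem P (n - i) i
    rw [Nat.sub_add_cancel (Nat.lt_succ_iff.1 i.2)] at this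
    exact Submodule.smul_mem _ _ this
  choose m hm using h
  exact ⟨m, hm⟩

/-- The matrix elements `m_{ij}^{(ℓ)}`, with `n = 2ℓ`, determined by
`Δ(ξ_i) = ∑_j m_{ij} ⊗ ξ_j`. The indices `r, r' ∈ {0, …, n}` stand for `i = r - ℓ` and
`j = r' - ℓ`. -/
def matrixElement (n : ℕ) : Fin (n + 1) → Fin (n + 1) → Cq P :=
  Classical.choose (exists_matrixElements P n)

theorem comul_ξ (n : ℕ) (i : Fin (n + 1)) :
    Coalgebra.comul (R := ℂ) (ξ P n i) = ∑ j, matrixElement P n i j ⊗ₜ[ℂ] ξ P n j :=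
  Classical.choose_spec (exists_matrixElements P n) i

/-- The space `M_ℓ σ^s` spanned by the elements `m_{ij}^{(ℓ)} σ^s`, with `n = 2ℓ`. -/
def component (n s : ℕ) : Submodule ℂ (Cq P) :=
  Submodule.span ℂ (Set.range fun ij : Fin (n + 1) × Fin (n + 1) =>
    matrixElement P n ij.1 ij.2 * σ P ^ s)

end Cq
end QuantumOSp
end

noncomputable section

namespace QuantumOSp

/-! Attach to a functional `φ` the operator `rightOp φ`, `u ↦ ∑ φ(u₁) u₂`. Convolution becomes
composition in the opposite order (`rightOp_convMul`), so `Re`, `Rf`, `Rk` satisfy the relations of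
the enveloping algebra read backwards, and skew Leibniz rules give their effect on a product with a
generator. Since `e`, `f k` and `α e + β f k + γ (k - 1)` have counit zero, their invariants are
kernels.

Kernel of `Re`. It contains every `c^i d^j σ^s`. Those with `i + j = n` and fixed `s` span a space
`cdSpan` lying in an eigenspace of `Rk`, and different pairs `(n, s)` have different eigenvalues
because `t²` is not a root of unity. From each `x` in such a space grows the string `x, Rf x, …,
Rf^n x`; the anticommutator of `Re` and `Rf` shows that `Re` steps back along it with nonzero
factors (`Re_Rf_pow`, `stringFactor_ne_zero`). The strings span the whole algebra, since their span
is stable under left multiplication by the generators (`allStrings_eq_top`). Linear algebra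
(`ker_eq_iSup_of_strings`) then leaves only the starting points of the strings in the kernel. No PBW
basis is needed.

Matching with matrix elements. The comodule vectors with `r = n` and `r = 0` are multiples of `c^n`
and `a^n`, and the q-binomial theorem for their coproducts gives rows made of nonzero multiples of
`c^(n-j) d^j` and `a^(n-j) b^j`. This settles `e`. For `f k`, the isomorphism exchanging `a` with
`d` and `b` with `c`, from the algebra with parameters `q⁻¹, -t⁻¹`, carries `Re` to a multiple of
`Rk ∘ Rf` (`Rk_Rf_flipHom`), hence one kernel to the other.

First claim. On matrix elements `R_x` acts through the scalar matrix of values `x(m_{ij} σ^s)`. If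
this is invertible for both `s`, then `R_x` is injective on `M_ℓ + M_ℓ σ`; the same works for `L_x`
up to signs, whose net effect on the determinants is `β ↦ -β`. So an invariant forces a determinant
to vanish for some `s`. The conditions at `ℓ = 1/2` and `ℓ = 1` already give `γ = 0` and `αβ = 0`
(`eq_zero_of_det_eq_zero`). -/

theorem Params.t_pow_ne_one (P : Params) (m : ℕ) (hm : 0 < m) : P.t ^ (2 * m) ≠ 1 := by
  intro h
  rw [pow_mul, P.t_sq] at h
  apply P.q_pow_ne_one (m * 2) (by omega)
  calc P.q ^ (m * 2) = ((-P.q) ^ m) ^ 2 := by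
        rw [← pow_mul, mul_comm, pow_mul, pow_mul, neg_sq]
    _ = 1 := by rw [h, one_pow]

/-! ### The operators `R_k`, `R_e`, `R_f` and their relations -/

namespace Cq

variable {P : Params}

/-- The operator `u ↦ ∑ φ(u₁) u₂` attached to a functional `φ`. -/
def rightOp (φ : Cq P →ₗ[ℂ] ℂ) : Cq P →ₗ[ℂ] Cq P :=
  (TensorProduct.lid ℂ (Cq P)).toLinearMap ∘ₗ φ.rTensor (Cq P) ∘ₗ Coalgebra.comul

/-- Contraction of the first tensor factor against a functional. -/
def contractLeft (φ : Cq P →ₗ[ℂ] ℂ) : Cq P ⊗[ℂ] Cq P →ₗ[ℂ] Cq P :=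
  (TensorProduct.lid ℂ (Cq P)).toLinearMap ∘ₗ φ.rTensor (Cq P)

theorem contractLeft_tmul (φ : Cq P →ₗ[ℂ] ℂ) (x y : Cq P) :
    contractLeft φ (x ⊗ₜ y) = φ x • y := by
  simp [contractLeft]

theorem rightOp_apply (φ : Cq P →ₗ[ℂ] ℂ) (u : Cq P) :
    rightOp φ u = contractLeft φ (comulLin P u) := rfl

theorem contractLeft_map (φ : Cq P →ₗ[ℂ] ℂ) (A B : Cq P →ₗ[ℂ] Cq P) (z : Cq P ⊗[ℂ] Cq P) :
    contractLeft φ (TensorProduct.map A B z) = B (contractLeft (φ ∘ₗ A) z) := by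
  induction z using TensorProduct.induction_on with
  | zero => simp
  | tmul x y => simp [contractLeft_tmul]
  | add x y hx hy => simp [hx, hy]

theorem contractLeft_smul (r : ℂ) (φ : Cq P →ₗ[ℂ] ℂ) (z : Cq P ⊗[ℂ] Cq P) :
    contractLeft (r • φ) z = r • contractLeft φ z := by
  simp [contractLeft, LinearMap.rTensor_smul]

theorem contractLeft_neg (φ : Cq P →ₗ[ℂ] ℂ) (z : Cq P ⊗[ℂ] Cq P) :
    contractLeft (-φ) z = -contractLeft φ z := by
  rw [← neg_one_smul ℂ φ, contractLeft_smul, neg_one_smul]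

theorem contractLeft_zero (z : Cq P ⊗[ℂ] Cq P) :
    contractLeft (0 : Cq P →ₗ[ℂ] ℂ) z = 0 := by
  simp [contractLeft]

theorem contractLeft_counit (u : Cq P) :
    contractLeft (counitHom P).toLinearMap (comulLin P u) = u := by
  have := Coalgebra.rTensor_counit_comul (R := ℂ) u
  rw [counit_eq, comul_eq] at this
  simp [contractLeft, this]

theorem rightOp_one (φ : Cq P →ₗ[ℂ] ℂ) : rightOp φ 1 = φ 1 • 1 := by
  rw [rightOp_apply, comulLin_one, contractLeft_tmul]

theorem rightOp_smul (r : ℂ) (φ : Cq P →ₗ[ℂ] ℂ) : rightOp (r • φ) = r • rightOp φ := by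
  ext u; simp [rightOp_apply, contractLeft_smul]

theorem rightOp_add (φ ψ : Cq P →ₗ[ℂ] ℂ) : rightOp (φ + ψ) = rightOp φ + rightOp ψ := by
  ext u; simp [rightOp, LinearMap.rTensor_add]

/-- Convolution of functionals corresponds to composition of operators in the opposite order. -/
theorem rightOp_convMul (φ ψ : Cq P →ₗ[ℂ] ℂ) :
    rightOp (WithConv.toConv φ * WithConv.toConv ψ : Dual P).ofConv = rightOp ψ ∘ₗ rightOp φ := by
  ext u
  have h := Coalgebra.coassoc_apply (R := ℂ) u
  rw [comul_eq] at h
  -- Contract both sides of coassociativity with `φ` in the first and `ψ` in the second of the three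
  -- factors.
  have h2 := congrArg (contractLeft ψ ∘ₗ (TensorProduct.lid ℂ (Cq P ⊗[ℂ] Cq P)).toLinearMap ∘ₗ
    φ.rTensor (Cq P ⊗[ℂ] Cq P)) h
  have e1 : ∀ z : Cq P ⊗[ℂ] Cq P, (contractLeft ψ ∘ₗ
      (TensorProduct.lid ℂ (Cq P ⊗[ℂ] Cq P)).toLinearMap ∘ₗ φ.rTensor (Cq P ⊗[ℂ] Cq P))
      (TensorProduct.assoc ℂ _ _ _ ((comulLin P).rTensor (Cq P) z)) =
      contractLeft (WithConv.toConv φ * WithConv.toConv ψ : Dual P).ofConv z := by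
    intro z
    induction z using TensorProduct.induction_on with
    | zero => simp
    | tmul x y =>
      have : (WithConv.toConv φ * WithConv.toConv ψ : Dual P).ofConv x =
        pair P φ ψ (comulLin P x) := rfl
      rw [contractLeft_tmul, this, LinearMap.rTensor_tmul]
      generalize comulLin P x = w
      induction w using TensorProduct.induction_on with
      | zero => simp
      | tmul x' y' => simp [pair, contractLeft_tmul, mul_smul]
      | add x y hx hy => simp only [TensorProduct.add_tmul, map_add, hx, hy, add_smul]
    | add x y hx hy => simp only [map_add, hx, hy]
  have e2 : ∀ z : Cq P ⊗[ℂ] Cq P, (contractLeft ψ ∘ₗ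
      (TensorProduct.lid ℂ (Cq P ⊗[ℂ] Cq P)).toLinearMap ∘ₗ φ.rTensor (Cq P ⊗[ℂ] Cq P))
      ((comulLin P).lTensor (Cq P) z) = rightOp ψ (contractLeft φ z) := by
    intro z
    induction z using TensorProduct.induction_on with
    | zero => simp
    | tmul x y => simp [contractLeft_tmul, rightOp_apply]
    | add x y hx hy => simp only [map_add, hx, hy]
  rw [e1, e2] at h2
  exact h2

variable (P) in
/-- The operator `R_k`. -/
def Rk : Cq P →ₗ[ℂ] Cq P := rightOp (kFun P)
variable (P) in
/-- The operator `R_{k⁻¹}`. -/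
def RkInv : Cq P →ₗ[ℂ] Cq P := rightOp (kInvFun P)
variable (P) in
/-- The operator `R_e`. -/
def Re : Cq P →ₗ[ℂ] Cq P := rightOp (eFun P)
variable (P) in
/-- The operator `R_f`. -/
def Rf : Cq P →ₗ[ℂ] Cq P := rightOp (fFun P)

theorem Rk_one : Rk P 1 = 1 := by simp [Rk, rightOp_one, kFun]
theorem RkInv_one : RkInv P 1 = 1 := by simp [RkInv, rightOp_one, kInvFun]
theorem Re_one : Re P 1 = 0 := by simp [Re, rightOp_one, eFun_one]
theorem Rf_one : Rf P 1 = 0 := by simp [Rf, rightOp_one, fFun_one]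

/-- The functional `k` is multiplicative and kills `b` and `c`, so only the term of the generator's
coproduct with first leg `a`, `d` or `σ` survives. -/
theorem Rk_gen_mul (g : CGen) (u : Cq P) : Rk P (gen P g * u) =
    (match g with | .a => P.t | .b => P.t | .c => -P.t⁻¹ | .d => -P.t⁻¹ | .σ => -1) •
      (gen P g * Rk P u) := by
  rw [Rk, rightOp_apply, comulLin_gen_mul, rightOp_apply]
  cases g <;> simp [comulOp, contractLeft_map, ← LinearMap.comp_assoc, kFun_comp, kFun_parity,
    LinearMap.smul_comp, contractLeft_smul, contractLeft_neg, contractLeft_zero]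

theorem RkInv_gen_mul (g : CGen) (u : Cq P) : RkInv P (gen P g * u) =
    (match g with | .a => P.t⁻¹ | .b => P.t⁻¹ | .c => -P.t | .d => -P.t | .σ => -1) •
      (gen P g * RkInv P u) := by
  rw [RkInv, rightOp_apply, comulLin_gen_mul, rightOp_apply]
  cases g <;> simp [comulOp, contractLeft_map, ← LinearMap.comp_assoc, kInvFun_comp, kInvFun_parity,
    LinearMap.smul_comp, contractLeft_smul, contractLeft_neg, contractLeft_zero]

/-- A skew Leibniz rule. The inhomogeneous terms come from first leg `b`, the only generator on
which `e` is nonzero; the signs beyond those of `k` come from an odd second leg passing the first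
leg of `u`. -/
theorem Re_gen_mul (g : CGen) (u : Cq P) : Re P (gen P g * u) = (match g with
    | .a => P.t • (a P * Re P u) + eVal P • (c P * u)
    | .b => -(P.t • (b P * Re P u)) + eVal P • (d P * u)
    | .c => P.t⁻¹ • (c P * Re P u)
    | .d => -(P.t⁻¹ • (d P * Re P u))
    | .σ => -(σ P * Re P u)) := by
  rw [Re, rightOp_apply, comulLin_gen_mul, rightOp_apply]
  cases g <;> simp [comulOp, contractLeft_map, ← LinearMap.comp_assoc, eFun_comp, eFun_parity',
    LinearMap.smul_comp, contractLeft_smul, contractLeft_neg, contractLeft_zero,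
    contractLeft_counit, counit_parity']

/-- Here the inhomogeneous terms come from first leg `c`, and they carry `RkInv` because the rule
for `f` on a product evaluates `k⁻¹` on the second factor. -/
theorem Rf_gen_mul (g : CGen) (u : Cq P) : Rf P (gen P g * u) = (match g with
    | .a => a P * Rf P u
    | .b => -(b P * Rf P u)
    | .c => a P * RkInv P u - c P * Rf P u
    | .d => b P * RkInv P u + d P * Rf P u
    | .σ => σ P * Rf P u) := by
  rw [Rf, rightOp_apply, comulLin_gen_mul, rightOp_apply, RkInv, rightOp_apply]
  cases g <;> simp [comulOp, contractLeft_map, ← LinearMap.comp_assoc, fFun_comp, fFun_parity',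
    LinearMap.smul_comp, contractLeft_smul, contractLeft_neg, contractLeft_zero,
    contractLeft_counit, kInvFun_parity, sub_eq_add_neg]

theorem Rk_RkInv (u : Cq P) : Rk P (RkInv P u) = u := by
  have := rightOp_convMul (kInvFun P) (kFun P)
  have h : (WithConv.toConv (kInvFun P) * WithConv.toConv (kFun P) : Dual P) = 1 :=
    kInvDual_mul_kDual P
  rw [h, ← toConv_counit] at this
  have h3 := LinearMap.congr_fun this u
  simpa [Rk, RkInv, rightOp_apply (counitHom P).toLinearMap u, contractLeft_counit] using h3.symm

theorem RkInv_Rk (u : Cq P) : RkInv P (Rk P u) = u := by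
  have := rightOp_convMul (kFun P) (kInvFun P)
  have h : (WithConv.toConv (kFun P) * WithConv.toConv (kInvFun P) : Dual P) = 1 :=
    kDual_mul_kInvDual P
  rw [h, ← toConv_counit] at this
  have h3 := LinearMap.congr_fun this u
  simpa [Rk, RkInv, rightOp_apply (counitHom P).toLinearMap u, contractLeft_counit] using h3.symm

/-- Composition reverses convolution, so the relation `k f = q⁻¹ f k` produces the factor `q` here.
The anticommutator of `e` and `f` is symmetric and keeps its form in `Re_Rf`. -/
theorem Rk_Rf (u : Cq P) : Rk P (Rf P u) = P.q • Rf P (Rk P u) := by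
  have h : (WithConv.toConv (kFun P) * WithConv.toConv (fFun P) : Dual P) =
    P.q⁻¹ • (WithConv.toConv (fFun P) * WithConv.toConv (kFun P)) := kDual_mul_fDual P
  have h2 := congrArg (fun φ : Dual P => rightOp φ.ofConv u) h
  simp only [rightOp_convMul, WithConv.ofConv_smul, rightOp_smul] at h2
  change Rf P (Rk P u) = P.q⁻¹ • Rk P (Rf P u) at h2
  rw [h2, smul_smul, mul_inv_cancel₀ P.q_ne_zero, one_smul]

theorem Re_Rf (u : Cq P) : Re P (Rf P u) =
    (P.q - P.q⁻¹)⁻¹ • (Rk P u - RkInv P u) - Rf P (Re P u) := by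
  have h : (WithConv.toConv (eFun P) * WithConv.toConv (fFun P) : Dual P) +
    (WithConv.toConv (fFun P) * WithConv.toConv (eFun P) : Dual P) =
    (P.q - P.q⁻¹)⁻¹ • (WithConv.toConv (kFun P) - WithConv.toConv (kInvFun P)) :=
    eDual_mul_fDual_add P
  have h2 := congrArg (fun φ : Dual P => rightOp φ.ofConv u) h
  simp only [rightOp_convMul, WithConv.ofConv_smul, rightOp_smul, WithConv.ofConv_add,
    WithConv.ofConv_sub, rightOp_add, sub_eq_add_neg _ (WithConv.toConv (kInvFun P)).ofConv,
    WithConv.ofConv_toConv, ← neg_one_smul ℂ (kInvFun P)] at h2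
  rw [eq_sub_iff_add_eq, add_comm]
  simpa [sub_eq_add_neg, Rk, RkInv, Re, Rf] using h2

end Cq

/-! ### Linear algebra of strings -/

section Strings

variable {V ι : Type*} [AddCommGroup V] [Module ℂ V]

/-- The span of the strings `F^m x`, `m ≤ M`, with `x` in the spaces `H i`. -/
def stringSpan (F : Module.End ℂ V) (H : ι → Submodule ℂ V) (M : ℕ) : Submodule ℂ V :=
  ⨆ i, ⨆ m : Fin (M + 1), (H i).map (F ^ (m : ℕ))

theorem pow_mem_stringSpan {F : Module.End ℂ V} {H : ι → Submodule ℂ V} {M m : ℕ} (hm : m ≤ M)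
    {i : ι} {x : V} (hx : x ∈ H i) : (F ^ m) x ∈ stringSpan F H M :=
  Submodule.mem_iSup_of_mem i (Submodule.mem_iSup_of_mem (⟨m, by omega⟩ : Fin (M + 1))
    (Submodule.mem_map_of_mem hx))

theorem stringSpan_le {F : Module.End ℂ V} {H : ι → Submodule ℂ V} {M : ℕ} {W : Submodule ℂ V}
    (h : ∀ i, ∀ x ∈ H i, ∀ m ≤ M, (F ^ m) x ∈ W) : stringSpan F H M ≤ W := by
  refine iSup_le fun i => iSup_le fun m => ?_
  rintro _ ⟨x, hx, rfl⟩
  exact h i x hx m (by omega)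

theorem stringSpan_mono {F : Module.End ℂ V} {H : ι → Submodule ℂ V} :
    Monotone (stringSpan F H) := fun _ _ h =>
  stringSpan_le fun _ _ hx _ hm => pow_mem_stringSpan (hm.trans h) hx

/-- Splits off the highest power of `F`, which is what the induction on `M` in
`ker_eq_iSup_of_strings` removes. -/
theorem exists_of_mem_stringSpan_succ {F : Module.End ℂ V} {H : ι → Submodule ℂ V} {M : ℕ}
    {v : V} (hv : v ∈ stringSpan F H (M + 1)) :
    ∃ w ∈ stringSpan F H M, ∃ x ∈ ⨆ i, H i, v = w + (F ^ (M + 1)) x := by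
  suffices h : stringSpan F H (M + 1) ≤
      stringSpan F H M ⊔ (⨆ i, H i).map (F ^ (M + 1)) by
    obtain ⟨w, hw, _, ⟨x, hx, rfl⟩, rfl⟩ := Submodule.mem_sup.1 (h hv)
    exact ⟨w, hw, x, hx, rfl⟩
  refine stringSpan_le fun i x hx m hm => ?_
  rcases hm.lt_or_eq with hm | rfl
  · exact Submodule.mem_sup_left (pow_mem_stringSpan (by omega) hx)
  · exact Submodule.mem_sup_right (Submodule.mem_map_of_mem (Submodule.mem_iSup_of_mem i hx))

/-- If a space is spanned by the strings `F^m x` of lengths `n i + 1` generated by independent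
spaces `H i` of vectors killed by `E`, and `E` moves down the strings with nonzero factors, then
the kernel of `E` is the sum of the `H i`. -/
theorem ker_eq_iSup_of_strings (E F : Module.End ℂ V) (H : ι → Submodule ℂ V) (hH : iSupIndep H)
    (n : ι → ℕ) (c : ι → ℕ → ℂ) (hE : ∀ i, ∀ x ∈ H i, E x = 0)
    (hF : ∀ i, ∀ x ∈ H i, (F ^ (n i + 1)) x = 0)
    (hEF : ∀ i, ∀ x ∈ H i, ∀ m, E ((F ^ (m + 1)) x) = c i m • (F ^ m) x)
    (hc : ∀ i m, m < n i → c i m ≠ 0) (htop : ∀ v, ∃ M, v ∈ stringSpan F H M) :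
    LinearMap.ker E = ⨆ i, H i := by
  classical
  refine le_antisymm ?_ (iSup_le fun i x hx => hE i x hx)
  have hpow : ∀ i, ∀ x ∈ H i, ∀ m, (E ^ m) ((F ^ m) x) = (∏ l ∈ Finset.range m, c i l) • x := by
    intro i x hx m
    induction m with
    | zero => simp
    | succ m ih =>
      rw [pow_succ E, Module.End.mul_apply, hEF i x hx, map_smul, ih, smul_smul,
        Finset.prod_range_succ, mul_comm]
  have hkill : ∀ M, stringSpan F H M ≤ LinearMap.ker (E ^ (M + 1)) := by
    intro M
    refine stringSpan_le fun i x hx m hm => ?_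
    rw [LinearMap.mem_ker, show M + 1 = (M - m) + (1 + m) by omega, pow_add, pow_add,
      Module.End.mul_apply, Module.End.mul_apply, hpow i x hx, map_smul, pow_one, hE i x hx]
    simp
  have key : ∀ M, ∀ v ∈ stringSpan F H M, E v = 0 → v ∈ ⨆ i, H i := by
    intro M
    induction M with
    | zero =>
      intro v hv _
      revert hv
      suffices h : stringSpan F H 0 ≤ ⨆ i, H i from fun hv => h hv
      refine stringSpan_le fun i x hx m hm => ?_
      obtain rfl : m = 0 := by omega
      exact Submodule.mem_iSup_of_mem i hx
    | succ M ih =>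
      intro v hv hv0
      obtain ⟨w, hw, x, hx, rfl⟩ := exists_of_mem_stringSpan_succ hv
      obtain ⟨y, hy, rfl⟩ := (Submodule.mem_iSup_iff_exists_finsupp _ _).1 hx
      -- `E ^ (M + 1)` kills the lower layers and turns the top layer into a combination of the `y
      -- i`. Hence independence of the spaces `H i` suffices; independence of whole strings is not
      -- needed.
      have h1 : (E ^ (M + 1)) (w + (F ^ (M + 1)) (y.sum fun _ z => z)) = 0 := by
        rw [pow_succ, Module.End.mul_apply, hv0, map_zero]
      rw [map_add, hkill M hw, zero_add, Finsupp.sum, map_sum, map_sum] at h1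
      have h2 := (iSupIndep_iff_finsetSum_eq_zero_imp_eq_zero H).1 hH y.support
        (fun i => (∏ l ∈ Finset.range (M + 1), c i l) • y i)
        (fun i _ => (H i).smul_mem _ (hy i))
        (by rw [← h1]; exact Finset.sum_congr rfl fun i _ => (hpow i _ (hy i) _).symm)
      have h3 : (F ^ (M + 1)) (y.sum fun _ z => z) = 0 := by
        rw [Finsupp.sum, map_sum]
        refine Finset.sum_eq_zero fun i hi => ?_
        -- Either all factors on the way down are nonzero, so that `y i = 0`, or the string of `y i`
        -- has already ended before the power `M + 1`.
        by_cases hM : M + 1 ≤ n i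
        · have := h2 i hi
          rw [smul_eq_zero, Finset.prod_eq_zero_iff] at this
          rcases this with ⟨l, hl, h0⟩ | h0
          · exact absurd h0 (hc i l (by rw [Finset.mem_range] at hl; omega))
          · rw [h0, map_zero]
        · rw [show M + 1 = (M - n i) + (n i + 1) by omega, pow_add, Module.End.mul_apply,
            hF i _ (hy i), map_zero]
      rw [h3, add_zero] at hv0 ⊢
      exact ih w hw hv0
  intro v hv
  obtain ⟨M, hM⟩ := htop v
  exact key M v hM hv

end Strings

/-! ### Quantum integers and nonvanishing of scalars -/

/-- The quantum integer `[m]_v = (v^m - v^{-m}) / (v - v⁻¹)`. -/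
def qInt (v : ℂ) (m : ℕ) : ℂ := (v ^ m - v⁻¹ ^ m) / (v - v⁻¹)

theorem sub_inv_ne_zero {v : ℂ} (hv : v ≠ 0) (hv2 : v ^ 2 ≠ 1) : v - v⁻¹ ≠ 0 := by
  intro h
  apply hv2
  rw [sub_eq_zero] at h
  rw [pow_two]
  nth_rewrite 2 [h]
  exact mul_inv_cancel₀ hv

theorem qInt_one {v : ℂ} (hv : v ≠ 0) (hv2 : v ^ 2 ≠ 1) : qInt v 1 = 1 := by
  rw [qInt, pow_one, pow_one, div_self (sub_inv_ne_zero hv hv2)]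

/-- This asymmetric recursion is the one that arises when one more factor is peeled off on the left
in `Rf_c_pow_mul` and `Rf_d_pow_mul`. -/
theorem qInt_succ {v : ℂ} (hv : v ≠ 0) (hv2 : v ^ 2 ≠ 1) (m : ℕ) :
    qInt v (m + 1) = v ^ m + v⁻¹ * qInt v m := by
  have h := sub_inv_ne_zero hv hv2
  rw [qInt, qInt, div_eq_iff h, add_mul, mul_assoc, div_mul_cancel₀ _ h, pow_succ, pow_succ]
  ring

theorem qInt_ne_zero {v : ℂ} (hv : v ≠ 0) (hv2 : v ^ 2 ≠ 1) {m : ℕ} (hm : v ^ (2 * m) ≠ 1) :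
    qInt v m ≠ 0 := by
  refine div_ne_zero ?_ (sub_inv_ne_zero hv hv2)
  intro h
  apply hm
  rw [sub_eq_zero, inv_pow] at h
  rw [two_mul, pow_add]
  nth_rewrite 2 [h]
  exact mul_inv_cancel₀ (pow_ne_zero _ hv)

theorem Params.neg_t_ne_zero (P : Params) : -P.t ≠ 0 := neg_ne_zero.2 P.t_ne_zero

theorem Params.neg_t_pow_ne_one (P : Params) (m : ℕ) (hm : 0 < m) : (-P.t) ^ (2 * m) ≠ 1 := by
  rw [Even.neg_pow (even_two_mul m)]
  exact P.t_pow_ne_one m hm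

theorem Params.t_sq_ne_one (P : Params) : P.t ^ 2 ≠ 1 := by
  simpa using P.t_pow_ne_one 1 one_pos

theorem Params.neg_t_sq_ne_one (P : Params) : (-P.t) ^ 2 ≠ 1 := by
  simpa using P.neg_t_pow_ne_one 1 one_pos

theorem Params.q_sub_inv_ne_zero (P : Params) : P.q - P.q⁻¹ ≠ 0 :=
  sub_inv_ne_zero P.q_ne_zero (P.q_pow_ne_one 2 two_pos)

theorem Params.q_eq (P : Params) : P.q = -P.t ^ 2 := by rw [P.t_sq, neg_neg]

/-! ### Commutation relations, and `R_f` on powers of `c` and `d` -/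

namespace Cq

variable {P : Params}

theorem dc_rel : d P * c P = (-P.t⁻¹) • (c P * d P) := by
  rw [cd_rel', smul_smul, neg_mul_neg, inv_mul_cancel₀ P.t_ne_zero, one_smul]

theorem db_rel : d P * b P = (-P.t⁻¹) • (b P * d P) := by
  rw [bd_rel', smul_smul, neg_mul_neg, inv_mul_cancel₀ P.t_ne_zero, one_smul]

theorem cb_rel : c P * b P = (-1 : ℂ) • (b P * c P) := by
  rw [bc_rel', smul_smul]; simp

theorem ba_rel : b P * a P = P.t⁻¹ • (a P * b P) := by
  rw [ab_rel, smul_smul, inv_mul_cancel₀ P.t_ne_zero, one_smul]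

/-- Both summands of `σ = ad + t bc` anticommute with `c` separately. -/
theorem σc_rel : σ P * c P = (-1 : ℂ) • (c P * σ P) := by
  have ht := P.t_ne_zero
  have h1 : a P * d P * c P = (-1 : ℂ) • (c P * (a P * d P)) := by
    rw [mul_assoc, dc_rel, mul_smul_comm, ← mul_assoc, ac_rel, smul_mul_assoc, smul_smul, mul_assoc]
    congr 1
    field_simp
  have h2 : b P * c P * c P = (-1 : ℂ) • (c P * (b P * c P)) := by
    rw [bc_rel', smul_mul_assoc, mul_assoc, bc_rel']
  rw [← ad_bc_rel, add_mul, mul_add, h1, smul_mul_assoc, h2, mul_smul_comm, smul_add]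
  module

theorem σb_rel : σ P * b P = (-1 : ℂ) • (b P * σ P) := by
  have ht := P.t_ne_zero
  have h1 : a P * d P * b P = (-1 : ℂ) • (b P * (a P * d P)) := by
    rw [mul_assoc, db_rel, mul_smul_comm, ← mul_assoc, ab_rel, smul_mul_assoc, smul_smul, mul_assoc]
    congr 1
    field_simp
  have h2 : b P * c P * b P = (-1 : ℂ) • (b P * (b P * c P)) := by
    rw [mul_assoc, cb_rel, mul_smul_comm]
  rw [← ad_bc_rel, add_mul, mul_add, h1, smul_mul_assoc, h2, mul_smul_comm, smul_add]
  module

/-- The summands of `σ` do not commute with `d` one by one: the correction from replacing `ad` by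
`da` is compensated by `bc d = t² d bc`. -/
theorem σd_rel : σ P * d P = d P * σ P := by
  have ht := P.t_ne_zero
  have h1 : a P * d P = d P * a P + (P.t⁻¹ - P.t) • (b P * c P) := by
    rw [← ad_da_rel]; abel
  have h2 : b P * c P * d P = (P.t ^ 2) • (d P * (b P * c P)) := by
    rw [mul_assoc, cd_rel', mul_smul_comm, ← mul_assoc, bd_rel', smul_mul_assoc, smul_smul,
      mul_assoc]
    congr 1
    ring
  rw [← ad_bc_rel, mul_add, add_mul]
  nth_rewrite 1 [h1]
  rw [add_mul, smul_mul_assoc, smul_mul_assoc, h2, mul_smul_comm, mul_assoc]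
  match_scalars <;> field_simp <;> ring

theorem σa_rel : σ P * a P = a P * σ P := by
  have ht := P.t_ne_zero
  have h1 : a P * d P = d P * a P + (P.t⁻¹ - P.t) • (b P * c P) := by
    rw [← ad_da_rel]; abel
  have h2 : a P * (b P * c P) = (P.t ^ 2) • (b P * c P * a P) := by
    rw [← mul_assoc, ab_rel, smul_mul_assoc, mul_assoc, ac_rel, mul_smul_comm, smul_smul,
      mul_assoc]
    congr 1
    ring
  rw [← ad_bc_rel, mul_add, add_mul]
  nth_rewrite 2 [h1]
  rw [mul_add, smul_mul_assoc, mul_smul_comm, mul_smul_comm, h2, ← mul_assoc]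
  match_scalars <;> field_simp <;> ring

theorem σ_mul (x : Cq P) : σ P * x = parity P x * σ P := by
  induction x using induction with
  | hone => simp
  | hsmul r x hx => simp [hx]
  | hgen g x hx =>
    rw [← mul_assoc, map_mul, mul_assoc (parity P (gen P g)), ← hx, ← mul_assoc]
    cases g <;> simp [σa_rel, σb_rel, σc_rel, σd_rel, parity_gen]
  | hadd x y hx hy => simp [mul_add, add_mul, hx, hy]

/-- Powers of a generator that skew-commutes with another element. -/
theorem mul_pow_of_mul_eq_smul {x y : Cq P} {r : ℂ} (h : x * y = r • (y * x)) (m : ℕ) :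
    x * y ^ m = r ^ m • (y ^ m * x) := by
  induction m with
  | zero => simp
  | succ m ih =>
    rw [pow_succ, ← mul_assoc, ih, smul_mul_assoc, mul_assoc, h, mul_smul_comm, smul_smul,
      ← mul_assoc, pow_succ]

theorem Rk_gen_pow_mul (g : CGen) (m : ℕ) (u : Cq P) : Rk P (gen P g ^ m * u) =
    (match g with | .a => P.t | .b => P.t | .c => -P.t⁻¹ | .d => -P.t⁻¹ | .σ => -1) ^ m •
      (gen P g ^ m * Rk P u) := by
  induction m with
  | zero => simp
  | succ m ih =>
    rw [pow_succ', mul_assoc, Rk_gen_mul, ih, mul_smul_comm, smul_smul, mul_assoc]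
    congr 1
    cases g <;> exact (pow_succ' _ _).symm

theorem RkInv_gen_pow_mul (g : CGen) (m : ℕ) (u : Cq P) : RkInv P (gen P g ^ m * u) =
    (match g with | .a => P.t⁻¹ | .b => P.t⁻¹ | .c => -P.t | .d => -P.t | .σ => -1) ^ m •
      (gen P g ^ m * RkInv P u) := by
  induction m with
  | zero => simp
  | succ m ih =>
    rw [pow_succ', mul_assoc, RkInv_gen_mul, ih, mul_smul_comm, smul_smul, mul_assoc]
    congr 1
    cases g <;> exact (pow_succ' _ _).symm

theorem Rk_σ_pow (s : ℕ) : Rk P (σ P ^ s) = (-1 : ℂ) ^ s • σ P ^ s := by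
  simpa [Rk_one] using Rk_gen_pow_mul (P := P) .σ s 1

theorem RkInv_σ_pow (s : ℕ) : RkInv P (σ P ^ s) = (-1 : ℂ) ^ s • σ P ^ s := by
  simpa [RkInv_one] using RkInv_gen_pow_mul (P := P) .σ s 1

theorem Re_σ_pow (s : ℕ) : Re P (σ P ^ s) = 0 := by
  induction s with
  | zero => simp [Re_one]
  | succ s ih => rw [pow_succ', Re_gen_mul, ih]; simp

theorem Rf_σ_pow (s : ℕ) : Rf P (σ P ^ s) = 0 := by
  induction s with
  | zero => simp [Rf_one]
  | succ s ih => rw [pow_succ', Rf_gen_mul, ih]; simp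

theorem mul_mul_of_mul_eq_smul {x y : Cq P} {r : ℂ} (h : x * y = r • (y * x)) (z : Cq P) :
    x * (y * z) = r • (y * (x * z)) := by
  rw [← mul_assoc, h, smul_mul_assoc, mul_assoc]

theorem Rf_c_mul (u : Cq P) : Rf P (c P * u) = a P * RkInv P u - c P * Rf P u := Rf_gen_mul .c u
theorem Rf_d_mul (u : Cq P) : Rf P (d P * u) = b P * RkInv P u + d P * Rf P u := Rf_gen_mul .d u

theorem RkInv_c_pow_mul (i : ℕ) (u : Cq P) :
    RkInv P (c P ^ i * u) = (-P.t) ^ i • (c P ^ i * RkInv P u) := RkInv_gen_pow_mul .c i u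
theorem RkInv_d_pow_mul (i : ℕ) (u : Cq P) :
    RkInv P (d P ^ i * u) = (-P.t) ^ i • (d P ^ i * RkInv P u) := RkInv_gen_pow_mul .d i u

/-- By the Leibniz rule `Rf` turns one factor `c` into `a`. Moving that `a` to the front, together
with the eigenvalue of `RkInv` on the factors behind it, gives a geometric sum that is a quantum
integer at `-t`. -/
theorem Rf_c_pow_mul (i : ℕ) (v : Cq P) : Rf P (c P ^ (i + 1) * v) =
    qInt (-P.t) (i + 1) • (a P * (c P ^ i * RkInv P v)) +
      (-1 : ℂ) ^ (i + 1) • (c P ^ (i + 1) * Rf P v) := by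
  have ht := P.t_ne_zero
  induction i with
  | zero =>
    simp [Rf_c_mul, qInt_one P.neg_t_ne_zero P.neg_t_sq_ne_one, sub_eq_add_neg]
  | succ i ih =>
    rw [pow_succ' (c P) (i + 1), mul_assoc, Rf_c_mul, ih, RkInv_c_pow_mul,
      qInt_succ P.neg_t_ne_zero P.neg_t_sq_ne_one (i + 1), mul_add, mul_smul_comm, mul_smul_comm,
      mul_smul_comm, mul_mul_of_mul_eq_smul (ca_rel P), ← mul_assoc (c P) (c P ^ i), ← pow_succ',
      ← mul_assoc (c P), inv_neg]
    match_scalars <;> ring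

theorem Rf_d_pow_mul (i : ℕ) (v : Cq P) : Rf P (d P ^ (i + 1) * v) =
    qInt (-P.t) (i + 1) • (b P * (d P ^ i * RkInv P v)) + d P ^ (i + 1) * Rf P v := by
  have ht := P.t_ne_zero
  induction i with
  | zero =>
    simp [Rf_d_mul, qInt_one P.neg_t_ne_zero P.neg_t_sq_ne_one]
  | succ i ih =>
    rw [pow_succ' (d P) (i + 1), mul_assoc, Rf_d_mul, ih, RkInv_d_pow_mul,
      qInt_succ P.neg_t_ne_zero P.neg_t_sq_ne_one (i + 1), mul_add, mul_smul_comm, mul_smul_comm,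
      mul_mul_of_mul_eq_smul db_rel, ← mul_assoc (d P) (d P ^ i), ← pow_succ',
      ← mul_assoc (d P), inv_neg]
    match_scalars <;> ring

/-! ### The kernel of `R_e` -/

variable (P) in
/-- The span of the monomials `c^i d^j σ^s` with `i + j = n`. -/
def cdSpan (p : ℕ × Fin 2) : Submodule ℂ (Cq P) :=
  Submodule.span ℂ {u | ∃ i j : ℕ, i + j = p.1 ∧ u = c P ^ i * (d P ^ j * σ P ^ (p.2 : ℕ))}

/-- The Leibniz rule for `Re` has no inhomogeneous term at `c`, `d`, `σ`, so the vanishing at `1`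
propagates. -/
theorem Re_cdSpan (p : ℕ × Fin 2) : cdSpan P p ≤ LinearMap.ker (Re P) := by
  refine Submodule.span_le.2 ?_
  rintro _ ⟨i, j, -, rfl⟩
  have hd : ∀ j : ℕ, Re P (d P ^ j * σ P ^ (p.2 : ℕ)) = 0 := by
    intro j
    induction j with
    | zero => rw [pow_zero, one_mul, Re_σ_pow]
    | succ j ih => rw [pow_succ', mul_assoc, Re_gen_mul, ih]; simp
  rw [SetLike.mem_coe, LinearMap.mem_ker]
  induction i with
  | zero => rw [pow_zero, one_mul, hd]
  | succ i ih => rw [pow_succ', mul_assoc, Re_gen_mul, ih]; simp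

variable (P) in
/-- The eigenvalue of `R_k` on the monomials `c^i d^j σ^s` with `i + j = n`. -/
def weight (p : ℕ × Fin 2) : ℂ := (-P.t⁻¹) ^ p.1 * (-1) ^ (p.2 : ℕ)

theorem weight_ne_zero (p : ℕ × Fin 2) : weight P p ≠ 0 :=
  mul_ne_zero (pow_ne_zero _ (neg_ne_zero.2 (inv_ne_zero P.t_ne_zero)))
    (pow_ne_zero _ (neg_ne_zero.2 one_ne_zero))

theorem Rk_cdSpan {p : ℕ × Fin 2} {x : Cq P} (hx : x ∈ cdSpan P p) :
    Rk P x = weight P p • x := by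
  suffices h : cdSpan P p ≤ LinearMap.eqLocus (Rk P) (weight P p • LinearMap.id) from h hx
  refine Submodule.span_le.2 ?_
  rintro _ ⟨i, j, hij, rfl⟩
  simp only [SetLike.mem_coe, LinearMap.mem_eqLocus, LinearMap.smul_apply, LinearMap.id_apply]
  rw [Rk_gen_pow_mul, Rk_gen_pow_mul, Rk_σ_pow, weight, ← hij, mul_smul_comm, mul_smul_comm,
    mul_smul_comm, smul_smul, smul_smul, pow_add, mul_assoc]

theorem t_pow_injective : Function.Injective fun n : ℕ => P.t ^ (2 * n) := by
  have key : ∀ m n : ℕ, m < n → P.t ^ (2 * m) ≠ P.t ^ (2 * n) := by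
    intro m n hmn h
    apply P.t_pow_ne_one (n - m) (by omega)
    apply mul_left_cancel₀ (pow_ne_zero (2 * m) P.t_ne_zero)
    rw [← pow_add, mul_one, h]
    congr 1
    omega
  intro m n h
  rcases lt_trichotomy m n with hmn | hmn | hmn
  · exact absurd h (key m n hmn)
  · exact hmn
  · exact absurd h.symm (key n m hmn)

/-- Squaring removes all signs and determines `n`, since `t²` is not a root of unity; the remaining
sign determines `s`. -/
theorem weight_injective : Function.Injective (weight P) := by
  rintro ⟨m, s⟩ ⟨n, s'⟩ h
  have ht := P.t_ne_zero
  have hsq : ∀ r : Fin 2, ((-1 : ℂ) ^ (r : ℕ)) ^ 2 = 1 := fun r => by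
    rw [← pow_mul, mul_comm, pow_mul]; simp
  have h2 := congrArg (fun z => (z ^ 2)⁻¹) h
  simp only [weight, mul_pow, hsq, mul_one, ← pow_mul, mul_comm _ 2] at h2
  rw [Even.neg_pow (even_two_mul m), Even.neg_pow (even_two_mul n), inv_pow, inv_pow, inv_inv,
    inv_inv] at h2
  obtain rfl := t_pow_injective h2
  have h3 := mul_left_cancel₀ (pow_ne_zero _ (neg_ne_zero.2 (inv_ne_zero ht))) h
  fin_cases s <;> fin_cases s' <;> first | rfl | (exfalso; norm_num at h3)

/-- The spaces lie in eigenspaces of `Rk` with distinct eigenvalues. Independence of the individual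
monomials is neither known nor used. -/
theorem cdSpan_iSupIndep : iSupIndep (cdSpan P) := by
  refine iSupIndep.mono (s := Module.End.eigenspace (Rk P) ∘ weight P)
    ((Module.End.eigenspaces_iSupIndep (Rk P)).comp weight_injective) ?_
  intro p x hx
  exact Module.End.mem_eigenspace_iff.2 (Rk_cdSpan hx)

theorem Rf_RkInv (u : Cq P) : Rf P (RkInv P u) = P.q • RkInv P (Rf P u) := by
  have h := Rk_Rf (RkInv P u)
  rw [Rk_RkInv] at h
  rw [← RkInv_Rk (Rf P (RkInv P u)), h, map_smul]

theorem RkInv_mem_ker_pow {m : ℕ} {x : Cq P} (hx : (Rf P ^ m) x = 0) :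
    (Rf P ^ m) (RkInv P x) = 0 := by
  have h : ∀ y, (Rf P ^ m) (RkInv P y) = P.q ^ m • RkInv P ((Rf P ^ m) y) := by
    clear hx
    induction m with
    | zero => simp
    | succ m ih =>
      intro y
      rw [pow_succ, Module.End.mul_apply, Rf_RkInv, map_smul, ih, smul_smul, ← pow_succ',
        Module.End.mul_apply]
  rw [h, hx, map_zero, smul_zero]

/-- `Rf` commutes with left multiplication by `a` and anticommutes with that by `b`, so neither
raises the order of nilpotency of `Rf` on a vector. Multiplication by `c` or `d` raises it by at
most one, which bounds the lengths of the strings. -/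
theorem a_mul_mem_ker_pow (m : ℕ) : ∀ {x : Cq P}, (Rf P ^ m) x = 0 → (Rf P ^ m) (a P * x) = 0 := by
  induction m with
  | zero => intro x hx; simp at hx; simp [hx]
  | succ m ih =>
    intro x hx
    rw [pow_succ, Module.End.mul_apply] at hx ⊢
    rw [Rf_gen_mul]
    exact ih hx

theorem b_mul_mem_ker_pow (m : ℕ) : ∀ {x : Cq P}, (Rf P ^ m) x = 0 → (Rf P ^ m) (b P * x) = 0 := by
  induction m with
  | zero => intro x hx; simp at hx; simp [hx]
  | succ m ih =>
    intro x hx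
    rw [pow_succ, Module.End.mul_apply] at hx ⊢
    rw [Rf_gen_mul, map_neg, ih hx, neg_zero]

theorem c_mul_mem_ker_pow (m : ℕ) :
    ∀ {x : Cq P}, (Rf P ^ m) x = 0 → (Rf P ^ (m + 1)) (c P * x) = 0 := by
  induction m with
  | zero => intro x hx; simp at hx; simp [hx]
  | succ m ih =>
    intro x hx
    rw [pow_succ, Module.End.mul_apply, Rf_gen_mul, map_sub,
      a_mul_mem_ker_pow _ (RkInv_mem_ker_pow hx), zero_sub, neg_eq_zero]
    rw [pow_succ, Module.End.mul_apply] at hx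
    exact ih hx

theorem d_mul_mem_ker_pow (m : ℕ) :
    ∀ {x : Cq P}, (Rf P ^ m) x = 0 → (Rf P ^ (m + 1)) (d P * x) = 0 := by
  induction m with
  | zero => intro x hx; simp at hx; simp [hx]
  | succ m ih =>
    intro x hx
    rw [pow_succ, Module.End.mul_apply, Rf_gen_mul, map_add,
      b_mul_mem_ker_pow _ (RkInv_mem_ker_pow hx), zero_add]
    rw [pow_succ, Module.End.mul_apply] at hx
    exact ih hx

theorem Rf_pow_cdSpan {p : ℕ × Fin 2} {x : Cq P} (hx : x ∈ cdSpan P p) :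
    (Rf P ^ (p.1 + 1)) x = 0 := by
  suffices h : cdSpan P p ≤ LinearMap.ker (Rf P ^ (p.1 + 1)) from h hx
  refine Submodule.span_le.2 ?_
  rintro _ ⟨i, j, hij, rfl⟩
  rw [SetLike.mem_coe, LinearMap.mem_ker, ← hij]
  clear hij
  induction i with
  | zero =>
    rw [pow_zero, one_mul, zero_add]
    induction j with
    | zero => rw [pow_zero, one_mul, zero_add, pow_one, Rf_σ_pow]
    | succ j ih => rw [pow_succ' (d P), mul_assoc]; exact d_mul_mem_ker_pow _ ih
  | succ i ih =>
    rw [pow_succ' (c P), mul_assoc, show i + 1 + j + 1 = (i + j + 1) + 1 by omega]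
    exact c_mul_mem_ker_pow _ ih

theorem Rk_Rf_pow {p : ℕ × Fin 2} {x : Cq P} (hx : x ∈ cdSpan P p) (m : ℕ) :
    Rk P ((Rf P ^ m) x) = (P.q ^ m * weight P p) • (Rf P ^ m) x := by
  induction m with
  | zero => simp [Rk_cdSpan hx]
  | succ m ih =>
    rw [pow_succ', Module.End.mul_apply, Rk_Rf, ih, map_smul, smul_smul, pow_succ']
    congr 1
    ring

theorem RkInv_Rf_pow {p : ℕ × Fin 2} {x : Cq P} (hx : x ∈ cdSpan P p) (m : ℕ) :
    RkInv P ((Rf P ^ m) x) = (P.q ^ m * weight P p)⁻¹ • (Rf P ^ m) x := by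
  have h0 : P.q ^ m * weight P p ≠ 0 :=
    mul_ne_zero (pow_ne_zero _ P.q_ne_zero) (weight_ne_zero p)
  rw [eq_inv_smul_iff₀ h0, ← map_smul, ← Rk_Rf_pow hx, RkInv_Rk]

variable (P) in
/-- The factor by which `R_e` moves down the strings generated by `R_f`. -/
def stringFactor (p : ℕ × Fin 2) (m : ℕ) : ℂ :=
  (-1) ^ m * (-1) ^ (p.2 : ℕ) * (P.q - P.q⁻¹)⁻¹ * ((P.t ^ (2 * (m + 1)) - 1) / (P.t ^ 2 - 1)) *
    (((-P.t) ^ p.1)⁻¹ - (-P.t) ^ p.1 * (P.t ^ (2 * m))⁻¹)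

/-- Only the last factor of the product can vanish, and it does so only if `t^(2m) = t^(2n)`, that
is, at `m = n`, where the string ends. -/
theorem stringFactor_ne_zero {p : ℕ × Fin 2} {m : ℕ} (hm : m < p.1) : stringFactor P p m ≠ 0 := by
  have h1 : (-1 : ℂ) ≠ 0 := neg_ne_zero.2 one_ne_zero
  have ht := P.t_ne_zero
  refine mul_ne_zero (mul_ne_zero (mul_ne_zero (mul_ne_zero (pow_ne_zero _ h1)
    (pow_ne_zero _ h1)) (inv_ne_zero P.q_sub_inv_ne_zero)) (div_ne_zero
    (sub_ne_zero.2 (P.t_pow_ne_one _ (Nat.succ_pos m))) (sub_ne_zero.2 P.t_sq_ne_one))) ?_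
  intro h
  have hz : (-P.t) ^ p.1 ≠ 0 := pow_ne_zero _ P.neg_t_ne_zero
  have hY : P.t ^ (2 * m) ≠ 0 := pow_ne_zero _ ht
  have h2 : P.t ^ (2 * m) = P.t ^ (2 * p.1) := by
    rw [sub_eq_zero, inv_eq_iff_eq_inv, mul_inv, inv_inv, eq_inv_mul_iff_mul_eq₀ hz,
      ← pow_add, ← two_mul, Even.neg_pow (even_two_mul p.1)] at h
    exact h.symm
  exact hm.ne (t_pow_injective h2)

/-- The anticommutation relation expresses each factor as the contribution of `Rk - RkInv` at the
current weight minus the previous factor; `stringFactor` is the closed form of the resulting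
alternating sum. -/
theorem Re_Rf_pow {p : ℕ × Fin 2} {x : Cq P} (hx : x ∈ cdSpan P p) (m : ℕ) :
    Re P ((Rf P ^ (m + 1)) x) = stringFactor P p m • (Rf P ^ m) x := by
  have ht := P.t_ne_zero
  have ht2 : P.t ^ 2 - 1 ≠ 0 := sub_ne_zero.2 P.t_sq_ne_one
  have hs : ((-1 : ℂ) ^ (p.2 : ℕ)) ^ 2 = 1 := by
    rw [← pow_mul, mul_comm, pow_mul]; simp
  have hs' : ((-1 : ℂ) ^ (p.2 : ℕ))⁻¹ = (-1 : ℂ) ^ (p.2 : ℕ) := by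
    rw [← inv_pow]; norm_num
  have hw : weight P p = ((-P.t) ^ p.1)⁻¹ * (-1) ^ (p.2 : ℕ) := by
    rw [weight, ← inv_neg, inv_pow]
  have hm' : ∀ m : ℕ, ((-1 : ℂ) ^ m)⁻¹ = (-1) ^ m := fun m => by rw [← inv_pow]; norm_num
  have hq : ∀ m, P.q ^ m = (-1) ^ m * P.t ^ (2 * m) := fun m => by
    rw [P.q_eq, neg_pow, ← pow_mul]
  rw [pow_succ', Module.End.mul_apply, Re_Rf, Rk_Rf_pow hx, RkInv_Rf_pow hx, ← sub_smul, smul_smul]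
  have hz : (-P.t) ^ p.1 ≠ 0 := pow_ne_zero _ P.neg_t_ne_zero
  induction m with
  | zero =>
    rw [pow_zero, pow_zero, Module.End.one_apply, Re_cdSpan p hx, map_zero, sub_zero, stringFactor]
    congr 1
    rw [hw, mul_inv, mul_inv, hs', inv_inv]
    simp only [mul_zero, pow_zero, zero_add, mul_one, one_mul, inv_one]
    rw [div_self ht2]
    ring
  | succ m ih =>
    have h1 : Re P ((Rf P ^ (m + 1)) x) = stringFactor P p m • (Rf P ^ m) x := by
      rw [← ih, pow_succ', Module.End.mul_apply, Re_Rf, Rk_Rf_pow hx, RkInv_Rf_pow hx, ← sub_smul,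
        smul_smul]
    rw [h1, map_smul, ← Module.End.mul_apply, ← pow_succ', ← sub_smul]
    congr 1
    rw [stringFactor, stringFactor, hq, hw, mul_inv, mul_inv, mul_inv, hs', inv_inv, hm']
    have hY : P.t ^ (2 * m) ≠ 0 := pow_ne_zero _ ht
    simp only [mul_add, pow_add, mul_one]
    generalize (-P.t) ^ p.1 = z at *
    generalize P.t ^ (2 * m) = Y at *
    generalize (P.q - P.q⁻¹)⁻¹ = κ
    field_simp
    ring

variable (P) in
/-- The span of all vectors `R_f^m x` with `x` a monomial `c^i d^j σ^s`. -/
def allStrings : Submodule ℂ (Cq P) := ⨆ M, stringSpan (Rf P) (cdSpan P) M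

theorem Rf_pow_mem_allStrings {p : ℕ × Fin 2} {x : Cq P} (hx : x ∈ cdSpan P p) (m : ℕ) :
    (Rf P ^ m) x ∈ allStrings P :=
  Submodule.mem_iSup_of_mem m (pow_mem_stringSpan le_rfl hx)

theorem allStrings_le {W : Submodule ℂ (Cq P)}
    (h : ∀ p, ∀ x ∈ cdSpan P p, ∀ m, (Rf P ^ m) x ∈ W) : allStrings P ≤ W :=
  iSup_le fun _ => stringSpan_le fun p x hx m _ => h p x hx m

theorem Rf_mem_allStrings {u : Cq P} (hu : u ∈ allStrings P) : Rf P u ∈ allStrings P := by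
  suffices h : allStrings P ≤ (allStrings P).comap (Rf P) from h hu
  refine allStrings_le fun p x hx m => ?_
  rw [Submodule.mem_comap, ← Module.End.mul_apply, ← pow_succ']
  exact Rf_pow_mem_allStrings hx _

theorem monomial_mem_cdSpan (i j : ℕ) (s : Fin 2) :
    c P ^ i * (d P ^ j * σ P ^ (s : ℕ)) ∈ cdSpan P (i + j, s) :=
  Submodule.subset_span ⟨i, j, rfl, rfl⟩

theorem monomial_mem_allStrings (i j : ℕ) (s : Fin 2) :
    c P ^ i * (d P ^ j * σ P ^ (s : ℕ)) ∈ allStrings P := by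
  simpa using Rf_pow_mem_allStrings (monomial_mem_cdSpan (P := P) i j s) 0

theorem σ_pow_mod_two (s : Fin 2) : ∃ s' : Fin 2, σ P * σ P ^ (s : ℕ) = σ P ^ (s' : ℕ) := by
  fin_cases s
  · exact ⟨1, by simp⟩
  · exact ⟨0, by simp [σ_sq_rel]⟩

theorem monomial_σ_mem_allStrings (i j : ℕ) (s : Fin 2) :
    c P ^ i * (σ P * (d P ^ j * σ P ^ (s : ℕ))) ∈ allStrings P := by
  obtain ⟨s', hs'⟩ := σ_pow_mod_two (P := P) s
  rw [σ_mul, map_mul, map_pow, map_pow, parity_d, parity_σ, mul_assoc, ← pow_succ, pow_succ', hs']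
  exact monomial_mem_allStrings i j s'

theorem Rf_monomial (i j s : ℕ) : Rf P (c P ^ (i + 1) * (d P ^ (j + 1) * σ P ^ s)) =
    (-1 : ℂ) ^ s • ((qInt (-P.t) (i + 1) * (-P.t) ^ (j + 1)) •
        (a P * (c P ^ i * (d P ^ (j + 1) * σ P ^ s))) +
      ((-1 : ℂ) ^ (i + 1) * qInt (-P.t) (j + 1)) •
        (c P ^ (i + 1) * (b P * (d P ^ j * σ P ^ s)))) := by
  rw [Rf_c_pow_mul, RkInv_d_pow_mul, Rf_d_pow_mul, RkInv_σ_pow, Rf_σ_pow]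
  simp only [mul_smul_comm, smul_smul, mul_zero, add_zero, smul_add]
  match_scalars <;> ring

/-- Move `a` past the powers of `c` and expand `ad = σ + t cb`. -/
theorem a_mul_monomial (i j s : ℕ) : a P * (c P ^ i * (d P ^ (j + 1) * σ P ^ s)) =
    P.t ^ i • (c P ^ i * (σ P * (d P ^ j * σ P ^ s))) +
      P.t ^ (i + 1) • (c P ^ (i + 1) * (b P * (d P ^ j * σ P ^ s))) := by
  rw [mul_mul_of_mul_eq_smul (mul_pow_of_mul_eq_smul (ac_rel P) i), pow_succ' (d P), mul_assoc (d P),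
    ← mul_assoc (a P) (d P), ad_rel', add_mul, mul_add, smul_add, smul_mul_assoc, mul_smul_comm,
    smul_smul, mul_assoc (c P) (b P), ← mul_assoc (c P ^ i) (c P), ← pow_succ, ← pow_succ]

/-- `Rf` of `c^(i+1) d^(j+1) σ^s` combines `a c^i d^(j+1) σ^s` with the element in question. By
`a_mul_monomial` the former equals a multiple of the latter plus an element of the span, so only the
total coefficient has to be nonzero. -/
theorem cb_monomial_mem_allStrings (i j : ℕ) (s : Fin 2) :
    c P ^ (i + 1) * (b P * (d P ^ j * σ P ^ (s : ℕ))) ∈ allStrings P := by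
  have ht := P.t_ne_zero
  have h := Rf_mem_allStrings (monomial_mem_allStrings (P := P) (i + 1) (j + 1) s)
  have h1 : (-1 : ℂ) ^ (s : ℕ) ≠ 0 := pow_ne_zero _ (neg_ne_zero.2 one_ne_zero)
  rw [Rf_monomial, Submodule.smul_mem_iff _ h1, a_mul_monomial, smul_add, add_assoc,
    Submodule.add_mem_iff_right _ ((allStrings P).smul_mem _
      ((allStrings P).smul_mem _ (monomial_σ_mem_allStrings i j s))), smul_smul, ← add_smul,
    Submodule.smul_mem_iff] at h
  · exact h
  · have hu := P.neg_t_ne_zero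
    have hd := sub_inv_ne_zero hu P.neg_t_sq_ne_one
    -- After clearing denominators, vanishing of the coefficient amounts to `(-t)^(2(i+j+2)) = 1`.
    intro h0
    have e1 : P.t ^ (i + 1) = (-1) ^ (i + 1) * (-P.t) ^ (i + 1) := by
      rw [← mul_pow]; simp
    rw [e1, qInt, qInt] at h0
    have hs : (-1 : ℂ) ^ (i + 1) ≠ 0 := pow_ne_zero _ (neg_ne_zero.2 one_ne_zero)
    have h2 : ((-P.t) ^ (i + 1) - (-P.t)⁻¹ ^ (i + 1)) * (-P.t) ^ (j + 1) * (-P.t) ^ (i + 1) +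
        ((-P.t) ^ (j + 1) - (-P.t)⁻¹ ^ (j + 1)) = 0 := by
      have h3 : (-1 : ℂ) ^ (i + 1) * (-P.t - (-P.t)⁻¹)⁻¹ *
        (((-P.t) ^ (i + 1) - (-P.t)⁻¹ ^ (i + 1)) * (-P.t) ^ (j + 1) * (-P.t) ^ (i + 1) +
        ((-P.t) ^ (j + 1) - (-P.t)⁻¹ ^ (j + 1))) = 0 := by
        rw [← h0]; ring
      exact (mul_eq_zero.1 h3).resolve_left (mul_ne_zero hs (inv_ne_zero hd))
    apply P.neg_t_pow_ne_one (i + j + 2) (by omega)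
    have hi : (-P.t)⁻¹ ^ (i + 1) * (-P.t) ^ (i + 1) = 1 := by
      rw [← mul_pow, inv_mul_cancel₀ hu, one_pow]
    have hj : (-P.t)⁻¹ ^ (j + 1) * (-P.t) ^ (j + 1) = 1 := by
      rw [← mul_pow, inv_mul_cancel₀ hu, one_pow]
    linear_combination (-P.t) ^ (j + 1) * h2 + (-P.t) ^ (j + 1) * (-P.t) ^ (j + 1) * hi + hj

/-- Without a factor `d`, the element is up to a nonzero scalar `Rf` of `c^(i+1) σ^s`; otherwise `a`
is absorbed by a `d`. -/
theorem a_monomial_mem_allStrings (i j : ℕ) (s : Fin 2) :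
    a P * (c P ^ i * (d P ^ j * σ P ^ (s : ℕ))) ∈ allStrings P := by
  cases j with
  | zero =>
    have h := Rf_mem_allStrings (monomial_mem_allStrings (P := P) (i + 1) 0 s)
    have h1 : (-1 : ℂ) ^ (s : ℕ) ≠ 0 := pow_ne_zero _ (neg_ne_zero.2 one_ne_zero)
    rw [pow_zero, one_mul, Rf_c_pow_mul, Rf_σ_pow, RkInv_σ_pow, mul_zero, smul_zero, add_zero,
      mul_smul_comm, mul_smul_comm, smul_smul, Submodule.smul_mem_iff] at h
    · rwa [pow_zero, one_mul]
    · exact mul_ne_zero (qInt_ne_zero P.neg_t_ne_zero P.neg_t_sq_ne_one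
        (P.neg_t_pow_ne_one _ (Nat.succ_pos i))) h1
  | succ j =>
    rw [a_mul_monomial]
    exact add_mem (Submodule.smul_mem _ _ (monomial_σ_mem_allStrings i j s))
      (Submodule.smul_mem _ _ (cb_monomial_mem_allStrings i j s))

theorem b_monomial_mem_allStrings (i j : ℕ) (s : Fin 2) :
    b P * (c P ^ i * (d P ^ j * σ P ^ (s : ℕ))) ∈ allStrings P := by
  cases i with
  | zero =>
    have h := Rf_mem_allStrings (monomial_mem_allStrings (P := P) 0 (j + 1) s)
    have h1 : (-1 : ℂ) ^ (s : ℕ) ≠ 0 := pow_ne_zero _ (neg_ne_zero.2 one_ne_zero)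
    rw [pow_zero, one_mul, Rf_d_pow_mul, Rf_σ_pow, RkInv_σ_pow, mul_zero, add_zero,
      mul_smul_comm, mul_smul_comm, smul_smul, Submodule.smul_mem_iff] at h
    · rwa [pow_zero, one_mul]
    · exact mul_ne_zero (qInt_ne_zero P.neg_t_ne_zero P.neg_t_sq_ne_one
        (P.neg_t_pow_ne_one _ (Nat.succ_pos j))) h1
  | succ i =>
    rw [mul_mul_of_mul_eq_smul (mul_pow_of_mul_eq_smul bc_rel' (i + 1))]
    exact Submodule.smul_mem _ _ (cb_monomial_mem_allStrings i j s)

theorem gen_monomial_mem_allStrings (g : CGen) (i j : ℕ) (s : Fin 2) :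
    gen P g * (c P ^ i * (d P ^ j * σ P ^ (s : ℕ))) ∈ allStrings P := by
  cases g with
  | a => exact a_monomial_mem_allStrings i j s
  | b => exact b_monomial_mem_allStrings i j s
  | c =>
    rw [← mul_assoc, ← pow_succ']
    exact monomial_mem_allStrings (i + 1) j s
  | d =>
    rw [mul_mul_of_mul_eq_smul (mul_pow_of_mul_eq_smul dc_rel i), ← mul_assoc (gen P .d),
      ← pow_succ']
    exact Submodule.smul_mem _ _ (monomial_mem_allStrings i (j + 1) s)
  | σ =>
    rw [mul_mul_of_mul_eq_smul (mul_pow_of_mul_eq_smul σc_rel i)]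
    exact Submodule.smul_mem _ _ (monomial_σ_mem_allStrings i j s)

/-- Apply `Rf` to `gen P g * Rf^m x`. The Leibniz rule gives the wanted element up to sign, plus
possibly a generator times `RkInv (Rf^m x)`. As `RkInv` is a scalar on `Rf^m x`, the extra term is
covered by the induction hypothesis for all generators at once. -/
theorem gen_mul_Rf_pow_mem {p : ℕ × Fin 2} {x : Cq P} (hx : x ∈ cdSpan P p) (m : ℕ) :
    ∀ g, gen P g * (Rf P ^ m) x ∈ allStrings P := by
  induction m with
  | zero =>
    intro g
    suffices h : cdSpan P p ≤ (allStrings P).comap (LinearMap.mulLeft ℂ (gen P g)) from h hx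
    refine Submodule.span_le.2 ?_
    rintro _ ⟨i, j, -, rfl⟩
    exact gen_monomial_mem_allStrings g i j p.2
  | succ m ih =>
    intro g
    have h1 := Rf_mem_allStrings (ih g)
    have h2 : ∀ g', gen P g' * RkInv P ((Rf P ^ m) x) ∈ allStrings P := by
      intro g'
      rw [RkInv_Rf_pow hx, mul_smul_comm]
      exact Submodule.smul_mem _ _ (ih g')
    rw [Rf_gen_mul] at h1
    rw [pow_succ', Module.End.mul_apply]
    cases g with
    | a => exact h1
    | b => exact neg_mem_iff.1 h1
    | c => exact (Submodule.sub_mem_iff_right _ (h2 .a)).1 h1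
    | d => exact (Submodule.add_mem_iff_right _ (h2 .b)).1 h1
    | σ => exact h1

theorem allStrings_eq_top : allStrings P = ⊤ := by
  refine (Submodule.eq_top_iff').2 fun u => ?_
  induction u using induction with
  | hone => simpa using monomial_mem_allStrings (P := P) 0 0 0
  | hsmul r x hx => exact Submodule.smul_mem _ _ hx
  | hgen g x hx =>
    suffices h : allStrings P ≤ (allStrings P).comap (LinearMap.mulLeft ℂ (gen P g)) from h hx
    exact allStrings_le fun p y hy m => gen_mul_Rf_pow_mem hy m g
  | hadd x y hx hy => exact add_mem hx hy

/-- The elements killed by `R_e` are the combinations of the monomials `c^i d^j σ^s`. -/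
theorem ker_Re : LinearMap.ker (Re P) = ⨆ p, cdSpan P p := by
  refine ker_eq_iSup_of_strings (Re P) (Rf P) (cdSpan P) cdSpan_iSupIndep Prod.fst
    (stringFactor P) (fun p x hx => Re_cdSpan p hx) (fun p x hx => Rf_pow_cdSpan hx)
    (fun p x hx m => Re_Rf_pow hx m) (fun p m hm => stringFactor_ne_zero hm) fun v => ?_
  have hv : v ∈ allStrings P := allStrings_eq_top ▸ Submodule.mem_top
  exact (Submodule.mem_iSup_of_directed _ stringSpan_mono.directed_le).1 hv

end Cq

/-! ### Gauss binomial coefficients -/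

/-- The Gauss binomial coefficients, defined by their recursion. -/
def qBinom (v : ℂ) : ℕ → ℕ → ℂ
  | _, 0 => 1
  | 0, _ + 1 => 0
  | n + 1, j + 1 => qBinom v n (j + 1) + v ^ (n - j) * qBinom v n j

theorem qBinom_zero_right (v : ℂ) (n : ℕ) : qBinom v n 0 = 1 := by cases n <;> rfl

theorem qBinom_eq_zero (v : ℂ) : ∀ n j : ℕ, n < j → qBinom v n j = 0
  | _, 0, h => absurd h (Nat.not_lt_zero _)
  | 0, _ + 1, _ => rfl
  | n + 1, j + 1, h => by
    rw [qBinom, qBinom_eq_zero v n (j + 1) (by omega), qBinom_eq_zero v n j (by omega)]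
    simp

theorem qPochhammer_succ (v : ℂ) (m : ℕ) :
    qPochhammer v v (m + 1) = qPochhammer v v m * (1 - v ^ (m + 1)) := by
  rw [qPochhammer, Finset.prod_range_succ, ← pow_succ']
  rfl

/-- The factorial formula, multiplied out so that it holds for every `v`. It serves to show that the
coefficients do not vanish. -/
theorem qBinom_mul (v : ℂ) : ∀ n j : ℕ, j ≤ n →
    qBinom v n j * (qPochhammer v v j * qPochhammer v v (n - j)) = qPochhammer v v n := by
  intro n
  induction n with
  | zero => intro j hj; obtain rfl : j = 0 := by omega
            simp [qBinom, qPochhammer]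
  | succ n ih =>
    intro j hj
    cases j with
    | zero => simp [qBinom, qPochhammer]
    | succ j =>
      rw [qBinom, qPochhammer_succ v n, Nat.add_sub_add_right]
      have h0 := ih j (by omega)
      rcases (Nat.lt_or_ge j n) with hjn | hjn
      · obtain ⟨m, rfl⟩ : ∃ m, n = j + 1 + m := ⟨n - (j + 1), by omega⟩
        have h1 := ih (j + 1) (by omega)
        rw [show j + 1 + m - (j + 1) = m by omega, qPochhammer_succ v j] at h1
        rw [show j + 1 + m - j = m + 1 by omega, qPochhammer_succ v m] at h0 ⊢
        rw [qPochhammer_succ v j]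
        linear_combination (1 - v ^ (m + 1)) * h1 + v ^ (m + 1) * (1 - v ^ (j + 1)) * h0
      · obtain rfl : n = j := by omega
        rw [qBinom_eq_zero v n (n + 1) (by omega), qPochhammer_succ v n]
        rw [Nat.sub_self] at h0 ⊢
        linear_combination (1 - v ^ (n + 1)) * h0

theorem qBinom_ne_zero (P : Params) {n j : ℕ} (hj : j ≤ n) :
    qBinom (P.t ^ (-2 : ℤ)) n j ≠ 0 := by
  intro h
  have := qBinom_mul (P.t ^ (-2 : ℤ)) n j hj
  rw [h, zero_mul] at this
  exact Cq.qPochhammer_ne_zero P n this.symm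

namespace Cq

variable {P : Params}

/-! ### Powers of `a` and `c` under the comultiplication -/

/-- The q-binomial theorem for a power of `Δ(g) = g ⊗ a + y ⊗ c`. The sign `ε` is the effect of
moving the odd leg `c` past one factor `y`, whence the exponent `j.choose 2`: it is `-1` for `y = b`
and `1` for `y = d`. -/
theorem comulLin_gen_pow (g : CGen) (y : Cq P) (ε v : ℂ)
    (hop : ∀ m j, comulOp P g ((gen P g ^ m * y ^ j) ⊗ₜ (a P ^ m * c P ^ j)) =
      (gen P g ^ (m + 1) * y ^ j) ⊗ₜ (a P ^ (m + 1) * c P ^ j) +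
        (ε ^ j * v ^ m) • ((gen P g ^ m * y ^ (j + 1)) ⊗ₜ (a P ^ m * c P ^ (j + 1)))) (n : ℕ) :
    comulLin P (gen P g ^ n) = ∑ j ∈ Finset.range (n + 1), (ε ^ (j.choose 2) * qBinom v n j) •
      ((gen P g ^ (n - j) * y ^ j) ⊗ₜ[ℂ] (a P ^ (n - j) * c P ^ j)) := by
  induction n with
  | zero => simp [comulLin_one, qBinom]
  | succ n ih =>
    rw [pow_succ', comulLin_gen_mul, ih, map_sum]
    have h1 : ∀ j ∈ Finset.range (n + 1), comulOp P g ((ε ^ (j.choose 2) * qBinom v n j) •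
        ((gen P g ^ (n - j) * y ^ j) ⊗ₜ[ℂ] (a P ^ (n - j) * c P ^ j))) =
        (ε ^ (j.choose 2) * qBinom v n j) •
          ((gen P g ^ (n + 1 - j) * y ^ j) ⊗ₜ[ℂ] (a P ^ (n + 1 - j) * c P ^ j)) +
        (ε ^ ((j + 1).choose 2) * (v ^ (n - j) * qBinom v n j)) •
          ((gen P g ^ (n + 1 - (j + 1)) * y ^ (j + 1)) ⊗ₜ[ℂ]
            (a P ^ (n + 1 - (j + 1)) * c P ^ (j + 1))) := by
      intro j hj
      rw [Finset.mem_range] at hj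
      rw [map_smul, hop, smul_add, smul_smul, Nat.add_sub_add_right,
        show n + 1 - j = n - j + 1 by omega, Nat.choose_succ_succ' j 1, Nat.choose_one_right,
        pow_add ε]
      congr 2
      ring
    rw [Finset.sum_congr rfl h1, Finset.sum_add_distrib, Finset.sum_range_succ' _ (n + 1)]
    have h2 : ∑ j ∈ Finset.range (n + 1), (ε ^ (j.choose 2) * qBinom v n j) •
          ((gen P g ^ (n + 1 - j) * y ^ j) ⊗ₜ[ℂ] (a P ^ (n + 1 - j) * c P ^ j)) =
        ∑ j ∈ Finset.range (n + 2), (ε ^ (j.choose 2) * qBinom v n j) •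
          ((gen P g ^ (n + 1 - j) * y ^ j) ⊗ₜ[ℂ] (a P ^ (n + 1 - j) * c P ^ j)) := by
      rw [Finset.sum_range_succ _ (n + 1), qBinom_eq_zero v n (n + 1) (by omega)]
      simp
    rw [h2, Finset.sum_range_succ' _ (n + 1), add_right_comm, ← Finset.sum_add_distrib,
      qBinom_zero_right, qBinom_zero_right]
    congr 1
    refine Finset.sum_congr rfl fun j _ => ?_
    rw [← add_smul, ← mul_add, qBinom]

theorem zpow_neg_two_pow (m : ℕ) : (P.t ^ (-2 : ℤ)) ^ m = P.t⁻¹ ^ m * P.t⁻¹ ^ m := by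
  have h : P.t ^ (-2 : ℤ) = P.t⁻¹ * P.t⁻¹ := by
    rw [zpow_neg, ← mul_inv, ← pow_two]
    rfl
  rw [h, mul_pow]

theorem comulLin_c_pow (n : ℕ) : comulLin P (c P ^ n) = ∑ j ∈ Finset.range (n + 1),
    (1 ^ (j.choose 2) * qBinom (P.t ^ (-2 : ℤ)) n j) •
      ((c P ^ (n - j) * d P ^ j) ⊗ₜ[ℂ] (a P ^ (n - j) * c P ^ j)) := by
  refine comulLin_gen_pow .c (d P) 1 _ (fun m j => ?_) n
  simp only [comulOp, LinearMap.add_apply, TensorProduct.map_tmul, LinearMap.mulLeft_apply,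
    LinearMap.comp_apply, AlgHom.toLinearMap_apply, map_mul, map_pow, parity_c, parity_d]
  rw [← neg_one_smul ℂ (c P), smul_pow, smul_mul_assoc, mul_smul_comm,
    mul_mul_of_mul_eq_smul (mul_pow_of_mul_eq_smul dc_rel m),
    mul_mul_of_mul_eq_smul (mul_pow_of_mul_eq_smul (ca_rel P) m), ← mul_assoc (c P),
    ← mul_assoc (a P), ← pow_succ', ← pow_succ',
    ← pow_succ', ← pow_succ',
    TensorProduct.tmul_smul, ← TensorProduct.smul_tmul', ← TensorProduct.smul_tmul', smul_smul,
    smul_smul, zpow_neg_two_pow]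
  congr 2
  rw [neg_pow P.t⁻¹ m]
  have h : (-1 : ℂ) ^ m * (-1) ^ m = 1 := by rw [← mul_pow]; simp
  linear_combination (P.t⁻¹ ^ m * P.t⁻¹ ^ m) * h

theorem comulLin_a_pow (n : ℕ) : comulLin P (a P ^ n) = ∑ j ∈ Finset.range (n + 1),
    ((-1) ^ (j.choose 2) * qBinom (P.t ^ (-2 : ℤ)) n j) •
      ((a P ^ (n - j) * b P ^ j) ⊗ₜ[ℂ] (a P ^ (n - j) * c P ^ j)) := by
  refine comulLin_gen_pow .a (b P) (-1) _ (fun m j => ?_) n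
  simp only [comulOp, LinearMap.add_apply, TensorProduct.map_tmul, LinearMap.mulLeft_apply,
    LinearMap.comp_apply, AlgHom.toLinearMap_apply, map_mul, map_pow, parity_a, parity_b]
  rw [← neg_one_smul ℂ (b P), smul_pow, mul_smul_comm, mul_smul_comm,
    mul_mul_of_mul_eq_smul (mul_pow_of_mul_eq_smul ba_rel m),
    mul_mul_of_mul_eq_smul (mul_pow_of_mul_eq_smul (ca_rel P) m), ← mul_assoc (a P) (a P ^ m) (b P ^ j),
    ← mul_assoc (a P) (a P ^ m), ← pow_succ', ← pow_succ', ← pow_succ',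
    TensorProduct.tmul_smul, ← TensorProduct.smul_tmul', ← TensorProduct.smul_tmul', smul_smul,
    smul_smul, zpow_neg_two_pow]
  congr 2
  ring

/-! ### Comodules spanned by finite families -/

theorem Rf_a_pow_mul (m : ℕ) (u : Cq P) : Rf P (a P ^ m * u) = a P ^ m * Rf P u := by
  induction m with
  | zero => simp
  | succ m ih => rw [pow_succ', mul_assoc, Rf_gen_mul, ih, mul_assoc]

/-- Up to a nonzero scalar `Rf` trades a factor `c` for a factor `a`; after `r` steps only a power
of `a` is left, which the counit detects. -/
theorem a_pow_mul_c_pow_ne_zero (m r : ℕ) : a P ^ m * c P ^ r ≠ 0 := by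
  induction r generalizing m with
  | zero =>
    intro h
    have := congrArg (counitHom P) h
    simp [counitHom_gen] at this
  | succ r ih =>
    intro h
    apply ih (m + 1)
    have h2 := congrArg (Rf P) h
    rw [Rf_a_pow_mul, map_zero] at h2
    have h3 := Rf_c_pow_mul (P := P) r 1
    rw [mul_one, Rf_one, RkInv_one, mul_one, mul_zero, smul_zero, add_zero] at h3
    rw [h3, mul_smul_comm, smul_eq_zero] at h2
    rw [pow_succ, mul_assoc]
    exact h2.resolve_left (qInt_ne_zero P.neg_t_ne_zero P.neg_t_sq_ne_one
      (P.neg_t_pow_ne_one _ (Nat.succ_pos r)))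

theorem Rk_monomial (m r : ℕ) : Rk P (a P ^ m * c P ^ r) =
    (P.t ^ m * (-P.t⁻¹) ^ r) • (a P ^ m * c P ^ r) := by
  have h1 := Rk_gen_pow_mul (P := P) .a m (c P ^ r)
  have h2 := Rk_gen_pow_mul (P := P) .c r 1
  rw [Rk_one, mul_one] at h2
  rw [h1, h2, mul_smul_comm, smul_smul]

theorem linearIndependent_monomial (n : ℕ) : LinearIndependent ℂ
    fun r : Fin (n + 1) => a P ^ (n - (r : ℕ)) * c P ^ (r : ℕ) := by
  have ht := P.t_ne_zero
  refine Module.End.eigenvectors_linearIndependent' (Rk P)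
    (fun r : Fin (n + 1) => P.t ^ (n - (r : ℕ)) * (-P.t⁻¹) ^ (r : ℕ)) ?_ _ fun r =>
    Module.End.hasEigenvector_iff.2 ⟨Module.End.mem_eigenspace_iff.2 (Rk_monomial _ _),
      a_pow_mul_c_pow_ne_zero _ _⟩
  intro r s h
  -- Squaring and multiplying by `t^(2n)` clears the signs and negative powers from the eigenvalues
  -- of `Rk`, so `t_pow_injective` applies.
  have key : ∀ r : Fin (n + 1), (P.t ^ (n - (r : ℕ)) * (-P.t⁻¹) ^ (r : ℕ)) ^ 2 *
      (P.t ^ n) ^ 2 = P.t ^ (2 * (2 * (n - r))) := by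
    intro r
    have hr : (r : ℕ) ≤ n := Nat.lt_succ_iff.1 r.2
    have h1 : P.t ^ n = P.t ^ (n - (r : ℕ)) * P.t ^ (r : ℕ) := by rw [← pow_add]; congr 1; omega
    have h2 : (-P.t⁻¹) ^ (r : ℕ) * P.t ^ (r : ℕ) = (-1) ^ (r : ℕ) := by
      rw [← mul_pow]; simp [ht]
    have h3 : ((-1 : ℂ) ^ (r : ℕ)) ^ 2 = 1 := by
      rw [← pow_mul, mul_comm, pow_mul]; simp
    calc _ = ((P.t ^ (n - (r : ℕ))) * P.t ^ (n - (r : ℕ))) ^ 2 *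
          ((-P.t⁻¹) ^ (r : ℕ) * P.t ^ (r : ℕ)) ^ 2 := by rw [h1]; ring
      _ = _ := by rw [h2, h3, ← pow_add, ← pow_mul, mul_one]; congr 1; omega
  have h2 := congrArg (fun z => z ^ 2 * (P.t ^ n) ^ 2) h
  simp only [key] at h2
  have h3 := t_pow_injective h2
  have hr := r.2
  have hs := s.2
  exact Fin.ext (by omega)

theorem exists_dual_of_linearIndependent {V ι : Type*} [AddCommGroup V] [Module ℂ V]
    [DecidableEq ι] {η : ι → V} (hη : LinearIndependent ℂ η) (j : ι) :
    ∃ δ : V →ₗ[ℂ] ℂ, ∀ l, δ (η l) = if l = j then 1 else 0 := by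
  obtain ⟨L, hL⟩ := LinearMap.exists_extend ((Finsupp.lapply j).comp hη.repr)
  refine ⟨L, fun l => ?_⟩
  have h := LinearMap.congr_fun hL ⟨η l, Submodule.subset_span ⟨l, rfl⟩⟩
  rw [LinearMap.comp_apply, Submodule.subtype_apply] at h
  rw [h, LinearMap.comp_apply, Finsupp.lapply_apply]
  exact (congrArg (fun z => z j) (hη.repr_eq_single l ⟨η l, _⟩ rfl)).trans (Finsupp.single_apply)

theorem sum_tmul_injective {V W ι : Type*} [AddCommGroup V] [Module ℂ V] [AddCommGroup W]
    [Module ℂ W] [Fintype ι] {η : ι → V} (hη : LinearIndependent ℂ η) {w w' : ι → W}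
    (h : ∑ j, w j ⊗ₜ[ℂ] η j = ∑ j, w' j ⊗ₜ[ℂ] η j) : w = w' := by
  classical
  funext j
  obtain ⟨δ, hδ⟩ := exists_dual_of_linearIndependent hη j
  have h2 := congrArg (fun z => TensorProduct.rid ℂ W (δ.lTensor W z)) h
  simpa [hδ] using h2

variable (P) in
/-- A finite linearly independent family that spans a left subcomodule, with its matrix
elements. -/
structure IsComoduleBasis {ι : Type*} [Fintype ι] (η : ι → Cq P) (μ : ι → ι → Cq P) : Prop where
  linearIndependent : LinearIndependent ℂ η
  comul_eq_sum : ∀ i, comulLin P (η i) = ∑ j, μ i j ⊗ₜ[ℂ] η j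

theorem isComoduleBasis_ξ (n : ℕ) : IsComoduleBasis P (ξ P n) (matrixElement P n) where
  linearIndependent := by
    have h := (linearIndependent_monomial (P := P) n).units_smul
      (fun r => Units.mk0 (ξCoeff P n r) (ξCoeff_ne_zero P n r))
    exact h
  comul_eq_sum := comul_ξ P n

namespace IsComoduleBasis

variable {ι : Type*} [Fintype ι] {η : ι → Cq P} {μ : ι → ι → Cq P}

theorem eq_of_comul (h : IsComoduleBasis P η μ) {i : ι} {w : ι → Cq P}
    (hw : comulLin P (η i) = ∑ j, w j ⊗ₜ[ℂ] η j) : μ i = w :=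
  sum_tmul_injective h.linearIndependent ((h.comul_eq_sum i).symm.trans hw)

/-- Compare the coefficients of `η j` in the third factor of coassociativity at `η i`. -/
theorem comul_matrix (h : IsComoduleBasis P η μ) (i j : ι) :
    comulLin P (μ i j) = ∑ l, μ i l ⊗ₜ[ℂ] μ l j := by
  have h1 := Coalgebra.coassoc_apply (R := ℂ) (η i)
  rw [comul_eq, h.comul_eq_sum, map_sum, map_sum, map_sum] at h1
  have h2 := congrArg (TensorProduct.assoc ℂ (Cq P) (Cq P) (Cq P)).symm h1
  simp only [LinearMap.rTensor_tmul, LinearMap.lTensor_tmul, h.comul_eq_sum,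
    TensorProduct.tmul_sum, map_sum, LinearEquiv.symm_apply_apply, TensorProduct.assoc_symm_tmul]
    at h2
  rw [Finset.sum_comm] at h2
  simp only [← TensorProduct.sum_tmul] at h2
  exact congrFun (sum_tmul_injective h.linearIndependent h2) j

theorem rightOp_eq (h : IsComoduleBasis P η μ) (φ : Cq P →ₗ[ℂ] ℂ) (i : ι) :
    rightOp φ (η i) = ∑ j, φ (μ i j) • η j := by
  rw [rightOp_apply, h.comul_eq_sum, map_sum]
  simp only [contractLeft_tmul]

theorem rightOp_matrix (h : IsComoduleBasis P η μ) (φ : Cq P →ₗ[ℂ] ℂ) (i j : ι) :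
    rightOp φ (μ i j) = ∑ l, φ (μ i l) • μ l j := by
  rw [rightOp_apply, h.comul_matrix, map_sum]
  simp only [contractLeft_tmul]

/-- Values on matrix elements are read off from the operator on the basis, so explicit formulas for
the matrix elements are not required. -/
theorem apply_eq (h : IsComoduleBasis P η μ) {φ : Cq P →ₗ[ℂ] ℂ} {i : ι} {z : ι → ℂ}
    (hz : rightOp φ (η i) = ∑ j, z j • η j) (j : ι) : φ (μ i j) = z j := by
  rw [h.rightOp_eq, ← sub_eq_zero, ← Finset.sum_sub_distrib] at hz
  simp only [← sub_smul] at hz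
  exact sub_eq_zero.1 (Fintype.linearIndependent_iff.1 h.linearIndependent _ hz j)

end IsComoduleBasis

/-- The last basis vector is a multiple of `c^n`, so the row is read off from `comulLin_c_pow`. Only
the nonvanishing of the scalars matters for spans. The first row is treated in the same way with
`a^n`. -/
theorem matrixElement_last (n : ℕ) : ∃ κ : Fin (n + 1) → ℂ, (∀ j, κ j ≠ 0) ∧
    ∀ j, matrixElement P n (Fin.last n) j = κ j • (c P ^ (n - (j : ℕ)) * d P ^ (j : ℕ)) := by
  refine ⟨fun j => ξCoeff P n n * (1 ^ ((j : ℕ).choose 2) * qBinom (P.t ^ (-2 : ℤ)) n j) *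
    (ξCoeff P n j)⁻¹, fun j => ?_, fun j => ?_⟩
  · exact mul_ne_zero (mul_ne_zero (ξCoeff_ne_zero P n n) (mul_ne_zero (pow_ne_zero _ one_ne_zero)
      (qBinom_ne_zero P (Nat.lt_succ_iff.1 j.2)))) (inv_ne_zero (ξCoeff_ne_zero P n j))
  · refine congrFun ((isComoduleBasis_ξ (P := P) n).eq_of_comul (w := fun j : Fin (n + 1) =>
      (ξCoeff P n n * (1 ^ ((j : ℕ).choose 2) * qBinom (P.t ^ (-2 : ℤ)) n j) * (ξCoeff P n j)⁻¹) •
        (c P ^ (n - (j : ℕ)) * d P ^ (j : ℕ))) ?_) j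
    rw [ξ, Fin.val_last, Nat.sub_self, pow_zero, one_mul, map_smul, comulLin_c_pow,
      Finset.sum_range, Finset.smul_sum]
    refine Finset.sum_congr rfl fun j _ => ?_
    rw [ξ, TensorProduct.tmul_smul, ← TensorProduct.smul_tmul', smul_smul, smul_smul]
    congr 1
    rw [mul_comm (ξCoeff P n j), inv_mul_cancel_right₀ (ξCoeff_ne_zero P n j)]

theorem matrixElement_zero (n : ℕ) : ∃ κ : Fin (n + 1) → ℂ, (∀ j, κ j ≠ 0) ∧
    ∀ j, matrixElement P n 0 j = κ j • (a P ^ (n - (j : ℕ)) * b P ^ (j : ℕ)) := by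
  refine ⟨fun j => ξCoeff P n 0 * ((-1) ^ ((j : ℕ).choose 2) * qBinom (P.t ^ (-2 : ℤ)) n j) *
    (ξCoeff P n j)⁻¹, fun j => ?_, fun j => ?_⟩
  · exact mul_ne_zero (mul_ne_zero (ξCoeff_ne_zero P n 0) (mul_ne_zero (pow_ne_zero _ (by norm_num))
      (qBinom_ne_zero P (Nat.lt_succ_iff.1 j.2)))) (inv_ne_zero (ξCoeff_ne_zero P n j))
  · refine congrFun ((isComoduleBasis_ξ (P := P) n).eq_of_comul (w := fun j : Fin (n + 1) =>
      (ξCoeff P n 0 * ((-1) ^ ((j : ℕ).choose 2) * qBinom (P.t ^ (-2 : ℤ)) n j) * (ξCoeff P n j)⁻¹) •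
        (a P ^ (n - (j : ℕ)) * b P ^ (j : ℕ))) ?_) j
    rw [ξ, Fin.val_zero, Nat.sub_zero, pow_zero, mul_one, map_smul, comulLin_a_pow,
      Finset.sum_range, Finset.smul_sum]
    refine Finset.sum_congr rfl fun j _ => ?_
    rw [ξ, TensorProduct.tmul_smul, ← TensorProduct.smul_tmul', smul_smul, smul_smul]
    congr 1
    rw [mul_comm (ξCoeff P n j), inv_mul_cancel_right₀ (ξCoeff_ne_zero P n j)]

end Cq

/-! ### The actions of `e` and `f k`, and invariants as kernels -/

namespace Uq

variable {P : Params}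

theorem counit_gen (g : UGen) : counit P (gen P g) =
    (match g with | .k => 1 | .kInv => 1 | .e => 0 | .f => 0) := by
  cases g <;> rw [counit, lift_gen]

theorem parity_gen (g : UGen) : parity P (gen P g) =
    (match g with | .k => k P | .kInv => kInv P | .e => -e P | .f => -f P) := by
  cases g <;> rw [parity, lift_gen]

theorem pairing_gen (g : UGen) : pairing P (gen P g) =
    (match g with
      | .k => Cq.kDual P | .kInv => Cq.kInvDual P | .e => Cq.eDual P | .f => Cq.fDual P) := by
  cases g <;> rw [pairing, lift_gen]

theorem eval_k : eval (k P) = Cq.kFun P := by rw [eval, k, pairing_gen]; rfl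
theorem eval_e : eval (e P) = Cq.eFun P := by rw [eval, e, pairing_gen]; rfl
theorem eval_one : eval (1 : Uq P) = (Cq.counitHom P).toLinearMap := by
  rw [eval, map_one, ← Cq.toConv_counit]
theorem eval_f_mul_k : eval (f P * k P) =
    (WithConv.toConv (Cq.fFun P) * WithConv.toConv (Cq.kFun P) : Cq.Dual P).ofConv := by
  rw [eval, map_mul, f, k, pairing_gen, pairing_gen]; rfl

theorem rightAct_e : rightAct (e P) = Cq.Re P := by
  change Cq.rightOp (eval (e P)) = _
  rw [eval_e, Cq.Re]

theorem rightAct_f_mul_k : rightAct (f P * k P) = Cq.Rk P ∘ₗ Cq.Rf P := by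
  change Cq.rightOp (eval (f P * k P)) = _
  rw [eval_f_mul_k, Cq.rightOp_convMul, Cq.Rk, Cq.Rf]

theorem eval_add (x y : Uq P) : eval (x + y) = eval x + eval y := by
  simp [eval]

theorem eval_smul (r : ℂ) (x : Uq P) : eval (r • x) = r • eval x := by
  simp [eval]

theorem rightAct_smul (r : ℂ) (x : Uq P) : rightAct (r • x) = r • rightAct x := by
  change Cq.rightOp (eval (r • x)) = _
  rw [eval_smul, Cq.rightOp_smul]
  rfl

theorem rightInvariants_span_singleton {x : Uq P} (hx : counit P x = 0) :
    rightInvariants (ℂ ∙ x) = LinearMap.ker (rightAct x) := by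
  ext u
  simp only [rightInvariants, Submodule.mem_iInf, LinearMap.mem_eqLocus, LinearMap.mem_ker]
  constructor
  · intro h
    simpa [hx] using h x (Submodule.mem_span_singleton_self x)
  · intro h y hy
    obtain ⟨r, rfl⟩ := Submodule.mem_span_singleton.1 hy
    simp [hx, rightAct_smul, h]

theorem leftAct_smul (r : ℂ) (x : Uq P) : leftAct (r • x) = r • leftAct x := by
  simp only [leftAct, map_smul, eval_smul, TensorProduct.map_smul_right, ← smul_add,
    LinearMap.comp_smul, LinearMap.smul_comp]

theorem leftInvariants_span_singleton {x : Uq P} (hx : counit P x = 0) :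
    leftInvariants (ℂ ∙ x) = LinearMap.ker (leftAct x) := by
  ext u
  simp only [leftInvariants, Submodule.mem_iInf, LinearMap.mem_eqLocus, LinearMap.mem_ker]
  constructor
  · intro h
    simpa [hx] using h x (Submodule.mem_span_singleton_self x)
  · intro h y hy
    obtain ⟨r, rfl⟩ := Submodule.mem_span_singleton.1 hy
    simp [hx, leftAct_smul, h]

end Uq

namespace Cq

variable {P : Params}

theorem eVal_ne_zero : eVal P ≠ 0 :=
  div_ne_zero (sub_inv_ne_zero P.t_ne_zero P.t_sq_ne_one) P.q_sub_inv_ne_zero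

/-- The right invariants of `e`. -/
theorem rightInvariants_e : Uq.rightInvariants (ℂ ∙ Uq.e P) =
    Submodule.span ℂ {u | ∃ (n : ℕ) (j : Fin (n + 1)) (s : Fin 2),
      u = matrixElement P n (Fin.last n) j * σ P ^ (s : ℕ)} := by
  rw [Uq.rightInvariants_span_singleton (Uq.counit_gen .e), Uq.rightAct_e, ker_Re]
  apply le_antisymm
  · refine iSup_le fun p => Submodule.span_le.2 ?_
    rintro _ ⟨i, j, -, rfl⟩
    obtain ⟨κ, hκ, h⟩ := matrixElement_last (P := P) (i + j)
    have hj := h ⟨j, by omega⟩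
    simp only [Nat.add_sub_cancel] at hj
    rw [← mul_assoc, ← inv_smul_smul₀ (hκ ⟨j, by omega⟩) (c P ^ i * d P ^ j), ← hj, smul_mul_assoc]
    exact Submodule.smul_mem _ _ (Submodule.subset_span ⟨i + j, ⟨j, by omega⟩, p.2, rfl⟩)
  · refine Submodule.span_le.2 ?_
    rintro _ ⟨n, j, s, rfl⟩
    obtain ⟨κ, -, h⟩ := matrixElement_last (P := P) n
    rw [h, smul_mul_assoc, mul_assoc]
    exact Submodule.smul_mem _ _ (Submodule.mem_iSup_of_mem _ (monomial_mem_cdSpan _ _ s))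

/-! ### Exchanging `e` and `f k` -/

end Cq

variable (P : Params) in
/-- The parameters `q⁻¹`, `-t⁻¹`. -/
def Params.flip : Params where
  q := P.q⁻¹
  t := -P.t⁻¹
  q_ne_zero := inv_ne_zero P.q_ne_zero
  q_pow_ne_one n hn h := P.q_pow_ne_one n hn (by rwa [inv_pow, inv_eq_one] at h)
  t_sq := by rw [neg_sq, inv_pow, P.t_sq, inv_neg]

theorem Params.flip_t (P : Params) : P.flip.t = -P.t⁻¹ := rfl

namespace Cq

variable {P : Params}

/-- The isomorphism `a ↦ d, b ↦ c, c ↦ b, d ↦ a, σ ↦ σ` between the algebras with parameters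
`t' = -t⁻¹` and `t`. -/
def flipHom (P P' : Params) (h : P'.t = -P.t⁻¹) : Cq P' →ₐ[ℂ] Cq P :=
  lift (d P) (c P) (b P) (a P) (σ P)
    (by rw [h, dc_rel]) (by rw [h, db_rel]) (by rw [cb_rel, neg_one_smul])
    (by rw [h, ca_rel, neg_smul, neg_neg]) (by rw [h, ba_rel, neg_smul, neg_neg])
    (by rw [h, ← neg_sub (a P * d P), ad_da_rel, bc_rel', inv_neg, inv_inv]; module)
    (by rw [h, da_rel']; module) (σ_sq_rel P)

theorem flipHom_gen (P P' : Params) (h : P'.t = -P.t⁻¹) (g : CGen) : flipHom P P' h (gen P' g) =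
    (match g with | .a => d P | .b => c P | .c => b P | .d => a P | .σ => σ P) := by
  cases g <;> rw [flipHom, lift_gen]

theorem flipHom_flipHom (P P' : Params) (h : P'.t = -P.t⁻¹) (h' : P.t = -P'.t⁻¹) (x : Cq P') :
    flipHom P' P h' (flipHom P P' h x) = x := by
  suffices h : (flipHom P' P h').comp (flipHom P P' h) = AlgHom.id ℂ _ from DFunLike.congr_fun h x
  refine algHom_ext' fun g => ?_
  cases g <;> simp [flipHom_gen]

/-- Both sides obey the same recursion under left multiplication by generators. The factor `k` in `f
k` matters: `Rk` cancels the `RkInv` in the inhomogeneous terms of `Rf`. The scalar is fixed by the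
value at `a`, where the left side gives `t b`. -/
theorem Rk_Rf_flipHom (P P' : Params) (h : P'.t = -P.t⁻¹) (x : Cq P') :
    Rk P (Rf P (flipHom P P' h x)) = (P.t / eVal P') • flipHom P P' h (Re P' x) := by
  have ht := P.t_ne_zero
  have hE := eVal_ne_zero (P := P')
  suffices h : Rk P ∘ₗ Rf P ∘ₗ (flipHom P P' h).toLinearMap =
      (P.t / eVal P') • ((flipHom P P' h).toLinearMap ∘ₗ Re P') from LinearMap.congr_fun h x
  refine linear_ext (by simp [Rf_one, Re_one]) fun g x hx => ?_
  simp only [LinearMap.comp_apply, AlgHom.toLinearMap_apply, LinearMap.smul_apply] at hx ⊢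
  rw [Re_gen_mul, map_mul, flipHom_gen]
  cases g <;> simp [Rf_gen_mul, Rk_gen_mul, flipHom_gen, hx, h, Rk_RkInv, smul_smul] <;>
    match_scalars <;> field_simp

theorem ker_Rk_Rf (P P' : Params) (h : P'.t = -P.t⁻¹) (h' : P.t = -P'.t⁻¹) :
    LinearMap.ker (Rk P ∘ₗ Rf P) =
      (LinearMap.ker (Re P')).map (flipHom P P' h).toLinearMap := by
  have hκ : P.t / eVal P' ≠ 0 := div_ne_zero P.t_ne_zero eVal_ne_zero
  ext u
  constructor
  · intro hu
    refine ⟨flipHom P' P h' u, ?_, flipHom_flipHom P' P h' h u⟩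
    have h1 := Rk_Rf_flipHom P P' h (flipHom P' P h' u)
    rw [flipHom_flipHom, show Rk P (Rf P u) = 0 from hu, eq_comm, smul_eq_zero] at h1
    have h2 := congrArg (flipHom P' P h') (h1.resolve_left hκ)
    rwa [flipHom_flipHom, map_zero] at h2
  · rintro ⟨x, hx, rfl⟩
    rw [SetLike.mem_coe, LinearMap.mem_ker] at hx
    rw [LinearMap.mem_ker, LinearMap.comp_apply, AlgHom.toLinearMap_apply, Rk_Rf_flipHom, hx,
      map_zero, smul_zero]

/-- The right invariants of `f k`. -/
theorem rightInvariants_f_mul_k : Uq.rightInvariants (ℂ ∙ (Uq.f P * Uq.k P)) =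
    Submodule.span ℂ {u | ∃ (n : ℕ) (j : Fin (n + 1)) (s : Fin 2),
      u = matrixElement P n 0 j * σ P ^ (s : ℕ)} := by
  have hf : Uq.counit P (Uq.f P) = 0 := Uq.counit_gen .f
  rw [Uq.rightInvariants_span_singleton (by rw [map_mul, hf, zero_mul]), Uq.rightAct_f_mul_k,
    ker_Rk_Rf P P.flip P.flip_t (by simp [Params.flip_t]), ker_Re, Submodule.map_iSup]
  have hflip : ∀ (i j s : ℕ), flipHom P P.flip P.flip_t
      (c P.flip ^ i * (d P.flip ^ j * σ P.flip ^ s)) =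
      P.t⁻¹ ^ (j * i) • (a P ^ j * b P ^ i * σ P ^ s) := by
    intro i j s
    have h1 : b P ^ i * a P ^ j = P.t⁻¹ ^ (j * i) • (a P ^ j * b P ^ i) := by
      have h2 := mul_pow_of_mul_eq_smul (ba_rel (P := P)) j
      induction i with
      | zero => simp
      | succ i ih =>
        rw [pow_succ', mul_assoc, ih, mul_smul_comm, mul_mul_of_mul_eq_smul h2, smul_smul,
          ← pow_add, Nat.mul_succ]
    have hc : flipHom P P.flip P.flip_t (c P.flip) = b P := flipHom_gen _ _ _ .c
    have hd : flipHom P P.flip P.flip_t (d P.flip) = a P := flipHom_gen _ _ _ .d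
    have hσ : flipHom P P.flip P.flip_t (σ P.flip) = σ P := flipHom_gen _ _ _ .σ
    rw [map_mul, map_mul, map_pow, map_pow, map_pow, hc, hd, hσ, ← mul_assoc, h1, smul_mul_assoc]
  apply le_antisymm
  · refine iSup_le fun p => Submodule.map_le_iff_le_comap.2 (Submodule.span_le.2 ?_)
    rintro _ ⟨i, j, -, rfl⟩
    -- The flip sends `c^i d^j` to a multiple of `a^j b^i`, which is found in column `i` for `n = j
    -- + i`.
    obtain ⟨κ, hκ, h⟩ := matrixElement_zero (P := P) (j + i)
    have hj := h ⟨i, by omega⟩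
    simp only [Nat.add_sub_cancel] at hj
    rw [SetLike.mem_coe, Submodule.mem_comap, AlgHom.toLinearMap_apply, hflip,
      ← inv_smul_smul₀ (hκ ⟨i, by omega⟩) (a P ^ j * b P ^ i), ← hj, smul_mul_assoc]
    exact Submodule.smul_mem _ _ (Submodule.smul_mem _ _
      (Submodule.subset_span ⟨j + i, ⟨i, by omega⟩, p.2, rfl⟩))
  · refine Submodule.span_le.2 ?_
    rintro _ ⟨n, j, s, rfl⟩
    obtain ⟨κ, -, h⟩ := matrixElement_zero (P := P) n
    have h1 := hflip j (n - j) s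
    rw [← inv_smul_eq_iff₀ (pow_ne_zero _ (inv_ne_zero P.t_ne_zero))] at h1
    rw [h, smul_mul_assoc, ← h1]
    exact Submodule.smul_mem _ _ (Submodule.smul_mem _ _ (Submodule.mem_iSup_of_mem _
      (Submodule.mem_map_of_mem (monomial_mem_cdSpan _ _ s))))

end Cq

/-! ### Injectivity from invertible coefficient matrices -/

section FiniteDimensional

variable {V ι : Type*} [AddCommGroup V] [Module ℂ V]

/-- A dimension count: the restriction of `T` to `W` has rank at least `dim W`. Stability of `W`
under `T` is not required. -/
theorem eq_zero_of_le_map (T : V →ₗ[ℂ] V) (W : Submodule ℂ V) [FiniteDimensional ℂ W]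
    (hW : W ≤ W.map T) {u : V} (hu : u ∈ W) (h0 : T u = 0) : u = 0 := by
  have h1 := LinearMap.finrank_range_add_finrank_ker (T.domRestrict W)
  rw [LinearMap.range_domRestrict] at h1
  have h2 := Submodule.finrank_mono hW
  have h3 : LinearMap.ker (T.domRestrict W) = ⊥ := Submodule.finrank_eq_zero.1 (by omega)
  have h4 : (⟨u, hu⟩ : W) ∈ LinearMap.ker (T.domRestrict W) := h0
  rw [h3, Submodule.mem_bot] at h4
  exact congrArg Subtype.val h4

/-- Preimages are written with `X⁻¹`. The `y i` may be dependent, so independence of the matrix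
elements is never needed. -/
theorem mem_map_of_det_ne_zero [Fintype ι] [DecidableEq ι] (T : V →ₗ[ℂ] V) (y : ι → V)
    (X : Matrix ι ι ℂ) (hX : X.det ≠ 0) (hT : ∀ i, T (y i) = ∑ l, X i l • y l)
    {W : Submodule ℂ V} (hy : ∀ i, y i ∈ W) (i : ι) : y i ∈ W.map T := by
  refine ⟨∑ l, X⁻¹ i l • y l, W.sum_mem fun l _ => W.smul_mem _ (hy l), ?_⟩
  simp only [map_sum, map_smul, hT, Finset.smul_sum, smul_smul]
  rw [Finset.sum_comm]
  simp only [← Finset.sum_smul, ← Matrix.mul_apply,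
    Matrix.nonsing_inv_mul X (isUnit_iff_ne_zero.2 hX), Matrix.one_apply]
  simp

end FiniteDimensional

/-! ### Left and right actions on the spaces of matrix elements -/

namespace Cq

variable {P : Params}

/-- `σ` is even and group-like, so multiplication by it on the right creates no sign. -/
theorem comulLin_mul_σ (u : Cq P) : comulLin P (u * σ P) =
    TensorProduct.map (LinearMap.mulRight ℂ (σ P)) (LinearMap.mulRight ℂ (σ P))
      (comulLin P u) := by
  suffices h : comulLin P ∘ₗ LinearMap.mulRight ℂ (σ P) =
      TensorProduct.map (LinearMap.mulRight ℂ (σ P)) (LinearMap.mulRight ℂ (σ P)) ∘ₗ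
        comulLin P from LinearMap.congr_fun h u
  refine linear_ext ?_ fun g x hx => ?_
  · have h := comulLin_gen_mul P .σ 1
    rw [mul_one, comulLin_one] at h
    simp [comulLin_one, h, comulOp]
  · simp only [LinearMap.comp_apply, LinearMap.mulRight_apply] at hx ⊢
    rw [mul_assoc, comulLin_gen_mul, hx, comulLin_gen_mul]
    generalize comulLin P x = z
    induction z using TensorProduct.induction_on with
    | zero => simp
    | tmul x y => cases g <;> simp [comulOp, mul_assoc]
    | add x y hx hy => simp only [map_add, hx, hy]

theorem comulLin_mul_σ_pow (u : Cq P) (s : ℕ) : comulLin P (u * σ P ^ s) =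
    TensorProduct.map (LinearMap.mulRight ℂ (σ P ^ s)) (LinearMap.mulRight ℂ (σ P ^ s))
      (comulLin P u) := by
  induction s with
  | zero => simp [LinearMap.mulRight_one]
  | succ s ih =>
    rw [pow_succ, ← mul_assoc, comulLin_mul_σ, ih, ← LinearMap.comp_apply,
      ← TensorProduct.map_comp, LinearMap.mulRight_mul]

theorem σ_pow_mul_σ_pow (s : ℕ) : σ P ^ s * σ P ^ s = 1 := by
  rw [← pow_add, ← two_mul, pow_mul, pow_two, σ_sq_rel, one_pow]

variable (P) in
/-- The vectors `a^{n-r} c^r σ^s`. -/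
def monomialBasis (n s : ℕ) (r : Fin (n + 1)) : Cq P :=
  a P ^ (n - (r : ℕ)) * c P ^ (r : ℕ) * σ P ^ s

variable (P) in
/-- The matrix elements with respect to the vectors `a^{n-r} c^r σ^s`. -/
def monomialMatrix (n s : ℕ) (i j : Fin (n + 1)) : Cq P :=
  ((ξCoeff P n i)⁻¹ * ξCoeff P n j) • (matrixElement P n i j * σ P ^ s)

/-- Dropping the scalars `ξCoeff` conjugates the matrix elements by a diagonal matrix: the square
roots disappear and the spans stay the same. -/
theorem isComoduleBasis_monomialBasis (n s : ℕ) :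
    IsComoduleBasis P (monomialBasis P n s) (monomialMatrix P n s) where
  linearIndependent := by
    refine (linearIndependent_monomial (P := P) n).map' (LinearMap.mulRight ℂ (σ P ^ s)) ?_
    refine LinearMap.ker_eq_bot_of_inverse (g := LinearMap.mulRight ℂ (σ P ^ s)) ?_
    rw [← LinearMap.mulRight_mul, σ_pow_mul_σ_pow, LinearMap.mulRight_one]
  comul_eq_sum i := by
    have h1 : monomialBasis P n s i = (ξCoeff P n i)⁻¹ • (ξ P n i * σ P ^ s) := by
      rw [ξ, smul_mul_assoc, inv_smul_smul₀ (ξCoeff_ne_zero P n i), monomialBasis]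
    rw [h1, map_smul, comulLin_mul_σ_pow, ← comul_eq, comul_ξ, map_sum, Finset.smul_sum]
    refine Finset.sum_congr rfl fun j _ => ?_
    rw [TensorProduct.map_tmul, LinearMap.mulRight_apply, LinearMap.mulRight_apply, monomialMatrix,
      monomialBasis, ξ, smul_mul_assoc, TensorProduct.tmul_smul, ← TensorProduct.smul_tmul',
      smul_smul]

theorem component_le (n s : ℕ) {W : Submodule ℂ (Cq P)}
    (h : ∀ i j, monomialMatrix P n s i j ∈ W) : component P n s ≤ W := by
  refine Submodule.span_le.2 ?_
  rintro _ ⟨⟨i, j⟩, rfl⟩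
  have hi := ξCoeff_ne_zero P n i
  have hj := ξCoeff_ne_zero P n j
  have h1 := h i j
  rwa [monomialMatrix, Submodule.smul_mem_iff _ (mul_ne_zero (inv_ne_zero hi) hj)] at h1

theorem monomialMatrix_mem (n s : ℕ) (i j : Fin (n + 1)) :
    monomialMatrix P n s i j ∈ component P n s :=
  Submodule.smul_mem _ _ (Submodule.subset_span ⟨(i, j), rfl⟩)

/-- The coproduct commutes with parity, and the basis vector of index `r` has the parity of `r`. -/
theorem parity_monomialMatrix (n s : ℕ) (i j : Fin (n + 1)) :
    parity P (monomialMatrix P n s i j) =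
      (-1 : ℂ) ^ ((i : ℕ) + j) • monomialMatrix P n s i j := by
  have hb := isComoduleBasis_monomialBasis (P := P) n s
  have hp : ∀ r, parity P (monomialBasis P n s r) = (-1 : ℂ) ^ (r : ℕ) • monomialBasis P n s r := by
    intro r
    rw [monomialBasis, map_mul, map_mul, map_pow, map_pow, map_pow, parity_a, parity_c, parity_σ,
      ← neg_one_smul ℂ (c P), smul_pow, mul_smul_comm, smul_mul_assoc]
  have h1 := comulLin_parity P (monomialBasis P n s i)
  rw [hp, map_smul, hb.comul_eq_sum, map_sum, Finset.smul_sum] at h1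
  simp only [TensorProduct.map_tmul, AlgHom.toLinearMap_apply, hp, TensorProduct.tmul_smul,
    TensorProduct.smul_tmul'] at h1
  have h2 := congrFun (sum_tmul_injective hb.linearIndependent h1) j
  rw [pow_add, mul_comm, ← smul_smul, h2, smul_smul, ← mul_pow]
  simp

/-- If `R_φ` acts invertibly on the comodules of index `n`, then it is injective on
`M_ℓ + M_ℓ σ`. -/
theorem eq_zero_of_rightOp_eq_zero (φ : Cq P →ₗ[ℂ] ℂ) (n : ℕ)
    (hdet : ∀ s < 2, (Matrix.of fun i j => φ (monomialMatrix P n s i j)).det ≠ 0)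
    {u : Cq P} (hu : u ∈ component P n 0 ⊔ component P n 1) (h0 : rightOp φ u = 0) : u = 0 := by
  have hfin : ∀ s, FiniteDimensional ℂ (component P n s) := fun s =>
    FiniteDimensional.span_of_finite ℂ (Set.finite_range _)
  refine eq_zero_of_le_map (rightOp φ) _ ?_ hu h0
  refine sup_le (component_le _ _ fun i j => ?_) (component_le _ _ fun i j => ?_)
  · exact mem_map_of_det_ne_zero _ (fun i => monomialMatrix P n 0 i j) _ (hdet 0 (by omega))
      (fun i => (isComoduleBasis_monomialBasis n 0).rightOp_matrix φ i j)
      (fun i => Submodule.mem_sup_left (monomialMatrix_mem n 0 i j)) i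
  · exact mem_map_of_det_ne_zero _ (fun i => monomialMatrix P n 1 i j) _ (hdet 1 (by omega))
      (fun i => (isComoduleBasis_monomialBasis n 1).rightOp_matrix φ i j)
      (fun i => Submodule.mem_sup_right (monomialMatrix_mem n 1 i j)) i

/-- The matrix of `L_x` on the `i`-th row of matrix elements. -/
def leftMatrix (x : Uq P) (n s i : ℕ) : Matrix (Fin (n + 1)) (Fin (n + 1)) ℂ := .of fun l j =>
  Uq.eval (evenPart (Uq.parity P) x) (monomialMatrix P n s l j) +
    (-1) ^ (i + (l : ℕ)) * Uq.eval (oddPart (Uq.parity P) x) (monomialMatrix P n s l j)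

/-- `L_x` mixes columns within a fixed row `i`. For odd `x` the sign is the parity of the first leg
`m_{il}`, which is why the coefficient matrix depends on the row. -/
theorem leftAct_monomialMatrix (x : Uq P) (n s : ℕ) (i j : Fin (n + 1)) :
    Uq.leftAct x (monomialMatrix P n s i j) =
      ∑ l, (leftMatrix x n s i).transpose j l • monomialMatrix P n s i l := by
  rw [Uq.leftAct, LinearMap.comp_apply, LinearMap.comp_apply, comul_eq,
    (isComoduleBasis_monomialBasis n s).comul_matrix, map_sum, map_sum]
  refine Finset.sum_congr rfl fun l _ => ?_
  simp only [Matrix.transpose_apply, leftMatrix, Matrix.of_apply, LinearMap.add_apply,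
    TensorProduct.map_tmul, LinearMap.id_apply,
    AlgHom.toLinearMap_apply, parity_monomialMatrix, LinearEquiv.coe_coe, map_add,
    TensorProduct.rid_tmul, smul_smul, add_smul]
  rw [mul_comm ((-1) ^ ((i : ℕ) + l))]

/-- If `L_x` acts invertibly on the comodules of index `n`, then it is injective on
`M_ℓ + M_ℓ σ`. -/
theorem eq_zero_of_leftAct_eq_zero (x : Uq P) (n : ℕ)
    (hdet : ∀ s < 2, ∀ i : ℕ, (leftMatrix x n s i).det ≠ 0)
    {u : Cq P} (hu : u ∈ component P n 0 ⊔ component P n 1) (h0 : Uq.leftAct x u = 0) :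
    u = 0 := by
  have hfin : ∀ s, FiniteDimensional ℂ (component P n s) := fun s =>
    FiniteDimensional.span_of_finite ℂ (Set.finite_range _)
  refine eq_zero_of_le_map (Uq.leftAct x) _ ?_ hu h0
  refine sup_le (component_le _ _ fun i j => ?_) (component_le _ _ fun i j => ?_)
  · refine mem_map_of_det_ne_zero _ (fun j => monomialMatrix P n 0 i j)
      (leftMatrix x n 0 i).transpose
      (by rw [Matrix.det_transpose]; exact hdet 0 (by omega) i)
      (fun j => leftAct_monomialMatrix x n 0 i j)
      (fun j => Submodule.mem_sup_left (monomialMatrix_mem n 0 i j)) j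
  · refine mem_map_of_det_ne_zero _ (fun j => monomialMatrix P n 1 i j)
      (leftMatrix x n 1 i).transpose
      (by rw [Matrix.det_transpose]; exact hdet 1 (by omega) i)
      (fun j => leftAct_monomialMatrix x n 1 i j)
      (fun j => Submodule.mem_sup_right (monomialMatrix_mem n 1 i j)) j

end Cq

/-! ### The elements `α e + β f k + γ (k - 1)` -/

namespace Uq

variable {P : Params}

variable (P) in
theorem counit_primitive (α β γ : ℂ) : counit P (primitive P α β γ) = 0 := by
  have hk : counit P (k P) = 1 := counit_gen .k
  have he : counit P (e P) = 0 := counit_gen .e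
  have hf : counit P (f P) = 0 := counit_gen .f
  simp [primitive, hk, he, hf]

variable (P) in
theorem parity_primitive (α β γ : ℂ) :
    parity P (primitive P α β γ) = primitive P (-α) (-β) γ := by
  have hk : parity P (k P) = k P := parity_gen .k
  have he : parity P (e P) = -e P := parity_gen .e
  have hf : parity P (f P) = -f P := parity_gen .f
  simp [primitive, hk, he, hf]

variable (P) in
theorem evenPart_primitive (α β γ : ℂ) :
    evenPart (parity P) (primitive P α β γ) = primitive P 0 0 γ := by
  simp only [evenPart, LinearMap.smul_apply, LinearMap.add_apply, LinearMap.id_apply,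
    AlgHom.toLinearMap_apply, parity_primitive]
  simp only [primitive]
  module

variable (P) in
theorem oddPart_primitive (α β γ : ℂ) :
    oddPart (parity P) (primitive P α β γ) = primitive P α β 0 := by
  simp only [oddPart, LinearMap.smul_apply, LinearMap.sub_apply, LinearMap.id_apply,
    AlgHom.toLinearMap_apply, parity_primitive]
  simp only [primitive]
  module

theorem rightAct_primitive (α β γ : ℂ) (u : Cq P) : rightAct (primitive P α β γ) u =
    α • Cq.Re P u + β • Cq.Rk P (Cq.Rf P u) + γ • (Cq.Rk P u - u) := by
  have h : ∀ x y : Uq P, rightAct (x + y) = rightAct x + rightAct y := fun x y => by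
    change Cq.rightOp (eval (x + y)) = _
    rw [eval_add, Cq.rightOp_add]
    rfl
  have h1 : rightAct (1 : Uq P) u = u := by
    change Cq.rightOp (eval 1) u = u
    rw [eval_one, Cq.rightOp_apply, Cq.contractLeft_counit]
  have hk : rightAct (k P) = Cq.Rk P := by
    change Cq.rightOp (eval (k P)) = _
    rw [eval_k, Cq.Rk]
  rw [primitive, h, h, rightAct_smul, rightAct_smul, rightAct_smul, rightAct_e, rightAct_f_mul_k,
    sub_eq_add_neg, ← neg_one_smul ℂ (1 : Uq P), h, rightAct_smul, hk]
  simp only [LinearMap.add_apply, LinearMap.smul_apply, h1, LinearMap.comp_apply, neg_one_smul,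
    sub_eq_add_neg]

end Uq

/-! ### Determinants for `ℓ = 1/2` and `ℓ = 1` -/

namespace Cq

variable {P : Params}

variable (P) in
/-- The matrix of `R_x`, `x = α e + β f k + γ (k - 1)`, on the vectors `a σ^s, c σ^s`, where
`w = (-1)^s`. -/
def primitiveMatrixOne (α β γ w : ℂ) : Matrix (Fin 2) (Fin 2) ℂ :=
  !![γ * (w * P.t - 1), α * eVal P; β * P.t, γ * (-w * P.t⁻¹ - 1)]

variable (P) in
/-- The matrix of `R_x`, `x = α e + β f k + γ (k - 1)`, on the vectors `a² σ^s, a c σ^s, c² σ^s`,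
where `w = (-1)^s`. -/
def primitiveMatrixTwo (α β γ w : ℂ) : Matrix (Fin 3) (Fin 3) ℂ :=
  !![γ * (w * P.t ^ 2 - 1), α * (eVal P * (P.t + P.t⁻¹)), 0;
    β * P.t ^ 2, γ * (-w - 1), α * eVal P;
    0, β * (P.t + P.t⁻¹), γ * (w * P.t⁻¹ ^ 2 - 1)]

theorem eval_primitive_monomialMatrix_one (α β γ : ℂ) (s : ℕ) (i j : Fin 2) :
    Uq.eval (Uq.primitive P α β γ) (monomialMatrix P 1 s i j) =
      primitiveMatrixOne P α β γ ((-1) ^ s) i j := by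
  have ht := P.t_ne_zero
  have hs : (-1 : ℂ) ^ s * (-1) ^ s = 1 := by rw [← mul_pow]; simp
  refine (isComoduleBasis_monomialBasis 1 s).apply_eq ?_ j
  change Uq.rightAct _ _ = _
  rw [Uq.rightAct_primitive]
  fin_cases i <;>
    simp [monomialBasis, primitiveMatrixOne, Re_gen_mul, Rf_gen_mul, Rk_gen_mul, Rk_σ_pow,
      RkInv_σ_pow, Re_σ_pow, Rf_σ_pow, smul_smul, hs] <;>
    match_scalars <;> first | ring1 | linear_combination β * P.t * hs

theorem eval_primitive_monomialMatrix_two (α β γ : ℂ) (s : ℕ) (i j : Fin 3) :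
    Uq.eval (Uq.primitive P α β γ) (monomialMatrix P 2 s i j) =
      primitiveMatrixTwo P α β γ ((-1) ^ s) i j := by
  have ht := P.t_ne_zero
  have hs : (-1 : ℂ) ^ s * (-1) ^ s = 1 := by rw [← mul_pow]; simp
  refine (isComoduleBasis_monomialBasis 2 s).apply_eq ?_ j
  change Uq.rightAct _ _ = _
  rw [Uq.rightAct_primitive]
  fin_cases i <;>
    simp [monomialBasis, primitiveMatrixTwo, pow_two, mul_assoc, Fin.sum_univ_succ,
      Re_gen_mul, Rf_gen_mul, Rk_gen_mul, RkInv_gen_mul, mul_mul_of_mul_eq_smul (ca_rel P),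
      Rk_σ_pow, RkInv_σ_pow, Re_σ_pow, Rf_σ_pow, smul_smul, mul_sub, hs] <;>
    match_scalars <;> (try field_simp) <;>
    first | ring1 | linear_combination β * hs | linear_combination (β * P.t ^ 2 + β) * hs

theorem det_primitiveMatrixOne (α β γ w : ℂ) (hw : w * w = 1) :
    (primitiveMatrixOne P α β γ w).det =
      γ ^ 2 * (w * (P.t⁻¹ - P.t)) - α * β * (eVal P * P.t) := by
  rw [primitiveMatrixOne, Matrix.det_fin_two_of]
  linear_combination (-γ ^ 2 * w * w) * P.t_mul_inv - γ ^ 2 * hw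

theorem det_primitiveMatrixTwo (α β γ w : ℂ) : (primitiveMatrixTwo P α β γ w).det =
    γ * (γ ^ 2 * ((w * P.t ^ 2 - 1) * (-w - 1) * (w * P.t⁻¹ ^ 2 - 1)) -
      α * β * (eVal P * (P.t + P.t⁻¹) *
        (P.t ^ 2 * (w * P.t⁻¹ ^ 2 - 1) + (w * P.t ^ 2 - 1)))) := by
  rw [primitiveMatrixTwo, Matrix.det_fin_three]
  simp
  ring

/-- The odd entries of row `l` carry the sign `(-1)^(i+l)`. In the determinant `α` and `β` occur
only as a product of entries from adjacent rows, whose signs are opposite, so the effect is `β ↦ -β`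
whatever `i` is. The same happens in size three. -/
theorem det_leftMatrix_one (α β γ : ℂ) (s i : ℕ) :
    (leftMatrix (Uq.primitive P α β γ) 1 s i).det =
      (primitiveMatrixOne P α (-β) γ ((-1) ^ s)).det := by
  have hi : (-1 : ℂ) ^ i * (-1) ^ i = 1 := by rw [← mul_pow]; simp
  have h : leftMatrix (Uq.primitive P α β γ) 1 s i = Matrix.of fun l j : Fin 2 =>
      primitiveMatrixOne P 0 0 γ ((-1) ^ s) l j +
        (-1) ^ (i + (l : ℕ)) * primitiveMatrixOne P α β 0 ((-1) ^ s) l j := by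
    ext l j
    rw [leftMatrix, Matrix.of_apply, Uq.evenPart_primitive, Uq.oddPart_primitive,
      eval_primitive_monomialMatrix_one, eval_primitive_monomialMatrix_one, Matrix.of_apply]
  rw [h, Matrix.det_fin_two, Matrix.det_fin_two]
  simp [primitiveMatrixOne, pow_succ]
  linear_combination (α * β * (eVal P * P.t)) * hi

theorem det_leftMatrix_two (α β γ : ℂ) (s i : ℕ) :
    (leftMatrix (Uq.primitive P α β γ) 2 s i).det =
      (primitiveMatrixTwo P α (-β) γ ((-1) ^ s)).det := by
  have hi : (-1 : ℂ) ^ i * (-1) ^ i = 1 := by rw [← mul_pow]; simp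
  have h : leftMatrix (Uq.primitive P α β γ) 2 s i = Matrix.of fun l j : Fin 3 =>
      primitiveMatrixTwo P 0 0 γ ((-1) ^ s) l j +
        (-1) ^ (i + (l : ℕ)) * primitiveMatrixTwo P α β 0 ((-1) ^ s) l j := by
    ext l j
    rw [leftMatrix, Matrix.of_apply, Uq.evenPart_primitive, Uq.oddPart_primitive,
      eval_primitive_monomialMatrix_two, eval_primitive_monomialMatrix_two, Matrix.of_apply]
  rw [h, Matrix.det_fin_three, Matrix.det_fin_three]
  simp [primitiveMatrixTwo, pow_succ]
  generalize (-1 : ℂ) ^ i = z at hi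
  generalize (-1 : ℂ) ^ s = w
  linear_combination (α * β * γ * eVal P * (P.t + P.t⁻¹) *
    (P.t * P.t * (w * (P.t⁻¹ * P.t⁻¹) - 1) + (w * (P.t * P.t) - 1))) * hi

/-- The condition at `ℓ = 1/2` makes `γ²` a nonzero multiple of `αβ`, so they vanish together; the
condition at `ℓ = 1` makes one of `γ` and `αβ` vanish. The two powers of `σ` involved may differ. -/
theorem eq_zero_of_det_eq_zero {α β γ : ℂ}
    (h1 : ∃ s < 2, (primitiveMatrixOne P α β γ ((-1) ^ s)).det = 0)
    (h2 : ∃ s < 2, (primitiveMatrixTwo P α β γ ((-1) ^ s)).det = 0) : γ = 0 ∧ α * β = 0 := by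
  have ht := P.t_ne_zero
  have hE := eVal_ne_zero (P := P)
  have hs : P.t - P.t⁻¹ ≠ 0 := sub_inv_ne_zero ht P.t_sq_ne_one
  have ht4 : P.t ^ 4 ≠ 1 := P.t_pow_ne_one 2 two_pos
  have hp : 1 + P.t ^ 2 ≠ 0 := fun h => ht4 (by linear_combination (P.t ^ 2 - 1) * h)
  have hp' : P.t + P.t⁻¹ ≠ 0 := fun h => hp (by
    linear_combination P.t * h - P.t_mul_inv)
  have key1 : ∃ w : ℂ, w ≠ 0 ∧ γ ^ 2 * (w * (P.t⁻¹ - P.t)) = α * β * (eVal P * P.t) := by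
    obtain ⟨s, -, h⟩ := h1
    refine ⟨(-1) ^ s, pow_ne_zero _ (by norm_num), ?_⟩
    rwa [det_primitiveMatrixOne _ _ _ _ (by rw [← mul_pow]; simp), sub_eq_zero] at h
  obtain ⟨w, hw, key1⟩ := key1
  have key2 : γ = 0 ∨ α * β = 0 := by
    obtain ⟨s, hs2, h⟩ := h2
    rw [det_primitiveMatrixTwo] at h
    obtain rfl | rfl : s = 0 ∨ s = 1 := by omega
    -- For `w = 1` the coefficient of `αβ` vanishes and `γ³` remains.
    · left
      have h3 : γ ^ 3 * (2 * (P.t - P.t⁻¹) ^ 2) = 0 := by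
        rw [← h]
        field_simp
        ring
      have h4 : (2 * (P.t - P.t⁻¹) ^ 2) ≠ 0 := mul_ne_zero two_ne_zero (pow_ne_zero _ hs)
      exact pow_eq_zero_iff (three_ne_zero) |>.1 ((mul_eq_zero.1 h3).resolve_right h4)
    -- For `w = -1` the middle diagonal entry `γ (-w - 1)` is zero, which removes the `γ³` term.
    · have h3 : γ * (α * β * (2 * eVal P * (P.t + P.t⁻¹) * (1 + P.t ^ 2))) = 0 := by
        rw [← h]
        field_simp
        ring
      refine (mul_eq_zero.1 h3).imp_right fun h4 => (mul_eq_zero.1 h4).resolve_right ?_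
      exact mul_ne_zero (mul_ne_zero (mul_ne_zero two_ne_zero hE) hp') hp
  have hEt : eVal P * P.t ≠ 0 := mul_ne_zero hE ht
  have hwt : w * (P.t⁻¹ - P.t) ≠ 0 := mul_ne_zero hw (by rw [← neg_sub]; exact neg_ne_zero.2 hs)
  rcases key2 with h | h
  · refine ⟨h, ?_⟩
    rw [h, zero_pow two_ne_zero, zero_mul, eq_comm] at key1
    exact (mul_eq_zero.1 key1).resolve_right hEt
  · refine ⟨?_, h⟩
    rw [h, zero_mul] at key1
    exact pow_eq_zero_iff two_ne_zero |>.1 ((mul_eq_zero.1 key1).resolve_right hwt)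

/-- An invariant for index `n` makes the coefficient matrix singular for some power of `σ`; only `n
= 1` and `n = 2` are used. -/
theorem of_rightInvariants {α β γ : ℂ} (h : ∀ n : ℕ, ∃ u ∈ component P n 0 ⊔ component P n 1,
    u ≠ 0 ∧ u ∈ Uq.rightInvariants (ℂ ∙ Uq.primitive P α β γ)) : γ = 0 ∧ α * β = 0 := by
  have hdet : ∀ n, ∃ s < 2, (Matrix.of fun i j =>
      Uq.eval (Uq.primitive P α β γ) (monomialMatrix P n s i j)).det = 0 := by
    intro n
    obtain ⟨u, hu, hu0, hinv⟩ := h n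
    by_contra hcon
    push Not at hcon
    rw [Uq.rightInvariants_span_singleton (Uq.counit_primitive P α β γ)] at hinv
    exact hu0 (eq_zero_of_rightOp_eq_zero _ n hcon hu hinv)
  refine eq_zero_of_det_eq_zero (P := P) ?_ ?_
  · obtain ⟨s, hs, hd⟩ := hdet 1
    refine ⟨s, hs, ?_⟩
    rw [← hd]
    congr 1
    ext i j
    exact (eval_primitive_monomialMatrix_one α β γ s i j).symm
  · obtain ⟨s, hs, hd⟩ := hdet 2
    refine ⟨s, hs, ?_⟩
    rw [← hd]
    congr 1
    ext i j
    exact (eval_primitive_monomialMatrix_two α β γ s i j).symm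

theorem of_leftInvariants {α β γ : ℂ} (h : ∀ n : ℕ, ∃ u ∈ component P n 0 ⊔ component P n 1,
    u ≠ 0 ∧ u ∈ Uq.leftInvariants (ℂ ∙ Uq.primitive P α β γ)) : γ = 0 ∧ α * β = 0 := by
  have hdet : ∀ n, ∃ s < 2, ∃ i, (leftMatrix (Uq.primitive P α β γ) n s i).det = 0 := by
    intro n
    obtain ⟨u, hu, hu0, hinv⟩ := h n
    by_contra hcon
    push Not at hcon
    rw [Uq.leftInvariants_span_singleton (Uq.counit_primitive P α β γ)] at hinv
    exact hu0 (eq_zero_of_leftAct_eq_zero _ n hcon hu hinv)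
  obtain ⟨s, hs, i, h1⟩ := hdet 1
  obtain ⟨s', hs', i', h2⟩ := hdet 2
  rw [det_leftMatrix_one] at h1
  rw [det_leftMatrix_two] at h2
  -- The determinants of the left action are those of the right action with `-β` in place of `β`,
  -- which does not affect the vanishing of `αβ`.
  obtain ⟨hγ, hαβ⟩ := eq_zero_of_det_eq_zero ⟨s, hs, h1⟩ ⟨s', hs', h2⟩
  exact ⟨hγ, by simpa using hαβ⟩

end Cq

end QuantumOSp

end

/-! ### The theorem -/

theorem theorem3p2 (P : QuantumOSp.Params) :
    (∀ α β γ : ℂ,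
      ((∀ n : ℕ, ∃ u ∈ QuantumOSp.Cq.component P n 0 ⊔ QuantumOSp.Cq.component P n 1, u ≠ 0 ∧
          u ∈ QuantumOSp.Uq.rightInvariants (ℂ ∙ QuantumOSp.Uq.primitive P α β γ)) ∨
        (∀ n : ℕ, ∃ u ∈ QuantumOSp.Cq.component P n 0 ⊔ QuantumOSp.Cq.component P n 1, u ≠ 0 ∧
          u ∈ QuantumOSp.Uq.leftInvariants (ℂ ∙ QuantumOSp.Uq.primitive P α β γ))) →
      ∃ z : ℂ, QuantumOSp.Uq.primitive P α β γ = z • QuantumOSp.Uq.e P ∨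
        QuantumOSp.Uq.primitive P α β γ = z • (QuantumOSp.Uq.f P * QuantumOSp.Uq.k P)) ∧
    QuantumOSp.Uq.rightInvariants (ℂ ∙ QuantumOSp.Uq.e P) =
      Submodule.span ℂ {u | ∃ (n : ℕ) (j : Fin (n + 1)) (s : Fin 2),
        u = QuantumOSp.Cq.matrixElement P n (Fin.last n) j * QuantumOSp.Cq.σ P ^ (s : ℕ)} ∧
    QuantumOSp.Uq.rightInvariants (ℂ ∙ (QuantumOSp.Uq.f P * QuantumOSp.Uq.k P)) =
      Submodule.span ℂ {u | ∃ (n : ℕ) (j : Fin (n + 1)) (s : Fin 2),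
        u = QuantumOSp.Cq.matrixElement P n 0 j * QuantumOSp.Cq.σ P ^ (s : ℕ)} := by
  refine ⟨fun α β γ h => ?_, QuantumOSp.Cq.rightInvariants_e,
    QuantumOSp.Cq.rightInvariants_f_mul_k⟩
  obtain ⟨rfl, hαβ⟩ : γ = 0 ∧ α * β = 0 :=
    h.elim QuantumOSp.Cq.of_rightInvariants QuantumOSp.Cq.of_leftInvariants
  rcases mul_eq_zero.1 hαβ with rfl | rfl
  · exact ⟨β, Or.inr (by simp [QuantumOSp.Uq.primitive])⟩
  · exact ⟨α, Or.inl (by simp [QuantumOSp.Uq.primitive])⟩
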